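/- Let $n\ge 2$ and let $CV_n$ be (projectivised) Outer Space of the free group $F_n$: classes of finite connected metric graphs $X$ with all vertices of valence at least three, marked by an isomorphism $F_n\cong\pi_1(X)$, up to homotheties compatible with the markings up to free homotopy. For a marked metric graph $X$ and a conjugacy class $\gamma$ of $F_n$ let $L_X(\gamma)$ be the length of the shortest closed curve in $X$ representing $\gamma$, and let $$d(X,Y)=\log\Big(\sup_\gamma\frac{L_X(\gamma)}{L_Y(\gamma)}\cdot\sup_\gamma\frac{L_Y(\gamma)}{L_X(\gamma)}\Big),$$ the suprema being over all nontrivial conjugacy classes; $d$ depends only on the classes of $X$ and $Y$ in $CV_n$. The (open) simplex of a marked graph $G$ is the set of classes of all metrics on $G$; a rose face of it is the simplex of a marked graph with exactly one vertex that is obtained from $G$ by collapsing some (possibly no) edges. A conjugacy class of $F_n$ is a simple loop in $G$ if it is represented in $G$ by an embedded circle, and an almost simple closed curve in $G$ if it is represented by an embedded circle, by a figure-eight (two embedded circles meeting in exactly one point, run through one after the other), or by a barbell (two disjoint embedded circles $a$, $b$ joined by an embedded arc $c$ meeting them only in its end points, run through as $a\,c\,b\,c^{-1}$). Let $\Delta_1$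 and $\Delta_2$ be simplices of $CV_n$ with the same set of rose faces, and let $G_1$ and $G_2$ be their underlying marked graphs. Let $\gamma_0$ be a simple loop in $G_1$. Then $\gamma_0$ is a simple loop in $G_2$, and every almost simple closed curve in $G_1$ is an almost simple closed curve in $G_2$. Moreover, let $X_1$ and $X_2$ be marked metric graphs with classes in $\Delta_1\cup\Delta_2$, normalised so that $L_{X_1}(\gamma_0)=L_{X_2}(\gamma_0)=1$, and suppose that $d(X_1,Y)=d(X_2,Y)$ for every point $Y$ of every rose face of $\Delta_1$. Then $L_{X_1}(\gamma)=L_{X_2}(\gamma)$ for every almost simple closed curve $\gamma$ in $G_1$. -/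

import Mathlib

/-! Finite graphs (loops and multiple edges allowed), edge paths, marked metric graphs,
Outer Space `CV n`, its simplices, rose faces, and the symmetric Lipschitz distance. -/

/-- A finite topological graph. Every edge carries an auxiliary orientation; an oriented edge is a
pair `(e, b)`, where `(e, true)` is `e` run from `src e` to `tgt e` and `(e, false)` is `e` run
backwards. -/
structure FinGraph where
  V : Type
  E : Type
  finV : Finite V
  finE : Finite E
  src : E → V
  tgt : E → V

namespace FinGraph

variable (G : FinGraph)

/-- Initial vertex of an oriented edge. -/
def init (d : G.E × Bool) : G.V := if d.2 then G.src d.1 else G.tgt d.1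

/-- Terminal vertex of an oriented edge. -/
def term (d : G.E × Bool) : G.V := if d.2 then G.tgt d.1 else G.src d.1

/-- `G.IsPath u p v`: the list `p` of oriented edges is an edge path from `u` to `v`. -/
def IsPath : G.V → List (G.E × Bool) → G.V → Prop
  | u, [], v => u = v
  | u, d :: p, v => G.init d = u ∧ IsPath (G.term d) p v

/-- The list of the initial vertices of the oriented edges of a path. -/
def verts (p : List (G.E × Bool)) : List G.V := p.map G.init

/-- The list of the (unoriented) edges of a path. -/
def edges (p : List (G.E × Bool)) : List G.E := p.map Prod.fst

theorem IsPath.append {G : FinGraph} {u v w : G.V} {p q : List (G.E × Bool)}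
    (hp : G.IsPath u p v) (hq : G.IsPath v q w) : G.IsPath u (p ++ q) w := by
  induction p generalizing u with
  | nil => cases hp; exact hq
  | cons d p ih => exact ⟨hp.1, ih hp.2⟩

theorem IsPath.invRev {G : FinGraph} {u v : G.V} {p : List (G.E × Bool)}
    (hp : G.IsPath u p v) : G.IsPath v (FreeGroup.invRev p) u := by
  induction p generalizing u with
  | nil => cases hp; rfl
  | cons d p ih =>
    have h2 : FreeGroup.invRev (d :: p) = FreeGroup.invRev p ++ [(d.1, !d.2)] := by
      simp [FreeGroup.invRev]
    rw [h2]
    refine (ih hp.2).append ⟨?_, ?_⟩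
    · cases d with | mk e b => cases b <;> rfl
    · have := hp.1
      cases d with | mk e b => cases b <;> exact this

/-- The fundamental group of `G` at `v`: homotopy classes of closed edge paths at `v`. Two edge
paths with the same end points are homotopic relative to the end points iff they differ by
insertions and deletions of backtrackings, that is, iff they define the same element of the free
group on the set of edges. -/
def pi1 (v : G.V) : Subgroup (FreeGroup G.E) where
  carrier := {g | ∃ p, G.IsPath v p v ∧ FreeGroup.mk p = g}
  one_mem' := ⟨[], rfl, rfl⟩
  mul_mem' := by
    rintro _ _ ⟨p, hp, rfl⟩ ⟨q, hq, rfl⟩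
    exact ⟨p ++ q, hp.append hq, FreeGroup.mul_mk.symm⟩
  inv_mem' := by
    rintro _ ⟨p, hp, rfl⟩
    exact ⟨FreeGroup.invRev p, hp.invRev, FreeGroup.inv_mk.symm⟩

/-- An embedded closed curve, started at the vertex `v`. -/
def IsSimpleClosed (v : G.V) (p : List (G.E × Bool)) : Prop :=
  p ≠ [] ∧ G.IsPath v p v ∧ (G.verts p).Nodup ∧ (G.edges p).Nodup

/-- A figure-eight curve: two simple closed curves `a`, `b` with exactly one common point `v`,
run through one after the other. -/
def IsFigureEight (v : G.V) (p : List (G.E × Bool)) : Prop :=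
  ∃ a b : List (G.E × Bool), p = a ++ b ∧
    G.IsSimpleClosed v a ∧ G.IsSimpleClosed v b ∧
    (G.verts a ++ (G.verts b).tail).Nodup ∧ (G.edges a ++ G.edges b).Nodup

/-- A barbell curve: disjoint simple closed curves `a` at `v` and `b` at `w`, joined by an embedded
arc `c` from `v` to `w` that meets them only in its end points; the curve runs through
`a`, `c`, `b` and `c` backwards. (The vertices of `a` and `b` being disjoint, `c` is
not constant.) -/
def IsBarbell (v : G.V) (p : List (G.E × Bool)) : Prop :=
  ∃ (w : G.V) (a c b : List (G.E × Bool)), p = a ++ c ++ b ++ FreeGroup.invRev c ∧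
    G.IsSimpleClosed v a ∧ G.IsPath v c w ∧ G.IsSimpleClosed w b ∧
    (G.verts a ++ (G.verts c).tail ++ G.verts b).Nodup ∧
    (G.edges a ++ G.edges c ++ G.edges b).Nodup

end FinGraph

/-- An isomorphism of graphs, given on vertices and on oriented edges. -/
structure GraphIso (G H : FinGraph) where
  onV : G.V ≃ H.V
  onD : G.E × Bool ≃ H.E × Bool
  onD_flip : ∀ d, onD (d.1, !d.2) = ((onD d).1, !(onD d).2)
  init_onD : ∀ d, H.init (onD d) = onV (G.init d)

namespace GraphIso

/-- The map induced on homotopy classes of edge paths. -/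
def hom {G H : FinGraph} (f : GraphIso G H) : FreeGroup G.E →* FreeGroup H.E :=
  FreeGroup.lift fun e => FreeGroup.mk [f.onD (e, true)]

theorem hom_mk {G H : FinGraph} (f : GraphIso G H) (p : List (G.E × Bool)) :
    f.hom (FreeGroup.mk p) = FreeGroup.mk (p.map f.onD) := by
  induction p with
  | nil => exact map_one f.hom
  | cons d p ih =>
    have h1 : FreeGroup.mk (d :: p) = FreeGroup.mk [d] * FreeGroup.mk p := by
      rw [FreeGroup.mul_mk]; rfl
    have h2 : FreeGroup.mk ((d :: p).map f.onD)
        = FreeGroup.mk [f.onD d] * FreeGroup.mk (p.map f.onD) := by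
      rw [FreeGroup.mul_mk]; rfl
    rw [h1, h2, map_mul, ih]
    congr 1
    obtain ⟨e, b⟩ := d
    have ht : FreeGroup.mk [(e, true)] = FreeGroup.of e := rfl
    cases b with
    | true => rw [ht]; simp [hom]
    | false =>
      have hf : (FreeGroup.mk [(e, false)] : FreeGroup G.E) = (FreeGroup.of e)⁻¹ := rfl
      have hfl := f.onD_flip (e, true)
      simp only [Bool.not_true] at hfl
      rw [hf, map_inv, hfl]
      simp [hom, FreeGroup.inv_mk, FreeGroup.invRev]

theorem term_onD {G H : FinGraph} (f : GraphIso G H) (d : G.E × Bool) :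
    H.term (f.onD d) = f.onV (G.term d) := by
  have h := f.init_onD (d.1, !d.2)
  rw [f.onD_flip] at h
  have e1 : ∀ (K : FinGraph) (x : K.E × Bool), K.init (x.1, !x.2) = K.term x := by
    rintro K ⟨e, b⟩; cases b <;> rfl
  rwa [e1, e1] at h

theorem isPath {G H : FinGraph} (f : GraphIso G H) {u v : G.V} {p : List (G.E × Bool)}
    (hp : G.IsPath u p v) : H.IsPath (f.onV u) (p.map f.onD) (f.onV v) := by
  induction p generalizing u with
  | nil => cases hp; rfl
  | cons d p ih =>
    refine ⟨?_, ?_⟩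
    · rw [f.init_onD, hp.1]
    · rw [f.term_onD]; exact ih hp.2

def refl (G : FinGraph) : GraphIso G G where
  onV := Equiv.refl _
  onD := Equiv.refl _
  onD_flip _ := rfl
  init_onD _ := rfl

def symm {G H : FinGraph} (f : GraphIso G H) : GraphIso H G where
  onV := f.onV.symm
  onD := f.onD.symm
  onD_flip d := by
    apply f.onD.injective
    rw [f.onD_flip]
    simp
  init_onD d := by
    apply f.onV.injective
    rw [← f.init_onD]
    simp

def trans {G H K : FinGraph} (f : GraphIso G H) (g : GraphIso H K) : GraphIso G K where
  onV := f.onV.trans g.onV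
  onD := f.onD.trans g.onD
  onD_flip d := by simp [f.onD_flip, g.onD_flip]
  init_onD d := by simp [f.init_onD, g.init_onD]

theorem hom_symm_hom {G H : FinGraph} (f : GraphIso G H) (x : FreeGroup G.E) :
    f.symm.hom (f.hom x) = x := by
  obtain ⟨p, rfl⟩ := Quot.exists_rep x
  change f.symm.hom (f.hom (FreeGroup.mk p)) = FreeGroup.mk p
  rw [hom_mk, hom_mk, List.map_map]
  congr 1
  simp [symm]

theorem hom_trans {G H K : FinGraph} (f : GraphIso G H) (g : GraphIso H K) (x : FreeGroup G.E) :
    (f.trans g).hom x = g.hom (f.hom x) := by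
  obtain ⟨p, rfl⟩ := Quot.exists_rep x
  change (f.trans g).hom (FreeGroup.mk p) = g.hom (f.hom (FreeGroup.mk p))
  rw [hom_mk, hom_mk, hom_mk, List.map_map]
  rfl

theorem hom_refl {G : FinGraph} (x : FreeGroup G.E) : (refl G).hom x = x := by
  obtain ⟨p, rfl⟩ := Quot.exists_rep x
  change (refl G).hom (FreeGroup.mk p) = FreeGroup.mk p
  rw [hom_mk]
  simp [refl]

end GraphIso

/-- A marked graph of rank `n`: a finite connected graph, all of whose vertices have valence at
least three, with an isomorphism from the free group of rank `n` onto its fundamental group. -/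
structure MarkedGraph (n : ℕ) extends FinGraph where
  connected : ∀ u v : V, ∃ p, toFinGraph.IsPath u p v
  valence : ∀ v : V, 3 ≤ Nat.card {d : E × Bool // toFinGraph.init d = v}
  base : V
  marking : FreeGroup (Fin n) →* FreeGroup E
  marking_injective : Function.Injective marking
  marking_range : marking.range = toFinGraph.pi1 base

/-- A marked metric graph of rank `n`: a marked graph with positive edge lengths. -/
structure MarkedMetricGraph (n : ℕ) extends MarkedGraph n where
  len : E → ℝ
  len_pos : ∀ e, 0 < len e

namespace MarkedGraph

variable {n : ℕ} (G : MarkedGraph n)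

/-- The closed edge path `p` at `v` is in the free homotopy class of closed curves of `G` that
corresponds to the conjugacy class of `γ` under the marking. -/
def Represents (v : G.V) (p : List (G.E × Bool)) (γ : FreeGroup (Fin n)) : Prop :=
  G.IsPath v p v ∧ ∃ u : List (G.E × Bool), G.IsPath G.base u v ∧
    FreeGroup.mk u * FreeGroup.mk p * (FreeGroup.mk u)⁻¹ = G.marking γ

/-- The conjugacy class of `γ` is represented by a simple loop of `G`. -/
def IsSimpleLoop (γ : FreeGroup (Fin n)) : Prop :=
  ∃ v p, G.IsSimpleClosed v p ∧ G.Represents v p γ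

/-- The conjugacy class of `γ` is represented by an almost simple closed curve of `G`: a simple
closed curve, a figure-eight curve or a barbell curve. -/
def IsAlmostSimple (γ : FreeGroup (Fin n)) : Prop :=
  ∃ v p, (G.IsSimpleClosed v p ∨ G.IsFigureEight v p ∨ G.IsBarbell v p) ∧ G.Represents v p γ

/-- The graph is a rose: it has exactly one vertex. -/
def IsRose : Prop := ∀ v : G.V, v = G.base

/-- An isomorphism of graphs commutes with the markings up to free homotopy. -/
def IsoCompatible {G H : MarkedGraph n} (f : GraphIso G.toFinGraph H.toFinGraph) : Prop :=
  ∃ u : List (H.E × Bool), H.IsPath H.base u (f.onV G.base) ∧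
    ∀ γ, FreeGroup.mk u * f.hom (G.marking γ) * (FreeGroup.mk u)⁻¹ = H.marking γ

end MarkedGraph

/-- A map `G → H` that collapses some edges of `G` and is otherwise an isomorphism. An edge `e` is
collapsed iff `onE e = none`; an edge that is not collapsed is mapped to an oriented edge. The
fibres over the vertices of `H` are the components of the union of the collapsed edges (and of
all vertices). -/
structure Collapse (G H : FinGraph) where
  onV : G.V → H.V
  onE : G.E → Option (H.E × Bool)
  onV_surjective : Function.Surjective onV
  onE_bijective : ∀ e' : H.E, ∃! e : G.E, ∃ b : Bool, onE e = some (e', b)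
  init_onE : ∀ e d, onE e = some d → onV (G.src e) = H.init d
  term_onE : ∀ e d, onE e = some d → onV (G.tgt e) = H.term d
  fibre : ∀ u v, onV u = onV v ↔ ∃ p, G.IsPath u p v ∧ ∀ d ∈ p, onE d.1 = none

/-- The map induced by a collapse on homotopy classes of edge paths. -/
def Collapse.hom {G H : FinGraph} (c : Collapse G H) : FreeGroup G.E →* FreeGroup H.E :=
  FreeGroup.lift fun e => (c.onE e).elim 1 fun d => FreeGroup.mk [d]

/-- `H.IsFaceOf G`: the marked graph `H` is obtained from `G` by collapsing some (possibly no)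
edges, the marking of `H` being that of `G` followed by the collapse, up to free homotopy. As both
are marked graphs of rank `n`, only forests can be collapsed. -/
def MarkedGraph.IsFaceOf {n : ℕ} (H G : MarkedGraph n) : Prop :=
  ∃ c : Collapse G.toFinGraph H.toFinGraph, ∃ u : List (H.E × Bool),
    H.IsPath H.base u (c.onV G.base) ∧
    ∀ γ, FreeGroup.mk u * c.hom (G.marking γ) * (FreeGroup.mk u)⁻¹ = H.marking γ

namespace MarkedMetricGraph

variable {n : ℕ}

/-- Length of an edge path. -/
def pathLen (X : MarkedMetricGraph n) (p : List (X.E × Bool)) : ℝ :=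
  (p.map fun d => X.len d.1).sum

/-- `L_X(γ)`: the length of a shortest closed edge path in the free homotopy class of `γ`. -/
noncomputable def L (X : MarkedMetricGraph n) (γ : FreeGroup (Fin n)) : ℝ :=
  sInf {l : ℝ | ∃ v p, X.Represents v p γ ∧ X.pathLen p = l}

/-- `sup_γ L_X(γ) / L_Y(γ)`, over all nontrivial conjugacy classes of the free group. -/
noncomputable def stretch (X Y : MarkedMetricGraph n) : ℝ :=
  ⨆ γ : {γ : FreeGroup (Fin n) // γ ≠ 1}, X.L γ / Y.L γ

/-- Marked metric graphs are equivalent if a homothety (by the factor `r`) between them commutes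
with the markings up to free homotopy. Homotheties preserve valences, hence map vertices to
vertices. -/
def Equivalent (X Y : MarkedMetricGraph n) : Prop :=
  ∃ f : GraphIso X.toFinGraph Y.toFinGraph, MarkedGraph.IsoCompatible f ∧
    ∃ r : ℝ, 0 < r ∧ ∀ d, Y.len (f.onD d).1 = r * X.len d.1

end MarkedMetricGraph

namespace MarkedGraph

variable {n : ℕ}

theorem isoCompatible_refl (G : MarkedGraph n) :
    IsoCompatible (G := G) (H := G) (GraphIso.refl G.toFinGraph) := by
  refine ⟨[], rfl, fun γ => ?_⟩
  rw [GraphIso.hom_refl, ← FreeGroup.one_eq_mk]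
  simp

theorem IsoCompatible.symm {G H : MarkedGraph n} {f : GraphIso G.toFinGraph H.toFinGraph}
    (h : IsoCompatible f) : IsoCompatible (G := H) (H := G) f.symm := by
  obtain ⟨u, hu, h⟩ := h
  refine ⟨(FreeGroup.invRev u).map f.symm.onD, ?_, fun γ => ?_⟩
  · have := f.symm.isPath hu.invRev
    have e : f.symm.onV (f.onV G.base) = G.base := f.onV.symm_apply_apply _
    rwa [e] at this
  · rw [← GraphIso.hom_mk, ← FreeGroup.inv_mk, ← h γ]
    simp only [map_mul, map_inv, GraphIso.hom_symm_hom]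
    group

theorem IsoCompatible.trans {G H K : MarkedGraph n} {f : GraphIso G.toFinGraph H.toFinGraph}
    {g : GraphIso H.toFinGraph K.toFinGraph} (hf : IsoCompatible f) (hg : IsoCompatible g) :
    IsoCompatible (G := G) (H := K) (f.trans g) := by
  obtain ⟨u, hu, hf⟩ := hf
  obtain ⟨w, hw, hg⟩ := hg
  refine ⟨w ++ u.map g.onD, hw.append (g.isPath hu), fun γ => ?_⟩
  rw [← FreeGroup.mul_mk, ← GraphIso.hom_mk, GraphIso.hom_trans, ← hg γ, ← hf γ]
  simp only [map_mul, map_inv]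
  group

theorem Represents.map {G H : MarkedGraph n} {f : GraphIso G.toFinGraph H.toFinGraph}
    (hf : IsoCompatible f) {v : G.V} {p : List (G.E × Bool)} {γ : FreeGroup (Fin n)}
    (h : G.Represents v p γ) : H.Represents (f.onV v) (p.map f.onD) γ := by
  obtain ⟨hp, u, hu, hup⟩ := h
  obtain ⟨w, hw, hf⟩ := hf
  refine ⟨f.isPath hp, w ++ u.map f.onD, hw.append (f.isPath hu), ?_⟩
  rw [← FreeGroup.mul_mk, ← GraphIso.hom_mk, ← GraphIso.hom_mk, ← hf γ, ← hup]
  simp only [map_mul, map_inv]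
  group

end MarkedGraph

namespace MarkedMetricGraph

variable {n : ℕ}

theorem Equivalent.refl (X : MarkedMetricGraph n) : X.Equivalent X :=
  ⟨GraphIso.refl _, X.isoCompatible_refl, 1, one_pos, fun d => by simp [GraphIso.refl]⟩

theorem Equivalent.symm {X Y : MarkedMetricGraph n} (h : X.Equivalent Y) : Y.Equivalent X := by
  obtain ⟨f, hf, r, hr, h⟩ := h
  refine ⟨f.symm, hf.symm, r⁻¹, inv_pos.2 hr, fun d => ?_⟩
  have := h (f.symm.onD d)
  have e : f.onD (f.symm.onD d) = d := f.onD.apply_symm_apply d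
  rw [e] at this
  rw [this, inv_mul_cancel_left₀ hr.ne']

theorem Equivalent.trans {X Y Z : MarkedMetricGraph n} (h : X.Equivalent Y)
    (h' : Y.Equivalent Z) : X.Equivalent Z := by
  obtain ⟨f, hf, r, hr, h⟩ := h
  obtain ⟨g, hg, s, hs, h'⟩ := h'
  refine ⟨f.trans g, hf.trans hg, s * r, mul_pos hs hr, fun d => ?_⟩
  have e : (f.trans g).onD d = g.onD (f.onD d) := rfl
  rw [e, h', h, mul_assoc]

instance setoid (n : ℕ) : Setoid (MarkedMetricGraph n) where
  r := Equivalent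
  iseqv := ⟨Equivalent.refl, Equivalent.symm, Equivalent.trans⟩

theorem exists_L_eq_mul {X Y : MarkedMetricGraph n} (h : X.Equivalent Y) :
    ∃ r : ℝ, 0 < r ∧ ∀ γ, Y.L γ = r * X.L γ := by
  have key : ∀ {X Y : MarkedMetricGraph n} (f : GraphIso X.toFinGraph Y.toFinGraph)
      (_ : MarkedGraph.IsoCompatible f) (r : ℝ) (_ : ∀ d, Y.len (f.onD d).1 = r * X.len d.1)
      (γ : FreeGroup (Fin n)) (l : ℝ), (∃ v p, X.Represents v p γ ∧ X.pathLen p = l) →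
      ∃ v p, Y.Represents v p γ ∧ Y.pathLen p = r * l := by
    rintro X Y f hf r h γ l ⟨v, p, hp, rfl⟩
    refine ⟨f.onV v, p.map f.onD, hp.map hf, ?_⟩
    unfold pathLen
    rw [List.map_map, ← List.sum_map_mul_left]
    congr 1
    apply List.map_congr_left
    intro d _
    exact h d
  have h' := h.symm
  obtain ⟨f, hf, r, hr, h⟩ := h
  refine ⟨r, hr, fun γ => ?_⟩
  unfold L
  rw [← smul_eq_mul, ← Real.sInf_smul_of_nonneg hr.le]
  congr 1
  ext l
  rw [Set.mem_smul_set]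
  constructor
  · intro hl
    refine ⟨r⁻¹ * l, key f.symm hf.symm r⁻¹ (fun d => ?_) γ l hl, ?_⟩
    · have := h (f.symm.onD d)
      have e : f.onD (f.symm.onD d) = d := f.onD.apply_symm_apply d
      rw [e] at this
      rw [this, inv_mul_cancel_left₀ hr.ne']
    · rw [smul_eq_mul, mul_inv_cancel_left₀ hr.ne']
  · rintro ⟨l, hl, rfl⟩
    exact key f hf r h γ l hl

/-- The symmetric Lipschitz distance
`log (sup_γ L_X(γ) / L_Y(γ) * sup_γ L_Y(γ) / L_X(γ))` of marked metric graphs. -/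
noncomputable def dist (X Y : MarkedMetricGraph n) : ℝ :=
  Real.log (X.stretch Y * Y.stretch X)

theorem dist_comm (X Y : MarkedMetricGraph n) : X.dist Y = Y.dist X := by
  unfold dist
  rw [mul_comm]

theorem dist_congr_left {X X' : MarkedMetricGraph n} (h : X.Equivalent X')
    (Y : MarkedMetricGraph n) : X.dist Y = X'.dist Y := by
  obtain ⟨r, hr, h⟩ := exists_L_eq_mul h
  have h1 : X'.stretch Y = r * X.stretch Y := by
    unfold stretch
    rw [Real.mul_iSup_of_nonneg hr.le]
    simp only [h, mul_div_assoc]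
  have h2 : Y.stretch X' = r⁻¹ * Y.stretch X := by
    unfold stretch
    rw [Real.mul_iSup_of_nonneg (inv_pos.2 hr).le]
    refine iSup_congr fun γ => ?_
    rw [h, div_mul_eq_div_div, div_eq_mul_inv _ r]
    ring
  unfold dist
  rw [h1, h2]
  congr 1
  field_simp

end MarkedMetricGraph

/-- Outer Space of rank `n`. -/
def CV (n : ℕ) : Type 1 := Quotient (MarkedMetricGraph.setoid n)

/-- The class `[X]` in Outer Space of a marked metric graph. -/
def CV.mk {n : ℕ} (X : MarkedMetricGraph n) : CV n := Quotient.mk _ X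

/-- The symmetric Lipschitz distance on Outer Space. -/
noncomputable def CV.dist {n : ℕ} : CV n → CV n → ℝ :=
  Quotient.lift₂ MarkedMetricGraph.dist fun X Y X' Y' hX hY => by
    rw [MarkedMetricGraph.dist_congr_left hX, MarkedMetricGraph.dist_comm,
      MarkedMetricGraph.dist_congr_left hY, MarkedMetricGraph.dist_comm]

/-- The open simplex of `CV n` with underlying marked graph `G`: all classes of metrics on `G`. -/
def MarkedGraph.simplex {n : ℕ} (G : MarkedGraph n) : Set (CV n) :=
  {x | ∃ (l : G.E → ℝ) (hl : ∀ e, 0 < l e),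
    x = CV.mk { toMarkedGraph := G, len := l, len_pos := hl }}

/-- The rose faces of the simplex with underlying marked graph `G`: the simplices whose underlying
marked graph is a rose and is obtained from `G` by collapsing some (possibly no) edges. -/
def MarkedGraph.roseFaces {n : ℕ} (G : MarkedGraph n) : Set (Set (CV n)) :=
  {S | ∃ R : MarkedGraph n, R.IsRose ∧ R.IsFaceOf G ∧ S = R.simplex}

/-! Combinatorial part. The rose faces of a simplex are the collapses of spanning trees of its
graph, and their petals are exactly the simple loops: all edges of a loop but one extend to a
spanning tree. Hence the simple loops depend only on the set of rose faces. In the same way a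
figure-eight or barbell is a product `ββ'` of two different petals of a suitable rose face.
Conversely, such a product lifts to a closed path `d q d' q'` with `q`, `q'` reduced paths in the
tree. If `q` and `q'` have no common vertex, the curve is a simple loop. If they run over an edge in
the same direction, that edge is a petal of another rose face, in which the curve has exponent sum
`±2`; but an almost simple curve has exponent sums in `{-1, 0, 1}` in every rose face. In the
remaining case `q` and `q'` form an `H` in the tree, and the curve is a figure-eight or barbell
(`Compat.isSimpleLoop_or_isSeparated`).

Metric part. Let `Y` be a rose `R` with petal lengths `y`. Closed lifts of the petals at a common
base point of `X`, of lengths `K`, bound `L_X` by the length with weights `K`. If `K ≤ M * y` and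
some class is stretched by `M`, then `d(X, Y) = log (M * ratioSup y)`, where `ratioSup y` is the
supremum of `L_Y / L_X`. Now let the petals in a set `S` shrink in fixed proportions. In the limit
the equality of the distances becomes `M₁ * ratioSup₁ z = M₂ * ratioSup₂ z` for all weights `z` that
vanish on `S` (`mul_ratioSup_eq_of_small`).

If one petal `γ` shrinks, `M` is `L(γ)`. In rank at least three, `z` can be supported on a third
petal, and the quotient `L_{X₁} / L_{X₂}` takes the same value at any two petals of `R`. In rank two
the graph is a rose, a theta or a dumbbell, and the value of `ratioSup` at a single petal is `1 /
min (L γ) s` with the same `s` for both petals; the two equations obtained again force equal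
quotients (`mul_eq_mul_of_min_eq`). Spanning trees are connected by exchanges, and the roses of
trees related by an exchange share a petal, so the quotient is constant on all simple loops
(`eq_of_isSimpleLoop`); by the normalisation at `γ₀` it is `1`.

Finally let the two petals `γ₁`, `γ₂` of a figure-eight or barbell `γ` shrink in proportion to their
lengths. Seen from the point of the joining arc that balances the two loops, `M = L(γ) / (L(γ₁) +
L(γ₂))`. Comparison on a third petal, or in rank two the fact that `ratioSup` is `1` at the rose
with these petal lengths, yields `L(γ)`. -/

/-! ### Words in free groups: weights, exponent sums, reducedness -/

section Words

variable {α : Type*}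

/-- Total weight of a word, each letter having the weight of its generator. -/
def wordWeight (z : α → ℝ) (p : List (α × Bool)) : ℝ := (p.map fun d => z d.1).sum

@[simp] theorem wordWeight_nil (z : α → ℝ) : wordWeight z [] = 0 := rfl

@[simp] theorem wordWeight_cons (z : α → ℝ) (d : α × Bool) (p : List (α × Bool)) :
    wordWeight z (d :: p) = z d.1 + wordWeight z p := by simp [wordWeight]

@[simp] theorem wordWeight_append (z : α → ℝ) (p q : List (α × Bool)) :
    wordWeight z (p ++ q) = wordWeight z p + wordWeight z q := by simp [wordWeight]

@[simp] theorem wordWeight_invRev (z : α → ℝ) (p : List (α × Bool)) :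
    wordWeight z (FreeGroup.invRev p) = wordWeight z p := by
  induction p with
  | nil => rfl
  | cons d p ih =>
    rw [FreeGroup.invRev_cons, wordWeight_append, ih, wordWeight_cons]
    simp [FreeGroup.invRev, add_comm]

theorem wordWeight_add (z z' : α → ℝ) (p : List (α × Bool)) :
    wordWeight (fun e => z e + z' e) p = wordWeight z p + wordWeight z' p := by
  induction p with
  | nil => simp
  | cons d p ih => simp only [wordWeight_cons, ih]; ring

theorem wordWeight_smul (r : ℝ) (z : α → ℝ) (p : List (α × Bool)) :
    wordWeight (fun e => r * z e) p = r * wordWeight z p := by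
  induction p with
  | nil => simp
  | cons d p ih => simp only [wordWeight_cons, ih]; ring

theorem wordWeight_mono {z z' : α → ℝ} {p : List (α × Bool)} (h : ∀ d ∈ p, z d.1 ≤ z' d.1) :
    wordWeight z p ≤ wordWeight z' p := by
  induction p with
  | nil => simp
  | cons d p ih =>
    simp only [wordWeight_cons]
    exact add_le_add (h d (by simp)) (ih fun d' hd => h d' (by simp [hd]))

theorem wordWeight_nonneg {z : α → ℝ} (hz : ∀ e, 0 ≤ z e) (p : List (α × Bool)) :
    0 ≤ wordWeight z p := by
  induction p with
  | nil => simp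
  | cons d p ih => simp only [wordWeight_cons]; exact add_nonneg (hz _) ih

theorem wordWeight_sublist {z : α → ℝ} (hz : ∀ e, 0 ≤ z e) {p q : List (α × Bool)}
    (h : p.Sublist q) : wordWeight z p ≤ wordWeight z q := by
  induction h with
  | slnil => simp
  | cons d _ ih => simp only [wordWeight_cons]; linarith [hz d.1]
  | cons_cons d _ ih => simp only [wordWeight_cons]; linarith

theorem wordWeight_flatten_replicate (z : α → ℝ) (k : ℕ) (p : List (α × Bool)) :
    wordWeight z (List.replicate k p).flatten = k * wordWeight z p := by
  induction k with
  | zero => simp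
  | succ k ih =>
    rw [List.replicate_succ, List.flatten_cons, wordWeight_append, ih]; push_cast; ring

theorem wordWeight_le_of_isReduced {z : α → ℝ} (hz : ∀ e, 0 ≤ z e) {p q : List (α × Bool)}
    (hp : FreeGroup.IsReduced p) (h : FreeGroup.mk p = FreeGroup.mk q) :
    wordWeight z p ≤ wordWeight z q := by
  classical
  have h1 := FreeGroup.reduce.sound h
  rw [hp.reduce_eq] at h1
  exact wordWeight_sublist hz (h1 ▸ (FreeGroup.reduce.red (L := q)).sublist)

/-- A cyclically reduced word has the smallest weight in its conjugacy class. -/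
theorem wordWeight_le_of_isCyclicallyReduced {z : α → ℝ} (hz : ∀ e, 0 ≤ z e)
    {p q : List (α × Bool)} (hp : FreeGroup.IsCyclicallyReduced p)
    (h : IsConj (FreeGroup.mk p) (FreeGroup.mk q)) : wordWeight z p ≤ wordWeight z q := by
  classical
  obtain ⟨g, hg⟩ := isConj_iff.1 h
  obtain ⟨u, rfl⟩ := Quot.exists_rep g
  change FreeGroup.mk u * FreeGroup.mk p * (FreeGroup.mk u)⁻¹ = FreeGroup.mk q at hg
  -- Powers of a cyclically reduced word stay reduced, while the conjugator contributes a bounded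
  -- amount, which becomes negligible as `k` grows.
  have key : ∀ k : ℕ, (k : ℝ) * wordWeight z p ≤ 2 * wordWeight z u + k * wordWeight z q := by
    intro k
    have h1 : FreeGroup.mk (List.replicate k p).flatten
        = FreeGroup.mk (FreeGroup.invRev u ++ (List.replicate k q).flatten ++ u) := by
      rw [← FreeGroup.mul_mk, ← FreeGroup.mul_mk, ← FreeGroup.pow_mk, ← FreeGroup.pow_mk, ← hg,
        ← FreeGroup.inv_mk, conj_pow]
      group
    have h2 := wordWeight_le_of_isReduced hz (hp.flatten_replicate k).isReduced h1
    simp only [wordWeight_append, wordWeight_invRev, wordWeight_flatten_replicate] at h2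
    linarith
  by_contra! hlt
  obtain ⟨k, hk⟩ := exists_nat_gt (2 * wordWeight z u / (wordWeight z p - wordWeight z q))
  rw [div_lt_iff₀ (by linarith)] at hk
  linarith [key k]

open Classical in
/-- Exponent sum of a generator in an element of a free group. -/
noncomputable def expSum (e : α) (x : FreeGroup α) : ℤ :=
  Multiplicative.toAdd
    (FreeGroup.lift (fun a => if a = e then Multiplicative.ofAdd (1 : ℤ) else 1) x)

@[simp] theorem expSum_one (e : α) : expSum e 1 = 0 := by simp [expSum]

@[simp] theorem expSum_mul (e : α) (x y : FreeGroup α) :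
    expSum e (x * y) = expSum e x + expSum e y := by simp [expSum]

@[simp] theorem expSum_inv (e : α) (x : FreeGroup α) : expSum e x⁻¹ = -expSum e x := by
  simp [expSum]

theorem expSum_eq_of_isConj (e : α) {x y : FreeGroup α} (h : IsConj x y) :
    expSum e x = expSum e y := by
  obtain ⟨g, rfl⟩ := isConj_iff.1 h
  simp

theorem expSum_of_ne {e a : α} (h : a ≠ e) : expSum e (FreeGroup.of a) = 0 := by
  simp [expSum, h]

theorem expSum_of_self (e : α) : expSum e (FreeGroup.of e) = 1 := by simp [expSum]

/-- Sign of an oriented letter. -/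
def letterSign (b : Bool) : ℤ := if b then 1 else -1

theorem letterSign_abs (b : Bool) : |letterSign b| = 1 := by cases b <;> simp [letterSign]

theorem mk_singleton_true (a : α) : FreeGroup.mk [(a, true)] = FreeGroup.of a := rfl

theorem mk_singleton_false (a : α) : FreeGroup.mk [(a, false)] = (FreeGroup.of a)⁻¹ := rfl

theorem mk_cons (d : α × Bool) (p : List (α × Bool)) :
    FreeGroup.mk (d :: p) = FreeGroup.mk [d] * FreeGroup.mk p := by
  rw [FreeGroup.mul_mk]; rfl

theorem expSum_mk_singleton_of_ne {e : α} {d : α × Bool} (h : d.1 ≠ e) :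
    expSum e (FreeGroup.mk [d]) = 0 := by
  obtain ⟨a, b⟩ := d
  cases b
  · rw [mk_singleton_false, expSum_inv, expSum_of_ne h, neg_zero]
  · rw [mk_singleton_true, expSum_of_ne h]

theorem expSum_mk_singleton (e : α) (b : Bool) :
    expSum e (FreeGroup.mk [(e, b)]) = letterSign b := by
  cases b
  · rw [mk_singleton_false, expSum_inv, expSum_of_self]; rfl
  · rw [mk_singleton_true, expSum_of_self]; rfl

theorem expSum_mk_eq_zero {e : α} {p : List (α × Bool)} (h : ∀ d ∈ p, d.1 ≠ e) :
    expSum e (FreeGroup.mk p) = 0 := by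
  induction p with
  | nil => exact expSum_one e
  | cons d p ih =>
    rw [mk_cons, expSum_mul, expSum_mk_singleton_of_ne (h d (by simp)),
      ih fun d' hd => h d' (by simp [hd]), zero_add]

theorem expSum_mk_append (e : α) (p q : List (α × Bool)) :
    expSum e (FreeGroup.mk (p ++ q)) = expSum e (FreeGroup.mk p) + expSum e (FreeGroup.mk q) := by
  rw [← FreeGroup.mul_mk, expSum_mul]

theorem expSum_mk_invRev (e : α) (p : List (α × Bool)) :
    expSum e (FreeGroup.mk (FreeGroup.invRev p)) = -expSum e (FreeGroup.mk p) := by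
  rw [← FreeGroup.inv_mk, expSum_inv]

/-- In a word that runs over every generator at most once, the exponent sum of a generator that
occurs is the sign of its occurrence. -/
theorem expSum_mk_of_nodup {p : List (α × Bool)} (hp : (p.map Prod.fst).Nodup) {d : α × Bool}
    (hd : d ∈ p) : expSum d.1 (FreeGroup.mk p) = letterSign d.2 := by
  obtain ⟨a, b, rfl⟩ := List.append_of_mem hd
  rw [List.map_append, List.map_cons, List.nodup_middle, List.nodup_cons] at hp
  have h1 : ∀ x ∈ a ++ b, x.1 ≠ d.1 := by
    intro x hx h
    apply hp.1
    rw [← List.map_append, ← h]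
    exact List.mem_map_of_mem hx
  rw [expSum_mk_append, mk_cons, expSum_mul, expSum_mk_singleton,
    expSum_mk_eq_zero fun x hx => h1 x (by simp [hx]),
    expSum_mk_eq_zero fun x hx => h1 x (by simp [hx])]
  ring

theorem abs_expSum_mk_le_of_nodup {p : List (α × Bool)} (hp : (p.map Prod.fst).Nodup) (e : α) :
    |expSum e (FreeGroup.mk p)| ≤ 1 := by
  by_cases h : ∃ d ∈ p, d.1 = e
  · obtain ⟨d, hd, rfl⟩ := h
    rw [expSum_mk_of_nodup hp hd, letterSign_abs]
  · push Not at h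
    rw [expSum_mk_eq_zero h]; simp

theorem isReduced_of_nodup {p : List (α × Bool)} (hp : (p.map Prod.fst).Nodup) :
    FreeGroup.IsReduced p := by
  unfold FreeGroup.IsReduced
  rw [List.Nodup, List.pairwise_map] at hp
  exact (hp.imp fun h h' => absurd h' h).isChain

theorem isReduced_invRev {p : List (α × Bool)} (hp : FreeGroup.IsReduced p) :
    FreeGroup.IsReduced (FreeGroup.invRev p) := by
  classical
  rw [FreeGroup.isReduced_iff_reduce_eq, FreeGroup.reduce_invRev, hp.reduce_eq]

theorem isConj_conj_right {G : Type*} [Group G] (g x : G) : IsConj x (g * x * g⁻¹) :=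
  isConj_iff.2 ⟨g, rfl⟩

theorem eq_of_isReduced {p q : List (α × Bool)} (hp : FreeGroup.IsReduced p)
    (hq : FreeGroup.IsReduced q) (h : FreeGroup.mk p = FreeGroup.mk q) : p = q := by
  classical
  have := FreeGroup.reduce.sound h
  rwa [hp.reduce_eq, hq.reduce_eq] at this

/-- Two words have a longest common prefix. -/
theorem exists_common_prefix {β : Type*} (p q : List β) :
    ∃ c p' q', p = c ++ p' ∧ q = c ++ q' ∧ ∀ d ∈ p'.head?, d ∉ q'.head? := by
  classical
  induction p generalizing q with
  | nil => exact ⟨[], [], q, rfl, rfl, by simp⟩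
  | cons d p ih =>
    cases q with
    | nil => exact ⟨[], d :: p, [], rfl, rfl, by simp⟩
    | cons d' q =>
      by_cases h : d = d'
      · subst h
        obtain ⟨c, p', q', rfl, rfl, h⟩ := ih q
        exact ⟨d :: c, p', q', rfl, rfl, h⟩
      · exact ⟨[], d :: p, d' :: q, rfl, rfl, by simpa using fun h' => h h'.symm⟩

theorem isReduced_append_iff {p q : List (α × Bool)} :
    FreeGroup.IsReduced (p ++ q) ↔ FreeGroup.IsReduced p ∧ FreeGroup.IsReduced q ∧
      ∀ x ∈ p.getLast?, ∀ y ∈ q.head?, x.1 = y.1 → x.2 = y.2 := by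
  unfold FreeGroup.IsReduced
  exact List.isChain_append

theorem getLast?_invRev (p : List (α × Bool)) :
    (FreeGroup.invRev p).getLast? = p.head?.map fun d => (d.1, !d.2) := by
  cases p <;> simp [FreeGroup.invRev]

/-- If two reduced words start with different letters, then the inverse of the first followed by
the second is reduced. -/
theorem isReduced_invRev_append {p q : List (α × Bool)} (hp : FreeGroup.IsReduced p)
    (hq : FreeGroup.IsReduced q) (h : ∀ d ∈ p.head?, d ∉ q.head?) :
    FreeGroup.IsReduced (FreeGroup.invRev p ++ q) := by
  refine isReduced_append_iff.2 ⟨isReduced_invRev hp, hq, ?_⟩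
  rw [getLast?_invRev]
  intro x hx y hy hxy
  simp only [Option.mem_def, Option.map_eq_some_iff] at hx
  obtain ⟨⟨a, s⟩, hd, rfl⟩ := hx
  obtain ⟨a', s'⟩ := y
  simp only at hxy ⊢
  subst hxy
  by_contra hne
  have : s = s' := by cases s <;> cases s' <;> simp_all
  subst this
  exact h _ hd hy

end Words

/-! ### Paths, forests and spanning trees -/

namespace FinGraph

variable {G : FinGraph}

theorem init_flip (d : G.E × Bool) : G.init (d.1, !d.2) = G.term d := by
  obtain ⟨e, b⟩ := d; cases b <;> rfl

theorem term_flip (d : G.E × Bool) : G.term (d.1, !d.2) = G.init d := by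
  obtain ⟨e, b⟩ := d; cases b <;> rfl

theorem isPath_append_iff {u w : G.V} {p q : List (G.E × Bool)} :
    G.IsPath u (p ++ q) w ↔ ∃ v, G.IsPath u p v ∧ G.IsPath v q w := by
  constructor
  · intro h
    induction p generalizing u with
    | nil => exact ⟨u, rfl, h⟩
    | cons d p ih =>
      obtain ⟨v, h1, h2⟩ := ih h.2
      exact ⟨v, ⟨h.1, h1⟩, h2⟩
  · rintro ⟨v, h1, h2⟩; exact h1.append h2

theorem IsPath.end_unique {u v v' : G.V} {p : List (G.E × Bool)} (h : G.IsPath u p v)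
    (h' : G.IsPath u p v') : v = v' := by
  induction p generalizing u with
  | nil => exact h.symm.trans h'
  | cons d p ih => exact ih h.2 h'.2

theorem isPath_singleton (d : G.E × Bool) : G.IsPath (G.init d) [d] (G.term d) := ⟨rfl, rfl⟩

theorem IsPath.of_red {u v : G.V} {p q : List (G.E × Bool)} (hp : G.IsPath u p v)
    (h : FreeGroup.Red p q) : G.IsPath u q v := by
  induction h with
  | refl => exact hp
  | tail _ hs ih =>
    cases hs with
    | @not L₁ L₂ x b =>
      obtain ⟨w, h1, h2, h3, h4⟩ := isPath_append_iff.1 ih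
      have h5 := G.term_flip (x, b)
      simp only at h5
      rw [h5, h2] at h4
      exact h1.append h4

/-- The edges of `T` connect all vertices. -/
def Spans (G : FinGraph) (T : Set G.E) : Prop :=
  ∀ u v, ∃ p, G.IsPath u p v ∧ ∀ d ∈ p, d.1 ∈ T

/-- Closed paths in `T` are null-homotopic. -/
def Acyclic (G : FinGraph) (T : Set G.E) : Prop :=
  ∀ v p, G.IsPath v p v → (∀ d ∈ p, d.1 ∈ T) → FreeGroup.mk p = 1

/-- The tautological cocycle with values in the free group on the edges is a coboundary on `T`. -/
def HasPotential (G : FinGraph) (T : Set G.E) : Prop :=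
  ∃ t : G.V → FreeGroup G.E, ∀ d : G.E × Bool, d.1 ∈ T →
    t (G.init d) * FreeGroup.mk [d] = t (G.term d)

theorem HasPotential.mono {A B : Set G.E} (h : G.HasPotential B) (hAB : A ⊆ B) :
    G.HasPotential A := by
  obtain ⟨t, ht⟩ := h
  exact ⟨t, fun d hd => ht d (hAB hd)⟩

theorem potential_path {T : Set G.E} {t : G.V → FreeGroup G.E}
    (ht : ∀ d : G.E × Bool, d.1 ∈ T → t (G.init d) * FreeGroup.mk [d] = t (G.term d))
    {u v : G.V} {p : List (G.E × Bool)} (hp : G.IsPath u p v) (hpT : ∀ d ∈ p, d.1 ∈ T) :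
    t u * FreeGroup.mk p = t v := by
  induction p generalizing u with
  | nil => cases hp; rw [← FreeGroup.one_eq_mk, mul_one]
  | cons d p ih =>
    rw [mk_cons, ← mul_assoc, ← hp.1, ht d (hpT d (by simp))]
    exact ih hp.2 fun d' hd => hpT d' (by simp [hd])

theorem HasPotential.acyclic {T : Set G.E} (h : G.HasPotential T) : G.Acyclic T := by
  obtain ⟨t, ht⟩ := h
  intro v p hp hpT
  exact mul_left_cancel ((potential_path ht hp hpT).trans (mul_one _).symm)

theorem Spans.exists_isReduced {T : Set G.E} (h : G.Spans T) (u v : G.V) :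
    ∃ p, G.IsPath u p v ∧ (∀ d ∈ p, d.1 ∈ T) ∧ FreeGroup.IsReduced p := by
  classical
  obtain ⟨p, hp, hpT⟩ := h u v
  refine ⟨FreeGroup.reduce p, hp.of_red FreeGroup.reduce.red, fun d hd => ?_, ?_⟩
  · exact hpT d ((FreeGroup.reduce.red (L := p)).sublist.subset hd)
  · exact FreeGroup.isReduced_iff_reduce_eq.2 FreeGroup.reduce.idem

/-- The list of all vertices of a path with terminal vertex `v`. -/
def support (G : FinGraph) (p : List (G.E × Bool)) (v : G.V) : List G.V := G.verts p ++ [v]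

@[simp] theorem support_nil (v : G.V) : G.support [] v = [v] := rfl

@[simp] theorem support_cons (d : G.E × Bool) (p : List (G.E × Bool)) (v : G.V) :
    G.support (d :: p) v = G.init d :: G.support p v := rfl

theorem support_append (p q : List (G.E × Bool)) (v : G.V) :
    G.support (p ++ q) v = G.verts p ++ G.support q v := by
  simp [support, verts]

theorem start_mem_support {u v : G.V} {p : List (G.E × Bool)} (hp : G.IsPath u p v) :
    u ∈ G.support p v := by
  cases p with
  | nil => cases hp; simp
  | cons d p => simp [hp.1]

theorem term_mem_support {u v : G.V} {p : List (G.E × Bool)} (hp : G.IsPath u p v)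
    {d : G.E × Bool} (hd : d ∈ p) : G.term d ∈ G.support p v := by
  induction p generalizing u with
  | nil => simp at hd
  | cons d' p ih =>
    rw [support_cons]
    rcases List.mem_cons.1 hd with rfl | hd
    · exact List.mem_cons_of_mem _ (start_mem_support hp.2)
    · exact List.mem_cons_of_mem _ (ih hp.2 hd)

theorem init_mem_support {v : G.V} {p : List (G.E × Bool)}
    {d : G.E × Bool} (hd : d ∈ p) : G.init d ∈ G.support p v := by
  simp only [support, verts, List.mem_append, List.mem_map]
  exact Or.inl ⟨d, hd, rfl⟩

theorem exists_split_of_mem_support {u v w : G.V} {p : List (G.E × Bool)} (hp : G.IsPath u p v)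
    (hw : w ∈ G.support p v) :
    ∃ p₁ p₂, p = p₁ ++ p₂ ∧ G.IsPath u p₁ w ∧ G.IsPath w p₂ v := by
  induction p generalizing u with
  | nil =>
    cases hp
    simp only [support_nil, List.mem_singleton] at hw
    subst hw
    exact ⟨[], [], rfl, rfl, rfl⟩
  | cons d p ih =>
    rw [support_cons] at hw
    rcases List.mem_cons.1 hw with rfl | hw
    · exact ⟨[], d :: p, rfl, hp.1.symm, rfl, hp.2⟩
    · obtain ⟨p₁, p₂, rfl, h1, h2⟩ := ih hp.2 hw
      exact ⟨d :: p₁, p₂, rfl, ⟨hp.1, h1⟩, h2⟩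

/-- Reduced paths in a forest have distinct vertices. -/
theorem Acyclic.support_nodup {T : Set G.E} (hT : G.Acyclic T) {u v : G.V}
    {p : List (G.E × Bool)} (hp : G.IsPath u p v) (hpT : ∀ d ∈ p, d.1 ∈ T)
    (hr : FreeGroup.IsReduced p) : (G.support p v).Nodup := by
  induction p generalizing u with
  | nil => simp
  | cons d p ih =>
    rw [support_cons, List.nodup_cons]
    refine ⟨fun hmem => ?_, ih hp.2 (fun d' hd => hpT d' (by simp [hd]))
      (hr.infix (List.suffix_cons d p).isInfix)⟩
    obtain ⟨p₁, p₂, rfl, h1, h2⟩ := exists_split_of_mem_support hp.2 hmem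
    have h3 := hT (G.init d) (d :: p₁) ⟨rfl, h1⟩ fun d' hd => hpT d' (by
      rw [← List.cons_append]; exact List.mem_append_left _ hd)
    have h4 : FreeGroup.IsReduced (d :: p₁) := hr.infix ⟨[], p₂, by simp⟩
    have := eq_of_isReduced h4 FreeGroup.IsReduced.nil (h3.trans FreeGroup.one_eq_mk)
    simp at this

theorem edges_nodup_of_support_nodup {u v : G.V} {p : List (G.E × Bool)} (hp : G.IsPath u p v)
    (h : (G.support p v).Nodup) : (G.edges p).Nodup := by
  induction p generalizing u with
  | nil => simp [edges]
  | cons d p ih =>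
    rw [support_cons, List.nodup_cons] at h
    simp only [edges, List.map_cons, List.nodup_cons]
    refine ⟨fun hmem => ?_, ih hp.2 h.2⟩
    obtain ⟨d', hd', hdd⟩ := List.mem_map.1 hmem
    by_cases hb : d'.2 = d.2
    · have : d' = d := Prod.ext hdd hb
      subst this
      exact h.1 (init_mem_support hd')
    · have : d' = (d.1, !d.2) := Prod.ext hdd (by
        revert hb; cases d'.2 <;> cases d.2 <;> simp)
      apply h.1
      have h5 := term_mem_support hp.2 hd'
      rwa [this, term_flip] at h5

theorem isSimpleClosed_cons_iff {v : G.V} {d : G.E × Bool} {q : List (G.E × Bool)} :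
    G.IsSimpleClosed v (d :: q) ↔ G.init d = v ∧ G.IsPath (G.term d) q v ∧
      (G.support q v).Nodup ∧ d.1 ∉ G.edges q := by
  unfold IsSimpleClosed
  constructor
  · rintro ⟨-, ⟨h1, h2⟩, h3, h4⟩
    refine ⟨h1, h2, ?_, ?_⟩
    · rw [support, ← h1]
      simp only [verts, List.map_cons] at h3 ⊢
      exact (List.perm_append_comm (l₁ := [G.init d])).nodup_iff.1 h3
    · simp only [edges, List.map_cons, List.nodup_cons] at h4
      exact h4.1
  · rintro ⟨h1, h2, h3, h4⟩
    refine ⟨by simp, ⟨h1, h2⟩, ?_, ?_⟩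
    · rw [support, ← h1] at h3
      simp only [verts, List.map_cons] at h3 ⊢
      exact (List.perm_append_comm (l₁ := [G.init d])).nodup_iff.2 h3
    · simp only [edges, List.map_cons, List.nodup_cons]
      exact ⟨h4, edges_nodup_of_support_nodup h2 h3⟩

/-- By induction on the path: the initial vertex does not occur later, so its potential can be
chosen freely to satisfy the relation on the first edge. -/
theorem hasPotential_edges {u v : G.V} {p : List (G.E × Bool)} (hp : G.IsPath u p v)
    (h : (G.support p v).Nodup) : G.HasPotential {e | e ∈ G.edges p} := by
  classical
  induction p generalizing u with
  | nil => exact ⟨fun _ => 1, by simp [edges]⟩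
  | cons d p ih =>
    rw [support_cons, List.nodup_cons] at h
    obtain ⟨t, ht⟩ := ih hp.2 h.2
    have hne : ∀ d' : G.E × Bool, d'.1 ∈ G.edges p → G.init d' ≠ G.init d := by
      intro d' hd' heq
      obtain ⟨x, hx, hxd⟩ := List.mem_map.1 hd'
      by_cases hb : x.2 = d'.2
      · exact h.1 (heq ▸ (Prod.ext hxd hb : x = d') ▸ init_mem_support hx)
      · have hxf : x = (d'.1, !d'.2) := Prod.ext hxd (by
          revert hb; cases d'.2 <;> cases x.2 <;> simp)
        have h5 := term_mem_support hp.2 hx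
        rw [hxf, term_flip, heq] at h5
        exact h.1 h5
    have hloop : G.term d ≠ G.init d := fun heq => h.1 (heq ▸ start_mem_support hp.2)
    have key : ∀ s : G.V → FreeGroup G.E, s (G.init d) * FreeGroup.mk [d] = s (G.term d) →
        s (G.init (d.1, !d.2)) * FreeGroup.mk [(d.1, !d.2)] = s (G.term (d.1, !d.2)) := by
      intro s hs
      rw [init_flip, term_flip, ← hs]
      have : (FreeGroup.mk [(d.1, !d.2)] : FreeGroup G.E) = (FreeGroup.mk [d])⁻¹ := by
        rw [FreeGroup.inv_mk]; rfl
      rw [this]; group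
    refine ⟨fun w => if w = G.init d then t (G.term d) * (FreeGroup.mk [d])⁻¹ else t w, ?_⟩
    intro d' hd'
    simp only [edges, List.map_cons, List.mem_cons, Set.mem_ofPred_eq] at hd'
    by_cases hmem : d'.1 ∈ G.edges p
    · have h1 := hne d' hmem
      have h2 := hne (d'.1, !d'.2) hmem
      rw [init_flip] at h2
      simp only [h1, h2, if_false]
      exact ht d' hmem
    · have hdd : d'.1 = d.1 := hd'.resolve_right hmem
      have h0 : (fun w => if w = G.init d then t (G.term d) * (FreeGroup.mk [d])⁻¹ else t w)
          (G.init d) * FreeGroup.mk [d]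
          = (fun w => if w = G.init d then t (G.term d) * (FreeGroup.mk [d])⁻¹ else t w)
            (G.term d) := by simp [hloop, -FreeGroup.inv_mk]
      by_cases hb : d'.2 = d.2
      · rw [(Prod.ext hdd hb : d' = d)]; exact h0
      · have hxf : d' = (d.1, !d.2) := Prod.ext hdd (by
          revert hb; cases d'.2 <;> cases d.2 <;> simp)
        rw [hxf]
        exact key (fun w => if w = G.init d then t (G.term d) * (FreeGroup.mk [d])⁻¹ else t w) h0

/-- A spanning tree. -/
def IsTree (G : FinGraph) (T : Set G.E) : Prop := G.Spans T ∧ G.HasPotential T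

/-- A forest in a connected spanning subgraph `B` extends to a spanning tree in `B`. -/
theorem exists_isTree {A B : Set G.E} (hA : G.HasPotential A) (hAB : A ⊆ B) (hB : G.Spans B) :
    ∃ T, A ⊆ T ∧ T ⊆ B ∧ G.IsTree T := by
  classical
  have := G.finE
  -- Take a maximal forest between `A` and `B`. If it does not span, some edge of `B` leaves the set
  -- of vertices reachable from `u`, and adding this edge contradicts maximality.
  obtain ⟨T, hAT, hmax⟩ := Set.Finite.exists_le_maximal
    (s := {T : Set G.E | A ⊆ T ∧ T ⊆ B ∧ G.HasPotential T}) (Set.toFinite _) (a := A)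
    ⟨subset_rfl, hAB, hA⟩
  obtain ⟨⟨-, hTB, t, ht⟩, hmax⟩ := hmax
  refine ⟨T, hAT, hTB, ?_, ⟨t, ht⟩⟩
  intro u v
  by_contra hv
  have key : ∀ (p : List (G.E × Bool)) (w : G.V), G.IsPath w p v → (∀ d ∈ p, d.1 ∈ B) →
      (∃ q, G.IsPath u q w ∧ ∀ d ∈ q, d.1 ∈ T) → ∃ d : G.E × Bool, d.1 ∈ B ∧
        (∃ q, G.IsPath u q (G.init d) ∧ ∀ d ∈ q, d.1 ∈ T) ∧
        ¬ ∃ q, G.IsPath u q (G.term d) ∧ ∀ d ∈ q, d.1 ∈ T := by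
    intro p
    induction p with
    | nil => rintro w rfl - h; exact absurd h hv
    | cons d p ih =>
      intro w hw hpB h
      by_cases hd : ∃ q, G.IsPath u q (G.term d) ∧ ∀ d ∈ q, d.1 ∈ T
      · exact ih _ hw.2 (fun d' hd' => hpB d' (by simp [hd'])) hd
      · exact ⟨d, hpB d (by simp), hw.1 ▸ h, hd⟩
  obtain ⟨p, hp, hpB⟩ := hB u v
  obtain ⟨d, hdB, hd1, hd2⟩ := key p u hp hpB ⟨[], rfl, by simp⟩
  set reach : G.V → Prop := fun w => ∃ q, G.IsPath u q w ∧ ∀ d ∈ q, d.1 ∈ T with hreach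
  have hfwd : ∀ d' : G.E × Bool, d'.1 ∈ T → reach (G.init d') → reach (G.term d') := by
    rintro d' hd' ⟨q, hq, hqT⟩
    refine ⟨q ++ [d'], hq.append (isPath_singleton d'), fun x hx => ?_⟩
    rcases List.mem_append.1 hx with hx | hx
    · exact hqT x hx
    · rw [List.mem_singleton] at hx; exact hx ▸ hd'
  have hbwd : ∀ d' : G.E × Bool, d'.1 ∈ T → reach (G.term d') → reach (G.init d') := by
    intro d' hd' h
    have := hfwd (d'.1, !d'.2) hd'
    rw [init_flip, term_flip] at this
    exact this h
  -- Translating the potential of the unreachable vertices by `g` respects the edges of `T`, which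
  -- never leave the reachable set, and makes the new edge compatible.
  set g := t (G.init d) * FreeGroup.mk [d] * (t (G.term d))⁻¹ with hg
  have hpot : G.HasPotential (insert d.1 T) := by
    refine ⟨fun w => if reach w then t w else g * t w, fun d' hd' => ?_⟩
    by_cases hT : d'.1 ∈ T
    · by_cases hr : reach (G.init d')
      · simp only [hr, hfwd d' hT hr, if_true]; exact ht d' hT
      · have hr' : ¬ reach (G.term d') := fun h => hr (hbwd d' hT h)
        simp only [hr, hr', if_false]
        rw [mul_assoc, ht d' hT]
    · have hdd : d'.1 = d.1 := (Set.mem_insert_iff.1 hd').resolve_right hT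
      by_cases hb : d'.2 = d.2
      · rw [(Prod.ext hdd hb : d' = d)]
        have h1 : reach (G.init d) := hd1
        have h2 : ¬ reach (G.term d) := hd2
        simp only [h1, h2, if_true, if_false, hg]
        group
      · have hxf : d' = (d.1, !d.2) := Prod.ext hdd (by
          revert hb; cases d'.2 <;> cases d.2 <;> simp)
        rw [hxf, init_flip, term_flip]
        have h1 : reach (G.init d) := hd1
        have h2 : ¬ reach (G.term d) := hd2
        have h3 : (FreeGroup.mk [(d.1, !d.2)] : FreeGroup G.E) = (FreeGroup.mk [d])⁻¹ := by
          rw [FreeGroup.inv_mk]; rfl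
        simp only [h1, h2, if_true, if_false, hg, h3]
        group
  have hsub := hmax ⟨hAT.trans (Set.subset_insert _ _), Set.insert_subset hdB hTB, hpot⟩
    (Set.subset_insert _ _)
  have hdT : d.1 ∈ T := hsub (Set.mem_insert _ _)
  exact hd2 (hfwd d hdT hd1)

end FinGraph

/-! ### Collapses acting on paths, weights and exponent sums -/

namespace Collapse

variable {G H : FinGraph} (c : Collapse G H)

/-- The image of an oriented edge: empty if the edge is collapsed. -/
def dart (d : G.E × Bool) : List (H.E × Bool) :=
  (c.onE d.1).elim [] fun β => [(β.1, if d.2 then β.2 else !β.2)]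

/-- The image of an edge path. -/
def path (p : List (G.E × Bool)) : List (H.E × Bool) := p.flatMap c.dart

/-- The set of collapsed edges. -/
def kernel : Set G.E := {e | c.onE e = none}

theorem dart_of_mem_kernel {d : G.E × Bool} (h : d.1 ∈ c.kernel) : c.dart d = [] := by
  have h' : c.onE d.1 = none := h
  simp [dart, h']

theorem exists_dart_eq {d : G.E × Bool} (h : d.1 ∉ c.kernel) : ∃ β, c.dart d = [β] := by
  have h' : c.onE d.1 ≠ none := h
  obtain ⟨β, hβ⟩ := Option.ne_none_iff_exists'.1 h'
  exact ⟨(β.1, if d.2 then β.2 else !β.2), by simp [dart, hβ]⟩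

theorem not_mem_kernel_of_dart_eq {d : G.E × Bool} {β : H.E × Bool} (h : c.dart d = [β]) :
    d.1 ∉ c.kernel := by
  intro h'
  rw [c.dart_of_mem_kernel h'] at h
  simp at h

theorem onE_of_dart_eq {d : G.E × Bool} {β : H.E × Bool} (h : c.dart d = [β]) :
    ∃ t, c.onE d.1 = some (β.1, t) := by
  unfold dart at h
  cases hd : c.onE d.1 with
  | none => simp [hd] at h
  | some β' =>
    rw [hd] at h
    simp only [Option.elim_some, List.cons.injEq, and_true] at h
    exact ⟨β'.2, by rw [← h]⟩

theorem exists_dart (β : H.E × Bool) : ∃ d, c.dart d = [β] := by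
  obtain ⟨b, s⟩ := β
  obtain ⟨e, ⟨t, he⟩, -⟩ := c.onE_bijective b
  by_cases h : t = s
  · exact ⟨(e, true), by simp [dart, he, h]⟩
  · refine ⟨(e, false), ?_⟩
    have : (!t) = s := by revert h; cases t <;> cases s <;> simp
    simp [dart, he, this]

theorem edge_eq_iff {d d' : G.E × Bool} {β β' : H.E × Bool} (h : c.dart d = [β])
    (h' : c.dart d' = [β']) : d.1 = d'.1 ↔ β.1 = β'.1 := by
  obtain ⟨t, ht⟩ := c.onE_of_dart_eq h
  obtain ⟨t', ht'⟩ := c.onE_of_dart_eq h'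
  constructor
  · intro he
    rw [he, ht'] at ht
    simp only [Option.some.injEq, Prod.mk.injEq] at ht
    exact ht.1.symm
  · intro hb
    exact (c.onE_bijective β.1).unique ⟨t, ht⟩ ⟨t', hb ▸ ht'⟩

theorem hom_mk (p : List (G.E × Bool)) :
    c.hom (FreeGroup.mk p) = FreeGroup.mk (c.path p) := by
  induction p with
  | nil => exact map_one c.hom
  | cons d p ih =>
    rw [mk_cons, map_mul, ih]
    have h1 : c.path (d :: p) = c.dart d ++ c.path p := rfl
    rw [h1, ← FreeGroup.mul_mk]
    congr 1
    obtain ⟨e, s⟩ := d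
    have hof : c.hom (FreeGroup.of e) = FreeGroup.mk (c.dart (e, true)) := by
      unfold hom dart
      rw [FreeGroup.lift_apply_of]
      cases c.onE e <;> rfl
    cases s
    · rw [mk_singleton_false, map_inv, hof, FreeGroup.inv_mk]
      unfold dart
      cases c.onE e <;> simp [FreeGroup.invRev]
    · rw [mk_singleton_true, hof]

@[simp] theorem path_append (p q : List (G.E × Bool)) :
    c.path (p ++ q) = c.path p ++ c.path q := by simp [path]

@[simp] theorem path_cons (d : G.E × Bool) (p : List (G.E × Bool)) :
    c.path (d :: p) = c.dart d ++ c.path p := rfl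

@[simp] theorem path_nil : c.path [] = [] := rfl

theorem path_of_forall_mem_kernel {p : List (G.E × Bool)} (h : ∀ d ∈ p, d.1 ∈ c.kernel) :
    c.path p = [] := by
  unfold path
  rw [List.flatMap_eq_nil_iff]
  exact fun d hd => c.dart_of_mem_kernel (h d hd)

/-- The weight on `G` pulled back from a weight on `H`; collapsed edges have weight zero. -/
def pullback (z : H.E → ℝ) (e : G.E) : ℝ := (c.onE e).elim 0 fun β => z β.1

theorem wordWeight_path (z : H.E → ℝ) (p : List (G.E × Bool)) :
    wordWeight z (c.path p) = wordWeight (c.pullback z) p := by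
  induction p with
  | nil => rfl
  | cons d p ih =>
    rw [path_cons, wordWeight_append, ih, wordWeight_cons]
    congr 1
    unfold dart pullback
    cases c.onE d.1 <;> simp

theorem pullback_of_mem_kernel {z : H.E → ℝ} {e : G.E} (h : e ∈ c.kernel) :
    c.pullback z e = 0 := by
  have h' : c.onE e = none := h
  simp [pullback, h']

theorem pullback_of_dart_eq {z : H.E → ℝ} {d : G.E × Bool} {β : H.E × Bool}
    (h : c.dart d = [β]) : c.pullback z d.1 = z β.1 := by
  obtain ⟨t, ht⟩ := c.onE_of_dart_eq h
  simp [pullback, ht]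

theorem expSum_hom {e : G.E} {b : H.E} {t : Bool} (h : c.onE e = some (b, t))
    (x : FreeGroup G.E) : expSum b (c.hom x) = letterSign t * expSum e x := by
  induction x using FreeGroup.induction_on with
  | C1 => simp
  | of a =>
    unfold hom
    rw [FreeGroup.lift_apply_of]
    by_cases ha : a = e
    · subst ha
      rw [h, expSum_of_self]
      simp [expSum_mk_singleton]
    · rw [expSum_of_ne ha, mul_zero]
      cases hβ : c.onE a with
      | none => simp
      | some β =>
        refine expSum_mk_singleton_of_ne fun hb => ha ?_
        exact (c.onE_bijective b).unique ⟨β.2, by rw [hβ, ← hb]⟩ ⟨t, h⟩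
  | inv_of a ih =>
    change expSum b (c.hom (FreeGroup.of a)) = _ at ih
    rw [map_inv, expSum_inv, ih]
    rw [expSum_inv, mul_neg]
  | mul x y hx hy => rw [map_mul, expSum_mul, hx, hy, expSum_mul, mul_add]

/-- A collapse followed by an isomorphism. -/
def transIso {K : FinGraph} (f : GraphIso H K) : Collapse G K where
  onV := f.onV ∘ c.onV
  onE e := (c.onE e).map f.onD
  onV_surjective := f.onV.surjective.comp c.onV_surjective
  onE_bijective e' := by
    have hflip : ∀ d : H.E × Bool, ∀ d' : H.E × Bool, d.1 = d'.1 → (f.onD d).1 = (f.onD d').1 := by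
      rintro ⟨e, b⟩ ⟨-, b'⟩ rfl
      by_cases h : b = b'
      · rw [h]
      · have := f.onD_flip (e, b)
        have hb : (!b) = b' := by revert h; cases b <;> cases b' <;> simp
        simp only [hb] at this
        rw [this]
    obtain ⟨e, ⟨t, he⟩, huniq⟩ := c.onE_bijective (f.onD.symm (e', true)).1
    refine ⟨e, ⟨(f.onD ((f.onD.symm (e', true)).1, t)).2, ?_⟩, ?_⟩
    · rw [he, Option.map_some, Option.some.injEq]
      refine Prod.ext ?_ rfl
      exact (hflip ((f.onD.symm (e', true)).1, t) (f.onD.symm (e', true)) rfl).trans (by rw [Equiv.apply_symm_apply])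
    · rintro a ⟨s, hs⟩
      obtain ⟨d, hd, hds⟩ := Option.map_eq_some_iff.1 hs
      refine huniq a ⟨d.2, ?_⟩
      rw [hd, Option.some.injEq]
      refine Prod.ext ?_ rfl
      by_cases hst : s = true
      · rw [← hst, ← hds, Equiv.symm_apply_apply]
      · have hs' : s = false := by simpa using hst
        have h2 := f.onD_flip d
        rw [hds, hs'] at h2
        rw [show ((e', true) : K.E × Bool) = f.onD (d.1, !d.2) by rw [h2]; rfl,
          Equiv.symm_apply_apply]
  init_onE e d h := by
    obtain ⟨d', hd', rfl⟩ := Option.map_eq_some_iff.1 h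
    rw [f.init_onD, Function.comp_apply, c.init_onE e d' hd']
  term_onE e d h := by
    obtain ⟨d', hd', rfl⟩ := Option.map_eq_some_iff.1 h
    rw [f.term_onD, Function.comp_apply, c.term_onE e d' hd']
  fibre u v := by
    simp only [Function.comp_apply, EmbeddingLike.apply_eq_iff_eq, Option.map_eq_none_iff]
    exact c.fibre u v

theorem hom_transIso {K : FinGraph} (f : GraphIso H K) (x : FreeGroup G.E) :
    (c.transIso f).hom x = f.hom (c.hom x) := by
  have : (c.transIso f).hom = f.hom.comp c.hom := by
    apply FreeGroup.ext_hom
    intro e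
    unfold hom
    rw [MonoidHom.comp_apply, FreeGroup.lift_apply_of, FreeGroup.lift_apply_of]
    change ((c.onE e).map f.onD).elim 1 _ = _
    cases c.onE e with
    | none => simp
    | some d => simp [GraphIso.hom_mk]
  rw [this]; rfl

end Collapse

/-! ### Markings, conjugacy classes and rose faces -/

namespace MarkedGraph

variable {n : ℕ} {G R : MarkedGraph n}

theorem IsFaceOf.of_iso {R' : MarkedGraph n} (h : R.IsFaceOf G)
    {f : GraphIso R.toFinGraph R'.toFinGraph} (hf : IsoCompatible f) : R'.IsFaceOf G := by
  obtain ⟨c, u, hu, h⟩ := h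
  obtain ⟨w, hw, hf⟩ := hf
  refine ⟨c.transIso f, w ++ u.map f.onD, hw.append (f.isPath hu), fun γ => ?_⟩
  rw [← FreeGroup.mul_mk, ← GraphIso.hom_mk, Collapse.hom_transIso, ← hf γ, ← h γ]
  simp only [map_mul, map_inv]
  group

/-- A simplex, as a set of points, determines its marked graph up to isomorphism: test it on the
metric with all edges of length one. -/
theorem exists_iso_of_simplex_eq {R' : MarkedGraph n} (h : R.simplex = R'.simplex) :
    ∃ f : GraphIso R'.toFinGraph R.toFinGraph, IsoCompatible f := by
  have h1 : CV.mk { toMarkedGraph := R, len := fun _ => 1, len_pos := fun _ => one_pos } ∈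
      R'.simplex := h ▸ ⟨_, _, rfl⟩
  obtain ⟨l, hl, hx⟩ := h1
  obtain ⟨f, hf, -⟩ := MarkedMetricGraph.Equivalent.symm (Quotient.exact hx)
  exact ⟨f, hf⟩

/-- Simplices with the same rose faces: a rose obtained from one graph by a collapse is obtained
from the other one. -/
theorem IsFaceOf.of_roseFaces_eq {G' : MarkedGraph n} (h : G.roseFaces = G'.roseFaces)
    (hR : R.IsRose) (hRG : R.IsFaceOf G) : R.IsFaceOf G' := by
  have h1 : R.simplex ∈ G'.roseFaces := h ▸ ⟨R, hR, hRG, rfl⟩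
  obtain ⟨R', -, hR'G, hs⟩ := h1
  obtain ⟨f, hf⟩ := exists_iso_of_simplex_eq hs
  exact hR'G.of_iso hf

theorem Represents.isConj {v : G.V} {p : List (G.E × Bool)} {γ : FreeGroup (Fin n)}
    (h : G.Represents v p γ) : IsConj (FreeGroup.mk p) (G.marking γ) := by
  obtain ⟨-, u, -, hu⟩ := h
  rw [← hu]
  exact isConj_conj_right _ _

theorem exists_represents (G : MarkedGraph n) (γ : FreeGroup (Fin n)) :
    ∃ p, G.Represents G.base p γ := by
  have h : G.marking γ ∈ G.pi1 G.base := G.marking_range ▸ ⟨γ, rfl⟩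
  obtain ⟨p, hp, hpγ⟩ := h
  refine ⟨p, hp, [], rfl, ?_⟩
  rw [← hpγ, ← FreeGroup.one_eq_mk]; simp

theorem exists_represents_of_isPath {v : G.V} {p : List (G.E × Bool)} (hp : G.IsPath v p v) :
    ∃ γ, G.Represents v p γ := by
  obtain ⟨u, hu⟩ := G.connected G.base v
  have h : FreeGroup.mk u * FreeGroup.mk p * (FreeGroup.mk u)⁻¹ ∈ G.pi1 G.base :=
    ⟨u ++ p ++ FreeGroup.invRev u, (hu.append hp).append hu.invRev, by
      rw [← FreeGroup.mul_mk, ← FreeGroup.mul_mk, FreeGroup.inv_mk]⟩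
  rw [← G.marking_range] at h
  obtain ⟨γ, hγ⟩ := h
  exact ⟨γ, hp, u, hu, hγ.symm⟩

theorem Represents.of_isConj {v : G.V} {p : List (G.E × Bool)} {γ γ' : FreeGroup (Fin n)}
    (h : G.Represents v p γ) (hγ : IsConj γ γ') : G.Represents v p γ' := by
  obtain ⟨hp, u, hu, hup⟩ := h
  obtain ⟨δ, rfl⟩ := isConj_iff.1 hγ
  have hδ : G.marking δ ∈ G.pi1 G.base := G.marking_range ▸ ⟨δ, rfl⟩
  obtain ⟨q, hq, hqδ⟩ := hδ
  refine ⟨hp, q ++ u, hq.append hu, ?_⟩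
  rw [← FreeGroup.mul_mk, hqδ, map_mul, map_mul, map_inv, ← hup]
  group

theorem Represents.rotate {v w : G.V} {a b : List (G.E × Bool)} {γ : FreeGroup (Fin n)}
    (h : G.Represents v (a ++ b) γ) (ha : G.IsPath v a w) : G.Represents w (b ++ a) γ := by
  obtain ⟨hp, u, hu, hup⟩ := h
  obtain ⟨w', ha', hb⟩ := FinGraph.isPath_append_iff.1 hp
  obtain rfl := ha'.end_unique ha
  refine ⟨hb.append ha, u ++ a, hu.append ha, ?_⟩
  rw [← hup, ← FreeGroup.mul_mk, ← FreeGroup.mul_mk, ← FreeGroup.mul_mk]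
  group

theorem Represents.of_mk_eq {v : G.V} {p q : List (G.E × Bool)} {γ : FreeGroup (Fin n)}
    (h : G.Represents v p γ) (hq : G.IsPath v q v) (hpq : FreeGroup.mk p = FreeGroup.mk q) :
    G.Represents v q γ := by
  obtain ⟨-, u, hu, hup⟩ := h
  exact ⟨hq, u, hu, hpq ▸ hup⟩

theorem Represents.inv {v : G.V} {p : List (G.E × Bool)} {γ : FreeGroup (Fin n)}
    (h : G.Represents v p γ) : G.Represents v (FreeGroup.invRev p) γ⁻¹ := by
  obtain ⟨hp, u, hu, hup⟩ := h
  refine ⟨hp.invRev, u, hu, ?_⟩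
  rw [map_inv, ← hup, ← FreeGroup.inv_mk]
  group

theorem IsRose.eq (hR : R.IsRose) (u v : R.V) : u = v := (hR u).trans (hR v).symm

theorem IsRose.isPath (hR : R.IsRose) (u : R.V) (p : List (R.E × Bool)) (v : R.V) :
    R.IsPath u p v := by
  induction p generalizing u with
  | nil => exact hR.eq u v
  | cons d p ih => exact ⟨hR.eq _ _, ih _⟩

theorem IsRose.marking_surjective (hR : R.IsRose) : Function.Surjective R.marking := by
  intro x
  obtain ⟨p, rfl⟩ := Quot.exists_rep x
  have : FreeGroup.mk p ∈ R.marking.range := by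
    rw [R.marking_range]; exact ⟨p, hR.isPath _ _ _, rfl⟩
  exact this

theorem IsRose.isConj_of_marking (hR : R.IsRose) {γ γ' : FreeGroup (Fin n)}
    (h : IsConj (R.marking γ) (R.marking γ')) : IsConj γ γ' := by
  obtain ⟨g, hg⟩ := isConj_iff.1 h
  obtain ⟨δ, rfl⟩ := hR.marking_surjective g
  refine isConj_iff.2 ⟨δ, R.marking_injective ?_⟩
  rw [map_mul, map_mul, map_inv, hg]

theorem IsRose.represents_iff (hR : R.IsRose) {v : R.V} {p : List (R.E × Bool)}
    {γ : FreeGroup (Fin n)} : R.Represents v p γ ↔ IsConj (FreeGroup.mk p) (R.marking γ) := by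
  refine ⟨Represents.isConj, fun h => ?_⟩
  obtain ⟨g, hg⟩ := isConj_iff.1 h
  obtain ⟨u, rfl⟩ := Quot.exists_rep g
  exact ⟨hR.isPath _ _ _, u, hR.isPath _ _ _, hg⟩

/-- A collapse is compatible with the markings, up to conjugation. -/
def Compat (c : Collapse G.toFinGraph R.toFinGraph) : Prop :=
  ∀ γ, IsConj (c.hom (G.marking γ)) (R.marking γ)

theorem IsFaceOf.exists_compat (h : R.IsFaceOf G) :
    ∃ c : Collapse G.toFinGraph R.toFinGraph, Compat c := by
  obtain ⟨c, u, -, h⟩ := h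
  exact ⟨c, fun γ => by rw [← h γ]; exact isConj_conj_right _ _⟩

variable {c : Collapse G.toFinGraph R.toFinGraph}

/-- Curves are identified below by this criterion: a free homotopy class in `G` is read off as a
conjugacy class of words in the petals. The converse direction uses that the marking of a rose is
onto the whole free group on its petals. -/
theorem Compat.represents_iff (hR : R.IsRose) (hc : Compat c) {v : G.V}
    {p : List (G.E × Bool)} (hp : G.IsPath v p v) {γ : FreeGroup (Fin n)} :
    G.Represents v p γ ↔ IsConj (FreeGroup.mk (c.path p)) (R.marking γ) := by
  rw [← c.hom_mk]
  constructor
  · intro h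
    exact (c.hom.map_isConj h.isConj).trans (hc γ)
  · intro h
    obtain ⟨γ', hγ'⟩ := exists_represents_of_isPath hp
    refine hγ'.of_isConj (hR.isConj_of_marking ?_)
    exact ((c.hom.map_isConj hγ'.isConj).trans (hc γ')).symm.trans h

theorem IsRose.spans (hR : R.IsRose) (c : Collapse G.toFinGraph R.toFinGraph) :
    G.Spans c.kernel := by
  intro u v
  exact (c.fibre u v).1 (hR.eq _ _)

/-- A closed path of collapsed edges has the empty word as image, so the class it represents is
killed by the injective marking of `R`. -/
theorem Compat.acyclic (hc : Compat c) : G.Acyclic c.kernel := by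
  intro v p hp hpT
  obtain ⟨γ, hγ⟩ := exists_represents_of_isPath hp
  have h1 : IsConj (c.hom (FreeGroup.mk p)) (R.marking γ) :=
    (c.hom.map_isConj hγ.isConj).trans (hc γ)
  rw [c.hom_mk, c.path_of_forall_mem_kernel hpT, ← FreeGroup.one_eq_mk, isConj_one_right] at h1
  have h2 : γ = 1 := R.marking_injective (h1.trans (map_one _).symm)
  have h3 := hγ.isConj
  rwa [h2, map_one, isConj_one_left] at h3

end MarkedGraph

/-! ### The rose obtained by collapsing a spanning tree -/

theorem natCard_of_freeGroup_bijective {n : ℕ} {E : Type} (f : FreeGroup (Fin n) →* FreeGroup E)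
    (hf : Function.Bijective f) : Nat.card E = n := by
  have e := Equiv.ofFreeGroupEquiv (MulEquiv.ofBijective f hf)
  rw [← Nat.card_congr e, Nat.card_fin]

namespace FinGraph

/-- The rose whose petals are the edges outside `T`. -/
def roseGraph (G : FinGraph) (T : Set G.E) : FinGraph where
  V := Unit
  E := {e : G.E // e ∉ T}
  finV := inferInstance
  finE := have := G.finE; inferInstance
  src _ := ()
  tgt _ := ()

/-- The petal given by an edge outside `T`. -/
def petal (G : FinGraph) {T : Set G.E} (e : G.E) (he : e ∉ T) : (G.roseGraph T).E := ⟨e, he⟩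

/-- The edge outside `T` that gives a petal. -/
def petalEdge (G : FinGraph) {T : Set G.E} (b : (G.roseGraph T).E) : G.E := b.1

theorem petalEdge_not_mem {G : FinGraph} {T : Set G.E} (b : (G.roseGraph T).E) :
    G.petalEdge b ∉ T := b.2

@[simp] theorem petalEdge_petal {G : FinGraph} {T : Set G.E} {e : G.E} (he : e ∉ T) :
    G.petalEdge (G.petal e he) = e := rfl

@[simp] theorem petal_petalEdge {G : FinGraph} {T : Set G.E} (b : (G.roseGraph T).E) :
    G.petal (G.petalEdge b) (petalEdge_not_mem b) = b := rfl

open Classical in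
/-- The collapse of a spanning tree. -/
noncomputable def treeCollapse (G : FinGraph) (v₀ : G.V) (T : Set G.E) (hT : G.Spans T) :
    Collapse G (G.roseGraph T) where
  onV _ := ()
  onE e := if h : e ∈ T then none else some (G.petal e h, true)
  onV_surjective _ := ⟨v₀, rfl⟩
  onE_bijective := by
    intro b
    refine ⟨G.petalEdge b, ⟨true, by simp [petalEdge_not_mem]⟩, ?_⟩
    rintro a ⟨t, ht⟩
    by_cases h : a ∈ T
    · simp [h] at ht
    · simp only [h, dite_false, Option.some.injEq] at ht
      exact congrArg (fun x => G.petalEdge x.1) ht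
  init_onE _ _ _ := rfl
  term_onE _ _ _ := rfl
  fibre u v := by
    refine ⟨fun _ => ?_, fun _ => rfl⟩
    obtain ⟨p, hp, hpT⟩ := hT u v
    exact ⟨p, hp, fun d hd => by simp [hpT d hd]⟩

theorem treeCollapse_kernel (G : FinGraph) (v₀ : G.V) (T : Set G.E) (hT : G.Spans T) :
    (G.treeCollapse v₀ T hT).kernel = T := by
  ext e
  change (G.treeCollapse v₀ T hT).onE e = none ↔ e ∈ T
  by_cases h : e ∈ T <;> simp [treeCollapse, h]

theorem treeCollapse_of_not_mem (G : FinGraph) (v₀ : G.V) {T : Set G.E} (hT : G.Spans T)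
    {e : G.E} (he : e ∉ T) :
    (G.treeCollapse v₀ T hT).onE e = some (G.petal e he, true) := by
  simp [treeCollapse, he]

/-- The potential `t` of the tree provides a left inverse: mapping the petal of `e` to `t (src e) *
e * (t (tgt e))⁻¹` recovers a closed path up to conjugation by the potential of its base point. -/
theorem treeCollapse_injective (G : FinGraph) (v₀ : G.V) {T : Set G.E} (hT : G.IsTree T)
    {v : G.V} {p : List (G.E × Bool)} (hp : G.IsPath v p v)
    (h : (G.treeCollapse v₀ T hT.1).hom (FreeGroup.mk p) = 1) : FreeGroup.mk p = 1 := by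
  obtain ⟨t, ht⟩ := hT.2
  set c := G.treeCollapse v₀ T hT.1 with hc
  let f : (G.roseGraph T).E → FreeGroup G.E := fun b =>
    t (G.src (G.petalEdge b)) * FreeGroup.of (G.petalEdge b) * (t (G.tgt (G.petalEdge b)))⁻¹
  let s : FreeGroup (G.roseGraph T).E →* FreeGroup G.E := FreeGroup.lift f
  have hd : ∀ d : G.E × Bool,
      s (c.hom (FreeGroup.mk [d])) = t (G.init d) * FreeGroup.mk [d] * (t (G.term d))⁻¹ := by
    intro d
    rw [c.hom_mk]
    by_cases he : d.1 ∈ T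
    · rw [ht d he, c.path_of_forall_mem_kernel, ← FreeGroup.one_eq_mk, map_one, mul_inv_cancel]
      intro d' hd'
      rw [List.mem_singleton.1 hd', hc, treeCollapse_kernel]
      exact he
    · obtain ⟨e, b⟩ := d
      have h1 : c.onE e = _ := G.treeCollapse_of_not_mem v₀ hT.1 he
      rw [c.path_cons, c.path_nil, List.append_nil, Collapse.dart, h1, Option.elim_some]
      cases b
      · simp only [Bool.not_true]
        rw [if_neg Bool.false_ne_true, mk_singleton_false, map_inv]
        simp only [s, f, FreeGroup.lift_apply_of, mk_singleton_false, petalEdge_petal, init, term]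
        simp [mul_assoc]
      · rw [if_pos rfl, mk_singleton_true]
        simp only [s, f, FreeGroup.lift_apply_of, mk_singleton_true, petalEdge_petal, init, term]
        simp
  have key : ∀ (p : List (G.E × Bool)) (u : G.V), G.IsPath u p v →
      s (c.hom (FreeGroup.mk p)) = t u * FreeGroup.mk p * (t v)⁻¹ := by
    intro p
    induction p with
    | nil =>
      rintro u rfl
      rw [← FreeGroup.one_eq_mk, map_one, map_one]; group
    | cons d p ih =>
      intro u hu
      rw [mk_cons, map_mul, map_mul, ih _ hu.2, hd, hu.1]
      group
  have h1 := key p v hp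
  rw [h, map_one] at h1
  exact conj_eq_one_iff.1 h1.symm

end FinGraph

namespace MarkedGraph

variable {n : ℕ}

theorem treeCollapse_bijective (G : MarkedGraph n) {T : Set G.E} (hT : G.IsTree T) :
    Function.Bijective ((G.treeCollapse G.base T hT.1).hom.comp G.marking) := by
  set c := G.treeCollapse G.base T hT.1 with hc
  constructor
  · rw [injective_iff_map_eq_one]
    intro γ hγ
    obtain ⟨p, hp⟩ := G.exists_represents γ
    have h1 : G.marking γ ∈ G.pi1 G.base := G.marking_range ▸ ⟨γ, rfl⟩
    obtain ⟨q, hq, hqγ⟩ := h1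
    have h2 : FreeGroup.mk q = 1 := G.treeCollapse_injective G.base hT hq (by rw [hqγ]; exact hγ)
    rw [hqγ] at h2
    exact G.marking_injective (h2.trans (map_one _).symm)
  · intro x
    induction x using FreeGroup.induction_on with
    | C1 => exact ⟨1, map_one _⟩
    | of b =>
      obtain ⟨q₁, hq₁, hT₁⟩ := hT.1 G.base (G.src (G.petalEdge b))
      obtain ⟨q₂, hq₂, hT₂⟩ := hT.1 (G.tgt (G.petalEdge b)) G.base
      have h1 : FreeGroup.mk (q₁ ++ (G.petalEdge b, true) :: q₂) ∈ G.pi1 G.base :=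
        ⟨_, hq₁.append (show G.IsPath _ ((G.petalEdge b, true) :: q₂) _ from ⟨rfl, hq₂⟩), rfl⟩
      rw [← G.marking_range] at h1
      obtain ⟨γ, hγ⟩ := h1
      refine ⟨γ, ?_⟩
      have hk : ∀ q : List (G.E × Bool), (∀ d ∈ q, d.1 ∈ T) → c.path q = [] := by
        intro q hq
        apply c.path_of_forall_mem_kernel
        rw [hc, FinGraph.treeCollapse_kernel]
        exact hq
      have h2 : c.onE (G.petalEdge b) = _ :=
        G.treeCollapse_of_not_mem G.base hT.1 (FinGraph.petalEdge_not_mem b)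
      rw [MonoidHom.comp_apply, hγ, c.hom_mk, c.path_append, c.path_cons, hk _ hT₁, hk _ hT₂,
        Collapse.dart, h2]
      rfl
    | inv_of b ih => obtain ⟨γ, hγ⟩ := ih; exact ⟨γ⁻¹, by rw [map_inv, hγ]⟩
    | mul x y hx hy =>
      obtain ⟨γ, hγ⟩ := hx
      obtain ⟨γ', hγ'⟩ := hy
      exact ⟨γ * γ', by rw [map_mul, hγ, hγ']⟩

/-- The marked rose obtained by collapsing a spanning tree. -/
noncomputable def roseOf (G : MarkedGraph n) (hn : 2 ≤ n) {T : Set G.E} (hT : G.IsTree T) :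
    MarkedGraph n where
  toFinGraph := G.roseGraph T
  connected _ _ := ⟨[], rfl⟩
  valence v := by
    have := G.finE
    have hcard := natCard_of_freeGroup_bijective _ (G.treeCollapse_bijective hT)
    have h1 : Nat.card {d : (G.roseGraph T).E × Bool // (G.roseGraph T).init d = v} = n * 2 := by
      rw [Nat.card_congr (Equiv.subtypeUnivEquiv
        (p := fun d => (G.roseGraph T).init d = v) fun _ => rfl), Nat.card_prod, hcard]
      simp
    exact le_of_le_of_eq (by omega) h1.symm
  base := ()
  marking := (G.treeCollapse G.base T hT.1).hom.comp G.marking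
  marking_injective := (G.treeCollapse_bijective hT).1
  marking_range := by
    rw [MonoidHom.range_eq_top.2 (G.treeCollapse_bijective hT).2, eq_comm, eq_top_iff]
    rintro x -
    obtain ⟨p, rfl⟩ := Quot.exists_rep x
    refine ⟨p, ?_, rfl⟩
    induction p with
    | nil => rfl
    | cons d p ih => exact ⟨rfl, ih⟩

variable (G : MarkedGraph n) (hn : 2 ≤ n) {T : Set G.E} (hT : G.IsTree T)

theorem isRose_roseOf : (G.roseOf hn hT).IsRose := fun _ => rfl

/-- The collapse of a spanning tree, as a map to the corresponding rose. -/
noncomputable def roseCollapse : Collapse G.toFinGraph (G.roseOf hn hT).toFinGraph :=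
  G.treeCollapse G.base T hT.1

theorem isFaceOf_roseOf : (G.roseOf hn hT).IsFaceOf G :=
  ⟨G.roseCollapse hn hT, [], rfl, fun γ => by
    rw [← FreeGroup.one_eq_mk, one_mul, inv_one, mul_one]; rfl⟩

theorem compat_roseCollapse : Compat (G.roseCollapse hn hT) := fun _ => IsConj.refl _

theorem kernel_roseCollapse : (G.roseCollapse hn hT).kernel = T :=
  G.treeCollapse_kernel G.base T hT.1

theorem IsRose.natCard_eq {R : MarkedGraph n} (hR : R.IsRose) : Nat.card R.E = n :=
  natCard_of_freeGroup_bijective _ ⟨R.marking_injective, hR.marking_surjective⟩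

end MarkedGraph

/-! ### Figure-eights and barbells in a common form -/

namespace FinGraph

variable {G : FinGraph}

theorem Spans.of_detours {A B : Set G.E} (hA : G.Spans A)
    (h : ∀ d : G.E × Bool, d.1 ∈ A → ∃ q, G.IsPath (G.init d) q (G.term d) ∧ ∀ x ∈ q, x.1 ∈ B) :
    G.Spans B := by
  intro u v
  obtain ⟨p, hp, hpA⟩ := hA u v
  induction p generalizing u with
  | nil => exact ⟨[], hp, by simp⟩
  | cons d p ih =>
    obtain ⟨q, hq, hqB⟩ := h d (hpA d (by simp))
    obtain ⟨q', hq', hqB'⟩ := ih _ hp.2 fun x hx => hpA x (by simp [hx])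
    refine ⟨q ++ q', hp.1 ▸ hq.append hq', fun x hx => ?_⟩
    rcases List.mem_append.1 hx with hx | hx
    · exact hqB x hx
    · exact hqB' x hx

theorem eq_or_eq_flip {d d' : G.E × Bool} (h : d.1 = d'.1) : d = d' ∨ d = (d'.1, !d'.2) := by
  obtain ⟨e, b⟩ := d
  obtain ⟨e', b'⟩ := d'
  cases b <;> cases b' <;> simp_all

theorem mem_invRev_iff {α : Type*} {p : List (α × Bool)} {d : α × Bool} :
    d ∈ FreeGroup.invRev p ↔ (d.1, !d.2) ∈ p := by
  obtain ⟨e, b⟩ := d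
  simp only [FreeGroup.invRev, List.mem_reverse, List.mem_map, Prod.mk.injEq, Prod.exists]
  constructor
  · rintro ⟨a, b', h, rfl, rfl⟩; simpa using h
  · intro h; exact ⟨e, !b, h, rfl, by simp⟩

theorem edges_append (p q : List (G.E × Bool)) : G.edges (p ++ q) = G.edges p ++ G.edges q := by
  simp [edges]

theorem edges_invRev (p : List (G.E × Bool)) :
    G.edges (FreeGroup.invRev p) = (G.edges p).reverse := by
  simp [edges, FreeGroup.invRev, List.map_reverse]

/-- If the endpoints of an edge `g` are joined by a path that avoids `g`, the remaining edges of
a connected graph still connect all vertices. -/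
theorem spans_ne_of_detour {A : Set G.E} (hA : G.Spans A) {g : G.E × Bool}
    {q : List (G.E × Bool)} (hq : G.IsPath (G.term g) q (G.init g))
    (hqg : ∀ x ∈ q, x.1 ≠ g.1) : G.Spans {e | e ≠ g.1} := by
  refine hA.of_detours fun d _ => ?_
  by_cases hd : d.1 = g.1
  · rcases eq_or_eq_flip hd with rfl | rfl
    · refine ⟨FreeGroup.invRev q, hq.invRev, fun x hx => ?_⟩
      exact hqg (x.1, !x.2) (mem_invRev_iff.1 hx)
    · rw [init_flip, term_flip]
      exact ⟨q, hq, hqg⟩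
  · exact ⟨[d], isPath_singleton d, by simpa using hd⟩

theorem hasPotential_empty : G.HasPotential ∅ := ⟨fun _ => 1, by simp⟩

/-- A figure-eight or barbell curve: simple closed curves `a` at `v` and `b` at `w`, joined by an
embedded arc `k`, which is constant in the case of a figure-eight. -/
structure IsSeparated (G : FinGraph) (v w : G.V) (a k b : List (G.E × Bool)) : Prop where
  left : G.IsSimpleClosed v a
  arc : G.IsPath v k w
  right : G.IsSimpleClosed w b
  verts_nodup : ((G.verts a).tail ++ G.support k w ++ (G.verts b).tail).Nodup
  edges_nodup : (G.edges a ++ G.edges k ++ G.edges b).Nodup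

theorem IsSimpleClosed.verts_eq {v : G.V} {a : List (G.E × Bool)} (h : G.IsSimpleClosed v a) :
    G.verts a = v :: (G.verts a).tail := by
  obtain ⟨h1, h2, -⟩ := h
  cases a with
  | nil => exact absurd rfl h1
  | cons d a => simp [verts, h2.1]

/-- Both shapes can be treated by one argument, a figure-eight being the case of a constant arc. The
arc of a barbell is never constant because its loops have no common vertex. -/
theorem figureEight_or_barbell_iff {v : G.V} {p : List (G.E × Bool)} :
    G.IsFigureEight v p ∨ G.IsBarbell v p ↔
      ∃ w a k b, p = a ++ k ++ b ++ FreeGroup.invRev k ∧ G.IsSeparated v w a k b := by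
  constructor
  · rintro (⟨a, b, rfl, ha, hb, hv, he⟩ | ⟨w, a, k, b, rfl, ha, hk, hb, hv, he⟩)
    · refine ⟨v, a, [], b, by simp, ha, rfl, hb, ?_, by simpa [edges] using he⟩
      rw [ha.verts_eq] at hv
      simp only [support_nil]
      grind
    · refine ⟨w, a, k, b, rfl, ha, hk, hb, ?_, he⟩
      rw [hb.verts_eq, ha.verts_eq] at hv
      cases k with
      | nil =>
        obtain rfl : v = w := hk
        simp [verts] at hv
      | cons d k =>
        rw [support_cons, support, hk.1]
        simp only [verts, List.map_cons, List.tail_cons] at hv ⊢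
        grind
  · rintro ⟨w, a, k, b, rfl, ha, hk, hb, hv, he⟩
    cases k with
    | nil =>
      obtain rfl : v = w := hk
      refine Or.inl ⟨a, b, by simp, ha, hb, ?_, by simpa [edges] using he⟩
      rw [ha.verts_eq]
      simp only [support_nil] at hv
      grind
    | cons d k =>
      refine Or.inr ⟨w, a, d :: k, b, rfl, ha, hk, hb, ?_, he⟩
      rw [hb.verts_eq, ha.verts_eq]
      rw [support_cons, support, hk.1] at hv
      simp only [verts, List.map_cons, List.tail_cons] at hv ⊢
      grind

/-- The vertices of a path other than its initial vertex. -/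
def laterVerts (G : FinGraph) (p : List (G.E × Bool)) : List G.V := p.map G.term

theorem support_eq_cons {u v : G.V} {p : List (G.E × Bool)} (hp : G.IsPath u p v) :
    G.support p v = u :: G.laterVerts p := by
  induction p generalizing u with
  | nil => cases hp; rfl
  | cons d p ih => rw [support_cons, ih hp.2, hp.1]; rfl

theorem verts_invRev (p : List (G.E × Bool)) :
    G.verts (FreeGroup.invRev p) = (G.laterVerts p).reverse := by
  simp only [verts, laterVerts, FreeGroup.invRev, List.map_reverse, List.map_map]
  congr 1
  exact List.map_congr_left fun d _ => init_flip d

/-- Run as one reduced path in a forest, the two legs and the arc `k` between them repeat no vertex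
and no edge; this records the disjointness of the three pieces at once. -/
theorem Acyclic.branch_nodup {T : Set G.E} (hT : G.Acyclic T) {x y u v : G.V}
    {l₁ k l₂ : List (G.E × Bool)} (h₁ : G.IsPath x l₁ u) (hk : G.IsPath x k y)
    (h₂ : G.IsPath y l₂ v) (hl₁ : ∀ d ∈ l₁, d.1 ∈ T) (hkT : ∀ d ∈ k, d.1 ∈ T)
    (hl₂ : ∀ d ∈ l₂, d.1 ∈ T) (hr : FreeGroup.IsReduced (FreeGroup.invRev l₁ ++ k ++ l₂)) :
    ((G.laterVerts l₁).reverse ++ G.support k y ++ G.laterVerts l₂).Nodup ∧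
      ((G.edges l₁).reverse ++ G.edges k ++ G.edges l₂).Nodup := by
  have hp := (h₁.invRev.append hk).append h₂
  have hpT : ∀ d ∈ FreeGroup.invRev l₁ ++ k ++ l₂, d.1 ∈ T := by
    intro d hd
    rcases List.mem_append.1 hd with hd | hd
    · rcases List.mem_append.1 hd with hd | hd
      · exact hl₁ (d.1, !d.2) (mem_invRev_iff.1 hd)
      · exact hkT d hd
    · exact hl₂ d hd
  have h3 := hT.support_nodup hp hpT hr
  have h4 := edges_nodup_of_support_nodup hp h3
  rw [edges_append, edges_append, edges_invRev] at h4
  refine ⟨?_, h4⟩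
  rw [List.append_assoc, support_append, support_append, support_eq_cons h₂, verts_invRev] at h3
  simpa [support] using h3

end FinGraph

/-! ### Petals and products of two petals as curves in the graph -/

namespace MarkedGraph

variable {n : ℕ} {G R : MarkedGraph n} {c : Collapse G.toFinGraph R.toFinGraph}

theorem Compat.isReduced_edges_nodup (hc : Compat c) {u v : G.V} {p : List (G.E × Bool)}
    (hp : G.IsPath u p v) (hpT : ∀ d ∈ p, d.1 ∈ c.kernel) (hr : FreeGroup.IsReduced p) :
    (G.edges p).Nodup :=
  FinGraph.edges_nodup_of_support_nodup hp (hc.acyclic.support_nodup hp hpT hr)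

/-- The simple loop given by a petal. -/
theorem Compat.exists_petal_loop (hR : R.IsRose) (hc : Compat c) (β : R.E × Bool) :
    ∃ d q, c.dart d = [β] ∧ (∀ x ∈ q, x.1 ∈ c.kernel) ∧
      G.IsSimpleClosed (G.init d) (d :: q) := by
  obtain ⟨d, hd⟩ := c.exists_dart β
  obtain ⟨q, hq, hqT, hqr⟩ := (hR.spans c).exists_isReduced (G.term d) (G.init d)
  refine ⟨d, q, hd, hqT, FinGraph.isSimpleClosed_cons_iff.2 ⟨rfl, hq,
    hc.acyclic.support_nodup hq hqT hqr, fun hmem => ?_⟩⟩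
  obtain ⟨x, hx, hxd⟩ := List.mem_map.1 hmem
  exact c.not_mem_kernel_of_dart_eq hd (hxd ▸ hqT x hx)

theorem Compat.isSimpleLoop (hR : R.IsRose) (hc : Compat c) {β : R.E × Bool}
    {γ : FreeGroup (Fin n)} (h : IsConj (FreeGroup.mk [β]) (R.marking γ)) :
    G.IsSimpleLoop γ := by
  obtain ⟨d, q, hd, hqT, hs⟩ := hc.exists_petal_loop hR β
  refine ⟨G.init d, d :: q, hs, (hc.represents_iff hR hs.2.1).2 ?_⟩
  rwa [c.path_cons, hd, c.path_of_forall_mem_kernel hqT]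

/-- Otherwise `d` followed by `q` would be a closed path in the forest with exponent sum `±1` at the
edge of `d`, hence not null-homotopic. -/
theorem not_mem_of_isPath_acyclic {T : Set G.E} (hT : G.Acyclic T) {d : G.E × Bool}
    {q : List (G.E × Bool)} (hq : G.IsPath (G.term d) q (G.init d))
    (hqT : ∀ x ∈ q, x.1 ∈ T) (hdq : d.1 ∉ G.edges q) : d.1 ∉ T := by
  intro hd
  have h1 := hT (G.init d) (d :: q) ⟨rfl, hq⟩ (by
    intro x hx
    rcases List.mem_cons.1 hx with rfl | hx
    · exact hd
    · exact hqT x hx)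
  have h2 : expSum d.1 (FreeGroup.mk (d :: q)) = letterSign d.2 := by
    rw [mk_cons, expSum_mul, expSum_mk_singleton, expSum_mk_eq_zero, add_zero]
    intro x hx hxd
    exact hdq (hxd ▸ List.mem_map_of_mem hx)
  rw [h1, expSum_one] at h2
  have := letterSign_abs d.2
  rw [← h2] at this
  simp at this

/-- Every simple loop is a petal of a rose face. -/
theorem IsSimpleLoop.exists_petal (hn : 2 ≤ n) {γ : FreeGroup (Fin n)} (h : G.IsSimpleLoop γ) :
    ∃ (T : Set G.E) (hT : G.IsTree T) (β : (G.roseOf hn hT).E × Bool),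
      IsConj (FreeGroup.mk [β]) ((G.roseOf hn hT).marking γ) := by
  obtain ⟨v, p, hs, hp⟩ := h
  cases p with
  | nil => exact absurd rfl hs.1
  | cons d q =>
    obtain ⟨rfl, hq, hnd, hdq⟩ := FinGraph.isSimpleClosed_cons_iff.1 hs
    -- The loop without its first edge is an embedded path, so it lies in a spanning tree, and the
    -- loop becomes the petal of its first edge.
    obtain ⟨T, hAT, -, hT⟩ := FinGraph.exists_isTree (FinGraph.hasPotential_edges hq hnd)
      (Set.subset_univ _) (fun u v => (G.connected u v).imp fun p hp => ⟨hp, by simp⟩)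
    have hqT : ∀ x ∈ q, x.1 ∈ T := fun x hx => hAT (List.mem_map_of_mem hx)
    have hd := not_mem_of_isPath_acyclic hT.2.acyclic hq hqT hdq
    rw [← G.kernel_roseCollapse hn hT] at hd hqT
    obtain ⟨β, hβ⟩ := (G.roseCollapse hn hT).exists_dart_eq hd
    refine ⟨T, hT, β, ?_⟩
    have h1 := ((G.compat_roseCollapse hn hT).represents_iff (G.isRose_roseOf hn hT) hs.2.1).1 hp
    rwa [Collapse.path_cons, hβ, Collapse.path_of_forall_mem_kernel _ hqT] at h1

/-- Every figure-eight or barbell curve is the product of two petals of a rose face. -/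
theorem exists_petal_pair_of_isSeparated (hn : 2 ≤ n) {γ : FreeGroup (Fin n)} {v w : G.V}
    {a k b : List (G.E × Bool)} (hs : G.IsSeparated v w a k b)
    (h : G.Represents v (a ++ k ++ b ++ FreeGroup.invRev k) γ) :
    ∃ (T : Set G.E) (hT : G.IsTree T) (β β' : (G.roseOf hn hT).E × Bool), β.1 ≠ β'.1 ∧
      IsConj (FreeGroup.mk [β, β']) ((G.roseOf hn hT).marking γ) := by
  obtain ⟨ha, hk, hb, hv, he⟩ := hs
  cases a with
  | nil => exact absurd rfl ha.1
  | cons d a =>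
    obtain ⟨b, d', rfl⟩ : ∃ b' d', b = b' ++ [d'] :=
      ⟨b.dropLast, b.getLast hb.1, (List.dropLast_append_getLast hb.1).symm⟩
    obtain ⟨rfl, ha', -, hda⟩ := FinGraph.isSimpleClosed_cons_iff.1 ha
    obtain ⟨x, hb', rfl, hd'w⟩ := FinGraph.isPath_append_iff.1 hb.2.1
    have hd'w : G.term d' = w := hd'w
    -- Without the first edge of the first loop and the last edge of the second one, the loops and
    -- the arc form one embedded path. In the rose of a spanning tree containing it, the two omitted
    -- edges are the petals of the product.
    have hsupp : (G.support (a ++ k ++ b) (G.init d')).Nodup := by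
      have h1 := hb.verts_eq
      have h2 : G.support (a ++ k ++ b) (G.init d')
          = G.verts a ++ (G.verts k ++ G.verts (b ++ [d'])) := by
        rw [FinGraph.support_append]
        simp [FinGraph.verts, FinGraph.support]
      rw [h2, h1]
      simpa [FinGraph.verts, FinGraph.support] using hv
    have hpath := (ha'.append hk).append hb'
    obtain ⟨T, hAT, -, hT⟩ := FinGraph.exists_isTree
      (FinGraph.hasPotential_edges hpath hsupp)
      (Set.subset_univ _) (fun u v => (G.connected u v).imp fun p hp => ⟨hp, by simp⟩)
    have hmem : ∀ x ∈ a ++ k ++ b, x.1 ∈ T := fun x hx => hAT (List.mem_map_of_mem hx)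
    have haT : ∀ x ∈ a, x.1 ∈ T := fun x hx => hmem x (by simp [hx])
    have hkT : ∀ x ∈ k, x.1 ∈ T := fun x hx => hmem x (by simp [hx])
    have hbT : ∀ x ∈ b, x.1 ∈ T := fun x hx => hmem x (by simp [hx])
    have hk'T : ∀ x ∈ FreeGroup.invRev k, x.1 ∈ T :=
      fun x hx => hkT (x.1, !x.2) (FinGraph.mem_invRev_iff.1 hx)
    have hd := not_mem_of_isPath_acyclic hT.2.acyclic ha' haT hda
    have hd' : d'.1 ∉ T := by
      refine not_mem_of_isPath_acyclic hT.2.acyclic (hd'w ▸ hb') hbT ?_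
      have := hb.2.2.2
      rw [FinGraph.edges_append, List.nodup_append] at this
      intro hmem
      exact this.2.2 _ hmem d'.1 (by simp [FinGraph.edges]) rfl
    have hdd' : d.1 ≠ d'.1 := by
      simp only [FinGraph.edges, List.map_cons, List.map_append, List.map_nil] at he
      grind
    rw [← G.kernel_roseCollapse hn hT] at hd hd' haT hkT hbT hk'T
    obtain ⟨β, hβ⟩ := (G.roseCollapse hn hT).exists_dart_eq hd
    obtain ⟨β', hβ'⟩ := (G.roseCollapse hn hT).exists_dart_eq hd'
    refine ⟨T, hT, β, β', fun hbb => hdd' (((G.roseCollapse hn hT).edge_eq_iff hβ hβ').2 hbb), ?_⟩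
    have h1 := ((G.compat_roseCollapse hn hT).represents_iff (G.isRose_roseOf hn hT) h.1).1 h
    simpa [Collapse.path_of_forall_mem_kernel _ haT, Collapse.path_of_forall_mem_kernel _ hkT,
      Collapse.path_of_forall_mem_kernel _ hbT, Collapse.path_of_forall_mem_kernel _ hk'T,
      hβ, hβ'] using h1

theorem IsAlmostSimple.cases {γ : FreeGroup (Fin n)} (h : G.IsAlmostSimple γ) :
    G.IsSimpleLoop γ ∨ ∃ v w a k b, G.IsSeparated v w a k b ∧
      G.Represents v (a ++ k ++ b ++ FreeGroup.invRev k) γ := by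
  obtain ⟨v, p, h | h, hp⟩ := h
  · exact Or.inl ⟨v, p, h, hp⟩
  · obtain ⟨w, a, k, b, rfl, hs⟩ := FinGraph.figureEight_or_barbell_iff.1 h
    exact Or.inr ⟨v, w, a, k, b, hs, hp⟩

theorem Compat.abs_expSum_marking (hc : Compat c) {γ : FreeGroup (Fin n)} {v : G.V}
    {p : List (G.E × Bool)} (h : G.Represents v p γ) {e : G.E} {b : R.E} {t : Bool}
    (he : c.onE e = some (b, t)) :
    |expSum b (R.marking γ)| = |expSum e (FreeGroup.mk p)| := by
  rw [← expSum_eq_of_isConj b ((c.hom.map_isConj h.isConj).trans (hc γ)), c.expSum_hom he,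
    abs_mul, letterSign_abs, one_mul]

/-- An almost simple closed curve has small exponent sums in every rose face. -/
theorem IsAlmostSimple.abs_expSum_le (hc : Compat c) {γ : FreeGroup (Fin n)}
    (h : G.IsAlmostSimple γ) (b : R.E) : |expSum b (R.marking γ)| ≤ 1 := by
  obtain ⟨e, ⟨t, he⟩, -⟩ := c.onE_bijective b
  rcases h.cases with ⟨v, p, hs, hp⟩ | ⟨v, w, a, k, b, hs, hp⟩
  · rw [hc.abs_expSum_marking hp he]
    exact abs_expSum_mk_le_of_nodup hs.2.2.2 e
  · rw [hc.abs_expSum_marking hp he]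
    -- The arc is run once in each direction and cancels; the two loops have no common edge.
    have h1 : expSum e (FreeGroup.mk (a ++ k ++ b ++ FreeGroup.invRev k))
        = expSum e (FreeGroup.mk (a ++ b)) := by
      simp only [expSum_mk_append, expSum_mk_invRev]; ring
    rw [h1]
    refine abs_expSum_mk_le_of_nodup ?_ e
    have := hs.edges_nodup
    simp only [FinGraph.edges] at this
    rw [List.map_append]
    grind

/-- A theta curve has an exponent sum two in some rose face. -/
theorem Compat.exists_rose_of_common_dart (hn : 2 ≤ n) (hR : R.IsRose) (hc : Compat c)
    {γ : FreeGroup (Fin n)} {d d' g : G.E × Bool} {q q' : List (G.E × Bool)}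
    (hd : d.1 ∉ c.kernel) (hd' : d'.1 ∉ c.kernel)
    (hq : G.IsPath (G.term d) q (G.init d')) (hq' : G.IsPath (G.term d') q' (G.init d))
    (hqT : ∀ x ∈ q, x.1 ∈ c.kernel) (hqT' : ∀ x ∈ q', x.1 ∈ c.kernel)
    (hqr : FreeGroup.IsReduced q) (hqr' : FreeGroup.IsReduced q')
    (h : G.Represents (G.init d) (d :: (q ++ d' :: q')) γ) (hg : g ∈ q) (hg' : g ∈ q') :
    ∃ (R' : MarkedGraph n) (b : R'.E), R'.IsRose ∧ R'.IsFaceOf G ∧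
      ¬ |expSum b (R'.marking γ)| ≤ 1 := by
  have hgT := hqT g hg
  have hnd := hc.isReduced_edges_nodup hq hqT hqr
  have hnd' := hc.isReduced_edges_nodup hq' hqT' hqr'
  have hexp : expSum g.1 (FreeGroup.mk (d :: (q ++ d' :: q'))) = 2 * letterSign g.2 := by
    rw [mk_cons, expSum_mul, expSum_mk_append, mk_cons d', expSum_mul,
      expSum_mk_singleton_of_ne (fun h => hd (h ▸ hgT)),
      expSum_mk_singleton_of_ne (fun h => hd' (h ▸ hgT)), expSum_mk_of_nodup hnd hg,
      expSum_mk_of_nodup hnd' hg']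
    ring
  obtain ⟨u₁, u₂, rfl⟩ := List.append_of_mem hg
  obtain ⟨w₁, w₂, rfl⟩ := List.append_of_mem hg'
  obtain ⟨x, -, -, hu₂⟩ := FinGraph.isPath_append_iff.1 hq
  obtain ⟨y, hw₁, hy, -⟩ := FinGraph.isPath_append_iff.1 hq'
  -- The part of the curve between its two passages of `g` joins the end of `g` to its start and
  -- avoids `g`. So there is a spanning tree without `g`, and `g` is a petal of its rose.
  have hspan : G.Spans {e | e ≠ g.1} := by
    refine FinGraph.spans_ne_of_detour (hR.spans c) (q := u₂ ++ d' :: w₁)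
      (hu₂.append (v := G.init d') ⟨rfl, hy ▸ hw₁⟩) fun z hz hzg => ?_
    rcases List.mem_append.1 hz with hz | hz
    · simp only [FinGraph.edges, List.map_append, List.map_cons] at hnd
      have : z.1 ∈ u₂.map Prod.fst := List.mem_map_of_mem hz
      grind
    · rcases List.mem_cons.1 hz with rfl | hz
      · exact hd' (hzg ▸ hgT)
      · simp only [FinGraph.edges, List.map_append, List.map_cons] at hnd'
        have : z.1 ∈ w₁.map Prod.fst := List.mem_map_of_mem hz
        grind
  obtain ⟨T, -, hTB, hT⟩ := FinGraph.exists_isTree FinGraph.hasPotential_empty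
    (Set.empty_subset _) hspan
  have hgT' : g.1 ∉ T := fun hgT => hTB hgT rfl
  refine ⟨G.roseOf hn hT, G.petal g.1 hgT', G.isRose_roseOf hn hT, G.isFaceOf_roseOf hn hT, ?_⟩
  have he : (G.roseCollapse hn hT).onE g.1 = some (G.petal g.1 hgT', true) :=
    G.treeCollapse_of_not_mem _ _ hgT'
  rw [(G.compat_roseCollapse hn hT).abs_expSum_marking h he, hexp, abs_mul, letterSign_abs]
  norm_num

end MarkedGraph

namespace FinGraph

variable {G : FinGraph}

theorem verts_leg_loop {x : G.V} {d : G.E × Bool} {s r : List (G.E × Bool)}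
    (hs : G.IsPath x s (G.init d)) :
    G.verts (s ++ d :: FreeGroup.invRev r)
      = x :: (G.laterVerts s ++ (G.laterVerts r).reverse) := by
  rw [← List.cons_append, ← support_eq_cons hs, ← verts_invRev]
  simp [verts, support]

theorem edges_leg_loop {d : G.E × Bool} {s r : List (G.E × Bool)} :
    G.edges (s ++ d :: FreeGroup.invRev r) = G.edges s ++ d.1 :: (G.edges r).reverse := by
  rw [← edges_invRev]; simp [edges]

/-- Two edges outside a forest whose end points are the four ends of an `H` in the forest. -/
theorem Acyclic.isSeparated_of_legs {T : Set G.E} (hT : G.Acyclic T) {x y : G.V}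
    {d d' : G.E × Bool} {s r s' r' k : List (G.E × Bool)}
    (hd : d.1 ∉ T) (hd' : d'.1 ∉ T) (hdd : d.1 ≠ d'.1)
    (hs : G.IsPath x s (G.init d)) (hr : G.IsPath x r (G.term d))
    (hs' : G.IsPath y s' (G.init d')) (hr' : G.IsPath y r' (G.term d')) (hk : G.IsPath x k y)
    (hsT : ∀ z ∈ s, z.1 ∈ T) (hrT : ∀ z ∈ r, z.1 ∈ T) (hsT' : ∀ z ∈ s', z.1 ∈ T)
    (hrT' : ∀ z ∈ r', z.1 ∈ T) (hkT : ∀ z ∈ k, z.1 ∈ T)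
    (h₁ : FreeGroup.IsReduced (FreeGroup.invRev r ++ k ++ s'))
    (h₂ : FreeGroup.IsReduced (FreeGroup.invRev r ++ k ++ r'))
    (h₃ : FreeGroup.IsReduced (FreeGroup.invRev s ++ k ++ s'))
    (h₄ : FreeGroup.IsReduced (FreeGroup.invRev s ++ k ++ r'))
    (h₅ : FreeGroup.IsReduced (FreeGroup.invRev r ++ s))
    (h₆ : FreeGroup.IsReduced (FreeGroup.invRev r' ++ s')) :
    G.IsSeparated x y (s ++ d :: FreeGroup.invRev r) k (s' ++ d' :: FreeGroup.invRev r') := by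
  -- Four reduced paths join a leg at `x` to a leg at `y` through `k`, and two join the legs at the
  -- same branch point; together they separate all pairs of pieces.
  obtain ⟨v₁, e₁⟩ := hT.branch_nodup hr hk hs' hrT hkT hsT' h₁
  obtain ⟨v₂, e₂⟩ := hT.branch_nodup hr hk hr' hrT hkT hrT' h₂
  obtain ⟨v₃, e₃⟩ := hT.branch_nodup hs hk hs' hsT hkT hsT' h₃
  obtain ⟨v₄, e₄⟩ := hT.branch_nodup hs hk hr' hsT hkT hrT' h₄
  obtain ⟨v₅, e₅⟩ := hT.branch_nodup (k := []) hr rfl hs hrT (by simp) hsT (by simpa using h₅)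
  obtain ⟨v₆, e₆⟩ := hT.branch_nodup (k := []) hr' rfl hs' hrT' (by simp) hsT' (by simpa using h₆)
  have hxk := start_mem_support hk
  have hyk : y ∈ G.support k y := by simp [support]
  have hne : ∀ {p : List (G.E × Bool)} {z : G.E × Bool}, (∀ z ∈ p, z.1 ∈ T) → z.1 ∉ T →
      z.1 ∉ G.edges p := by
    intro p z hp hz hmem
    obtain ⟨w, hw, hwz⟩ := List.mem_map.1 hmem
    exact hz (hwz ▸ hp w hw)
  have n₁ := hne hsT hd
  have n₂ := hne hrT hd
  have n₃ := hne hsT' hd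
  have n₄ := hne hrT' hd
  have n₅ := hne hkT hd
  have m₁ := hne hsT hd'
  have m₂ := hne hrT hd'
  have m₃ := hne hsT' hd'
  have m₄ := hne hrT' hd'
  have m₅ := hne hkT hd'
  have hloop : ∀ {x : G.V} {d : G.E × Bool} {s r : List (G.E × Bool)},
      G.IsPath x s (G.init d) → G.IsPath x r (G.term d) →
      G.IsPath x (s ++ d :: FreeGroup.invRev r) x :=
    fun hs hr => hs.append ⟨rfl, hr.invRev⟩
  simp only [List.nodup_append, List.nodup_reverse, List.mem_append, List.mem_reverse,
    support_nil, List.mem_singleton, edges, List.map_nil] at v₁ v₂ v₃ v₄ v₅ v₆ e₁ e₂ e₃ e₄ e₅ e₆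
  refine ⟨⟨by simp, hloop hs hr, ?_, ?_⟩, hk, ⟨by simp, hloop hs' hr', ?_, ?_⟩, ?_, ?_⟩
  · rw [verts_leg_loop hs]
    simp only [List.nodup_append, List.nodup_cons, List.nodup_reverse, List.mem_append,
      List.mem_reverse]
    grind
  · rw [edges_leg_loop]
    simp only [List.nodup_append, List.nodup_cons, List.nodup_reverse, List.mem_cons,
      List.mem_reverse]
    simp only [edges] at *
    grind
  · rw [verts_leg_loop hs']
    simp only [List.nodup_append, List.nodup_cons, List.nodup_reverse, List.mem_append,
      List.mem_reverse]
    grind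
  · rw [edges_leg_loop]
    simp only [List.nodup_append, List.nodup_cons, List.nodup_reverse, List.mem_cons,
      List.mem_reverse]
    simp only [edges] at *
    grind
  · rw [verts_leg_loop hs, verts_leg_loop hs', List.tail_cons, List.tail_cons]
    simp only [List.nodup_append, List.nodup_reverse, List.mem_append, List.mem_reverse]
    grind
  · rw [edges_leg_loop, edges_leg_loop]
    simp only [List.nodup_append, List.nodup_cons, List.nodup_reverse, List.mem_append,
      List.mem_cons, List.mem_reverse]
    simp only [edges] at *
    grind

end FinGraph

namespace MarkedGraph

open FinGraph

variable {n : ℕ} {G R : MarkedGraph n} {c : Collapse G.toFinGraph R.toFinGraph}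

/-- The product of two petals is a simple loop, a figure-eight or a barbell, or it is a theta curve,
which has an exponent sum two in some rose face. -/
theorem Compat.isSimpleLoop_or_isSeparated (hn : 2 ≤ n) (hR : R.IsRose) (hc : Compat c)
    {β β' : R.E × Bool} (hβ : β.1 ≠ β'.1) {γ : FreeGroup (Fin n)}
    (h : IsConj (FreeGroup.mk [β, β']) (R.marking γ))
    (hexp : ∀ (R' : MarkedGraph n) (b : R'.E), R'.IsRose → R'.IsFaceOf G →
      |expSum b (R'.marking γ)| ≤ 1) :
    G.IsSimpleLoop γ ∨ ∃ v w a k b, G.IsSeparated v w a k b ∧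
      c.path a = [β] ∧ c.path k = [] ∧ c.path b = [β'] := by
  obtain ⟨d, hd⟩ := c.exists_dart β
  obtain ⟨d', hd'⟩ := c.exists_dart β'
  have hdT := c.not_mem_kernel_of_dart_eq hd
  have hdT' := c.not_mem_kernel_of_dart_eq hd'
  have hdd : d.1 ≠ d'.1 := fun he => hβ ((c.edge_eq_iff hd hd').1 he)
  obtain ⟨q, hq, hqT, hqr⟩ := (hR.spans c).exists_isReduced (G.term d) (G.init d')
  obtain ⟨q', hq', hqT', hqr'⟩ := (hR.spans c).exists_isReduced (G.term d') (G.init d)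
  have hpath : G.IsPath (G.init d) (d :: (q ++ d' :: q')) (G.init d) :=
    ⟨rfl, hq.append ⟨rfl, hq'⟩⟩
  have hrep : G.Represents (G.init d) (d :: (q ++ d' :: q')) γ := by
    refine (hc.represents_iff hR hpath).2 ?_
    rw [c.path_cons, c.path_append, c.path_cons, hd, hd', c.path_of_forall_mem_kernel hqT,
      c.path_of_forall_mem_kernel hqT']
    exact h
  -- Two passages of a tree edge in the same direction would contradict `hexp`; only opposite
  -- passages remain.
  have hcommon : ∀ g, g ∈ q → g ∉ q' := by
    intro g hg hg'
    obtain ⟨R', b, hR', hRG, hb⟩ :=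
      hc.exists_rose_of_common_dart hn hR hdT hdT' hq hq' hqT hqT' hqr hqr' hrep hg hg'
    exact hb (hexp R' b hR' hRG)
  by_cases hdisj : ∃ x, x ∈ G.support q (G.init d') ∧ x ∈ G.support q' (G.init d)
  swap
  · left
    refine ⟨_, _, isSimpleClosed_cons_iff.2 ⟨rfl, hpath.2, ?_, ?_⟩, hrep⟩
    · have h1 := hc.acyclic.support_nodup hq hqT hqr
      have h2 := hc.acyclic.support_nodup hq' hqT' hqr'
      have h3 : G.support (q ++ d' :: q') (G.init d)
          = G.support q (G.init d') ++ G.support q' (G.init d) := by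
        rw [support_append, support_cons]; simp [support]
      rw [h3, List.nodup_append]
      refine ⟨h1, h2, ?_⟩
      rintro x hx y hy rfl
      exact hdisj ⟨x, hx, hy⟩
    · intro hmem
      obtain ⟨z, hz, hzd⟩ := List.mem_map.1 hmem
      rcases List.mem_append.1 hz with hz | hz
      · exact hdT (hzd ▸ hqT z hz)
      · rcases List.mem_cons.1 hz with rfl | hz
        · exact hdd hzd.symm
        · exact hdT (hzd ▸ hqT' z hz)
  right
  obtain ⟨x, hx, hx'⟩ := hdisj
  obtain ⟨r₁, s₁, rfl, hr₁, hs₁⟩ := exists_split_of_mem_support hq hx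
  obtain ⟨r₂, s₂, rfl, hr₂, hs₂⟩ := exists_split_of_mem_support hq' hx'
  -- From the common vertex `x`, the paths to the two ends of `d'` run together along `k₀` up to a
  -- branch point `y`. From `y`, the paths to the two ends of `d` then run together along `k` up to
  -- a second branch point `z`. This gives the crossbar `k` and the four legs `r`, `s`, `r'`, `s'`
  -- of the `H`.
  obtain ⟨k₀, s', r', rfl, hr₂', hh'⟩ := exists_common_prefix s₁ (FreeGroup.invRev r₂)
  obtain rfl : r₂ = FreeGroup.invRev r' ++ FreeGroup.invRev k₀ := by
    rw [← FreeGroup.invRev_append, ← hr₂', FreeGroup.invRev_invRev]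
  obtain ⟨y, hk₀, hs'⟩ := isPath_append_iff.1 hs₁
  obtain ⟨y', hr', hk₀'⟩ := isPath_append_iff.1 hr₂
  obtain rfl : y = y' := by
    have := hk₀'.invRev
    rw [FreeGroup.invRev_invRev] at this
    exact hk₀.end_unique this
  obtain ⟨k, r, s, hρ, hσ, hh⟩ := exists_common_prefix (FreeGroup.invRev k₀ ++ FreeGroup.invRev r₁)
    (FreeGroup.invRev k₀ ++ s₂)
  have hρ' : r₁ ++ k₀ = FreeGroup.invRev r ++ FreeGroup.invRev k := by
    rw [← FreeGroup.invRev_append, ← hρ, FreeGroup.invRev_append, FreeGroup.invRev_invRev,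
      FreeGroup.invRev_invRev]
  have eq₁ : r₁ ++ (k₀ ++ s') = FreeGroup.invRev r ++ FreeGroup.invRev k ++ s' := by
    rw [← List.append_assoc, hρ']
  have eq₂ : FreeGroup.invRev r' ++ FreeGroup.invRev k₀ ++ s₂ = FreeGroup.invRev r' ++ k ++ s := by
    rw [List.append_assoc, hσ, List.append_assoc]
  have hρp : G.IsPath y (k ++ r) (G.term d) := hρ ▸ hk₀.invRev.append hr₁.invRev
  have hσp : G.IsPath y (k ++ s) (G.init d) := hσ ▸ hk₀.invRev.append hs₂
  obtain ⟨z, hk, hr⟩ := isPath_append_iff.1 hρp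
  obtain ⟨z', hkz, hs⟩ := isPath_append_iff.1 hσp
  obtain rfl := hk.end_unique hkz
  rw [eq₁] at hqr hqT hcommon
  rw [eq₂] at hqr' hqT' hcommon
  have hrp : G.IsPath y r' (G.term d') := by
    have := hr'.invRev
    rwa [FreeGroup.invRev_invRev] at this
  have hrT : ∀ z ∈ r, z.1 ∈ c.kernel := fun z hz => by
    refine hqT (z.1, !z.2) ?_
    simp [mem_invRev_iff, hz]
  have hrT' : ∀ z ∈ r', z.1 ∈ c.kernel := fun z hz => by
    refine hqT' (z.1, !z.2) ?_
    simp [mem_invRev_iff, hz]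
  have hsT : ∀ z ∈ s, z.1 ∈ c.kernel := fun z hz => hqT' z (by simp [hz])
  have hsT' : ∀ z ∈ s', z.1 ∈ c.kernel := fun z hz => hqT z (by simp [hz])
  have hkT : ∀ z ∈ FreeGroup.invRev k, z.1 ∈ c.kernel := fun z hz => hqT z (by simp [hz])
  have rr : FreeGroup.IsReduced r := by
    have := isReduced_invRev (hqr.infix ⟨[], FreeGroup.invRev k ++ s', by simp⟩ :
      FreeGroup.IsReduced (FreeGroup.invRev r))
    rwa [FreeGroup.invRev_invRev] at this
  have rr' : FreeGroup.IsReduced r' := by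
    have := isReduced_invRev (hqr'.infix ⟨[], k ++ s, by simp⟩ :
      FreeGroup.IsReduced (FreeGroup.invRev r'))
    rwa [FreeGroup.invRev_invRev] at this
  have rs : FreeGroup.IsReduced s := hqr'.infix (List.suffix_append _ _).isInfix
  have rs' : FreeGroup.IsReduced s' := hqr.infix (List.suffix_append _ _).isInfix
  have hq4 : FreeGroup.IsReduced (FreeGroup.invRev s ++ FreeGroup.invRev k ++ r') := by
    have := isReduced_invRev hqr'
    simpa only [FreeGroup.invRev_append, FreeGroup.invRev_invRev, List.append_assoc] using this
  have hhs : ∀ d ∈ s.head?, d ∉ s'.head? := fun g hg hg' =>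
    hcommon g (by simp [List.mem_of_mem_head? hg']) (by simp [List.mem_of_mem_head? hg])
  have hhr : ∀ d ∈ r.head?, d ∉ r'.head? := fun g hg hg' =>
    hcommon (g.1, !g.2) (by simp [mem_invRev_iff, List.mem_of_mem_head? hg])
      (by simp [mem_invRev_iff, List.mem_of_mem_head? hg'])
  refine ⟨z, y, _, FreeGroup.invRev k, _, hc.acyclic.isSeparated_of_legs hdT hdT' hdd hs hr hs'
    hrp hk.invRev hsT hrT hsT' hrT' hkT hqr ?_ ?_ hq4 (isReduced_invRev_append rr rs hh)
    (isReduced_invRev_append rr' rs' fun g hg hg' => hh' g hg' hg), ?_, ?_, ?_⟩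
  -- If the crossbar is not constant, reducedness follows from that of the first tree path and of
  -- the inverse of the second, which overlap along it. If it is constant, legs starting with the
  -- same edge would mean a common passage in the same direction. The next case is analogous.
  · by_cases hk0 : FreeGroup.invRev k = []
    · rw [hk0, List.append_nil]; exact isReduced_invRev_append rr rr' hhr
    · refine FreeGroup.IsReduced.append_overlap (hqr.infix ⟨[], s', by simp⟩)
        (hq4.infix ⟨FreeGroup.invRev s, [], by simp⟩) hk0
  · by_cases hk0 : FreeGroup.invRev k = []
    · rw [hk0, List.append_nil]; exact isReduced_invRev_append rs rs' hhs
    · refine FreeGroup.IsReduced.append_overlap (hq4.infix ⟨[], r', by simp⟩)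
        (hqr.infix ⟨FreeGroup.invRev r, [], by simp⟩) hk0
  · rw [c.path_append, c.path_cons, hd, c.path_of_forall_mem_kernel hsT,
      c.path_of_forall_mem_kernel (p := FreeGroup.invRev r)]
    · rfl
    · exact fun z hz => hrT (z.1, !z.2) (mem_invRev_iff.1 hz)
  · exact c.path_of_forall_mem_kernel hkT
  · rw [c.path_append, c.path_cons, hd', c.path_of_forall_mem_kernel hsT',
      c.path_of_forall_mem_kernel (p := FreeGroup.invRev r')]
    · rfl
    · exact fun z hz => hrT' (z.1, !z.2) (mem_invRev_iff.1 hz)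

theorem IsSeparated.isPath {v w : G.V} {a k b : List (G.E × Bool)}
    (h : G.IsSeparated v w a k b) : G.IsPath v (a ++ k ++ b ++ FreeGroup.invRev k) v :=
  ((h.left.2.1.append h.arc).append h.right.2.1).append h.arc.invRev

theorem path_invRev_of_path_eq_nil {k : List (G.E × Bool)} (hk : c.path k = []) :
    c.path (FreeGroup.invRev k) = [] := by
  refine c.path_of_forall_mem_kernel fun z hz => ?_
  have h1 := List.flatMap_eq_nil_iff.1 hk _ (mem_invRev_iff.1 hz)
  by_contra hzT
  obtain ⟨β, hβ⟩ := c.exists_dart_eq (d := (z.1, !z.2)) hzT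
  rw [hβ] at h1
  simp at h1

theorem IsSeparated.represents (hR : R.IsRose) (hc : Compat c) {β β' : R.E × Bool}
    {γ : FreeGroup (Fin n)} (h : IsConj (FreeGroup.mk [β, β']) (R.marking γ)) {v w : G.V}
    {a k b : List (G.E × Bool)} (hs : G.IsSeparated v w a k b) (ha : c.path a = [β])
    (hk : c.path k = []) (hb : c.path b = [β']) :
    G.Represents v (a ++ k ++ b ++ FreeGroup.invRev k) γ := by
  refine (hc.represents_iff hR (IsSeparated.isPath hs)).2 ?_
  simpa [ha, hk, hb, path_invRev_of_path_eq_nil hk] using h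

variable {G' : MarkedGraph n}

theorem IsSimpleLoop.of_roseFaces_eq (hn : 2 ≤ n) (hG : G.roseFaces = G'.roseFaces)
    {γ : FreeGroup (Fin n)} (h : G.IsSimpleLoop γ) : G'.IsSimpleLoop γ := by
  obtain ⟨T, hT, β, hβ⟩ := h.exists_petal hn
  obtain ⟨c, hc⟩ := ((G.isFaceOf_roseOf hn hT).of_roseFaces_eq hG
    (G.isRose_roseOf hn hT)).exists_compat
  exact hc.isSimpleLoop (G.isRose_roseOf hn hT) hβ

/-- A rose face of `G'` is one of `G`, so the bound passes to `G'`; there it excludes theta curves.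
-/
theorem IsAlmostSimple.expSum_of_roseFaces_eq (hG : G.roseFaces = G'.roseFaces)
    {γ : FreeGroup (Fin n)} (h : G.IsAlmostSimple γ) (R' : MarkedGraph n) (b : R'.E)
    (hR' : R'.IsRose) (hRG : R'.IsFaceOf G') : |expSum b (R'.marking γ)| ≤ 1 := by
  obtain ⟨c, hc⟩ := (hRG.of_roseFaces_eq hG.symm hR').exists_compat
  exact h.abs_expSum_le hc b

theorem IsAlmostSimple.of_roseFaces_eq (hn : 2 ≤ n) (hG : G.roseFaces = G'.roseFaces)
    {γ : FreeGroup (Fin n)} (h : G.IsAlmostSimple γ) : G'.IsAlmostSimple γ := by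
  rcases h.cases with h' | ⟨v, w, a, k, b, hs, hp⟩
  · obtain ⟨v, p, hs, hp⟩ := h'.of_roseFaces_eq hn hG
    exact ⟨v, p, Or.inl hs, hp⟩
  · obtain ⟨T, hT, β, β', hne, hβ⟩ := exists_petal_pair_of_isSeparated hn hs hp
    have hR := G.isRose_roseOf hn hT
    obtain ⟨c, hc⟩ := ((G.isFaceOf_roseOf hn hT).of_roseFaces_eq hG hR).exists_compat
    rcases hc.isSimpleLoop_or_isSeparated hn hR hne hβ (h.expSum_of_roseFaces_eq hG) with
      ⟨v, p, hs, hp⟩ | ⟨v, w, a, k, b, hs, ha, hk, hb⟩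
    · exact ⟨v, p, Or.inl hs, hp⟩
    · exact ⟨v, _, Or.inr (figureEight_or_barbell_iff.2 ⟨w, a, k, b, rfl, hs⟩),
        IsSeparated.represents hR hc hβ hs ha hk hb⟩

end MarkedGraph

/-! ### Exchanges of spanning trees -/

namespace MarkedGraph

open FinGraph

variable {n : ℕ} {G : MarkedGraph n}

/-- An edge outside a spanning tree closes a loop with it, so no forest properly contains a spanning
tree. -/
theorem not_mem_tree_of_subset {T T' : Set G.E} (hT : G.Spans T) (hT' : G.Acyclic T')
    (h : T ⊆ T') {e : G.E} (he : e ∉ T) : e ∉ T' := by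
  obtain ⟨q, hq, hqT⟩ := hT (G.term (e, true)) (G.init (e, true))
  refine not_mem_of_isPath_acyclic hT' hq (fun x hx => h (hqT x hx)) fun hmem => ?_
  obtain ⟨x, hx, hxe⟩ := List.mem_map.1 hmem
  have hxe' : x.1 = e := hxe
  exact he (hxe' ▸ hqT x hx)

/-- Spanning trees are connected by exchanges, and the roses of two trees related by an exchange
share a petal. Hence a function that is constant on the petals of each rose face is constant on
simple loops. -/
theorem eq_of_isTree (hn : 2 ≤ n) {α : Type*} (f : FreeGroup (Fin n) → α)
    (hf : ∀ R : MarkedGraph n, R.IsRose → R.IsFaceOf G → ∀ β β' γ γ',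
      IsConj (FreeGroup.mk [β]) (R.marking γ) → IsConj (FreeGroup.mk [β']) (R.marking γ') →
      f γ = f γ') {T₀ : Set G.E} (hT₀ : G.IsTree T₀) {γ₀ : FreeGroup (Fin n)}
    {β₀ : (G.roseOf hn hT₀).E × Bool}
    (h₀ : IsConj (FreeGroup.mk [β₀]) ((G.roseOf hn hT₀).marking γ₀)) :
    ∀ (N : ℕ) (T : Set G.E) (hT : G.IsTree T), (T₀ \ T).ncard = N →
      ∀ (γ : FreeGroup (Fin n)) (β : (G.roseOf hn hT).E × Bool),
      IsConj (FreeGroup.mk [β]) ((G.roseOf hn hT).marking γ) → f γ = f γ₀ := by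
  have := G.finE
  intro N
  induction N using Nat.strong_induction_on with
  | _ N ih =>
    intro T hT hN γ β hβ
    by_cases hsub : T₀ ⊆ T
    · obtain rfl : T₀ = T := by
        refine hsub.antisymm fun e he => ?_
        by_contra he₀
        exact not_mem_tree_of_subset hT₀.1 hT.2.acyclic hsub he₀ he
      exact hf _ (G.isRose_roseOf hn hT) (G.isFaceOf_roseOf hn hT) β β₀ γ γ₀ hβ h₀
    · obtain ⟨e, he₀, he⟩ := Set.not_subset.1 hsub
      -- The exchange: `T'` gains `e`, keeps `T ∩ T₀` and uses no other edges than those of `T`. It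
      -- must give up some edge `g` of `T`, and it is closer to `T₀`.
      obtain ⟨T', hAT', hT'B, hT'⟩ := exists_isTree (A := insert e (T ∩ T₀)) (B := insert e T)
        (hT₀.2.mono (Set.insert_subset he₀ Set.inter_subset_right))
        (Set.insert_subset_insert Set.inter_subset_left)
        (fun u v => (hT.1 u v).imp fun p hp => ⟨hp.1, fun d hd => Or.inr (hp.2 d hd)⟩)
      have heT' : e ∈ T' := hAT' (Set.mem_insert _ _)
      have hg : ∃ g ∈ T, g ∉ T' := by
        by_contra! h
        exact not_mem_tree_of_subset hT.1 hT'.2.acyclic h he heT'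
      obtain ⟨g, hgT, hgT'⟩ := hg
      obtain ⟨q, hq, hqT', hqr⟩ := hT'.1.exists_isReduced (G.term (g, true)) (G.init (g, true))
      have hnd := edges_nodup_of_support_nodup hq (hT'.2.acyclic.support_nodup hq hqT' hqr)
      have hgq : g ∉ G.edges q := by
        intro hmem
        obtain ⟨x, hx, hxg⟩ := List.mem_map.1 hmem
        exact hgT' (hxg ▸ hqT' x hx)
      have heq : e ∈ G.edges q := by
        by_contra heq
        refine not_mem_of_isPath_acyclic hT.2.acyclic hq (fun x hx => ?_) hgq hgT
        rcases hT'B (hqT' x hx) with h | h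
        · exact absurd (h ▸ List.mem_map_of_mem hx) heq
        · exact h
      obtain ⟨x, hx, rfl⟩ := List.mem_map.1 heq
      obtain ⟨q₁, q₂, rfl⟩ := List.append_of_mem hx
      have hmem : ∀ y ∈ q₁ ++ q₂, y.1 ∈ T := by
        intro y hy
        refine (hT'B (hqT' y ?_)).resolve_left fun hyx => ?_
        · rcases List.mem_append.1 hy with h | h <;> simp [h]
        · simp only [edges, List.map_append, List.map_cons] at hnd
          rw [List.nodup_middle, List.nodup_cons, ← List.map_append] at hnd
          exact hnd.1 (hyx ▸ List.mem_map_of_mem hy)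
      have hloop : G.IsPath (G.init (g, true)) ((g, true) :: (q₁ ++ x :: q₂))
          (G.init (g, true)) := ⟨rfl, hq⟩
      -- The loop formed by `g` and its path in `T'` has the edge of `x` as its only edge outside
      -- `T`. So it is a petal of both roses: of the edge of `x` for `T`, and of `g` for `T'`.
      obtain ⟨δ, hδ⟩ := exists_represents_of_isPath hloop
      have h1 := ((G.compat_roseCollapse hn hT).represents_iff (G.isRose_roseOf hn hT) hloop).1 hδ
      have h2 := ((G.compat_roseCollapse hn hT').represents_iff
        (G.isRose_roseOf hn hT') hloop).1 hδ
      obtain ⟨βx, hβx⟩ := (G.roseCollapse hn hT).exists_dart_eq (d := x)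
        (by rwa [kernel_roseCollapse])
      obtain ⟨βg, hβg⟩ := (G.roseCollapse hn hT').exists_dart_eq (d := (g, true))
        (by rwa [kernel_roseCollapse])
      rw [Collapse.path_cons, Collapse.dart_of_mem_kernel _ (by rwa [kernel_roseCollapse]),
        Collapse.path_append, Collapse.path_cons, hβx,
        Collapse.path_of_forall_mem_kernel (p := q₁) _ (by
          rw [kernel_roseCollapse]; exact fun y hy => hmem y (by simp [hy])),
        Collapse.path_of_forall_mem_kernel (p := q₂) _ (by
          rw [kernel_roseCollapse]; exact fun y hy => hmem y (by simp [hy]))] at h1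
      rw [Collapse.path_cons, hβg, Collapse.path_of_forall_mem_kernel _ (by
          rw [kernel_roseCollapse]; exact hqT')] at h2
      refine (hf _ (G.isRose_roseOf hn hT) (G.isFaceOf_roseOf hn hT) β βx γ δ hβ h1).trans
        (ih _ ?_ T' hT' rfl δ βg h2)
      rw [← hN]
      refine Set.ncard_lt_ncard ⟨fun y hy => ⟨hy.1, fun hyT => hy.2 (hAT' (Or.inr ⟨hyT, hy.1⟩))⟩,
        fun hsub => ?_⟩ (Set.toFinite _)
      exact (hsub ⟨he₀, he⟩).2 heT'

/-- A function that is constant on the petals of each rose face is constant on simple loops. -/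
theorem eq_of_isSimpleLoop (hn : 2 ≤ n) {α : Type*} (f : FreeGroup (Fin n) → α)
    (hf : ∀ R : MarkedGraph n, R.IsRose → R.IsFaceOf G → ∀ β β' γ γ',
      IsConj (FreeGroup.mk [β]) (R.marking γ) → IsConj (FreeGroup.mk [β']) (R.marking γ') →
      f γ = f γ') {γ γ' : FreeGroup (Fin n)} (h : G.IsSimpleLoop γ) (h' : G.IsSimpleLoop γ') :
    f γ = f γ' := by
  obtain ⟨T, hT, β, hβ⟩ := h.exists_petal hn
  obtain ⟨T', hT', β', hβ'⟩ := h'.exists_petal hn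
  exact eq_of_isTree hn f hf hT' hβ' _ T hT rfl γ β hβ

end MarkedGraph

/-! ### Lengths of conjugacy classes with respect to edge weights -/

theorem exists_le_mul_of_finite {ι : Type*} [Finite ι] (f g : ι → ℝ) (hg : ∀ i, 0 < g i) :
    ∃ C, 0 ≤ C ∧ ∀ i, f i ≤ C * g i := by
  obtain ⟨C, hC⟩ := (Set.finite_range fun i => f i / g i).bddAbove
  refine ⟨max C 0, le_max_right _ _, fun i => ?_⟩
  have h := (hC ⟨i, rfl⟩ : f i / g i ≤ C).trans (le_max_left C 0)
  rwa [div_le_iff₀ (hg i)] at h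

theorem wordWeight_pos {α : Type*} {z : α → ℝ} (hz : ∀ e, 0 < z e) {p : List (α × Bool)}
    (hp : p ≠ []) : 0 < wordWeight z p := by
  cases p with
  | nil => exact absurd rfl hp
  | cons d p =>
    rw [wordWeight_cons]
    exact add_pos_of_pos_of_nonneg (hz _) (wordWeight_nonneg (fun e => (hz e).le) p)

namespace MarkedGraph

variable {n : ℕ} (G : MarkedGraph n)

/-- The conjugator split off by cyclic reduction is itself an edge path, and the cyclically reduced
core is closed at its end point. -/
theorem exists_isCyclicallyReduced (γ : FreeGroup (Fin n)) :
    ∃ v p, G.Represents v p γ ∧ FreeGroup.IsCyclicallyReduced p := by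
  classical
  obtain ⟨p, hp⟩ := G.exists_represents γ
  have h1 : G.Represents G.base (FreeGroup.reduce p) γ :=
    hp.of_mk_eq (hp.1.of_red FreeGroup.reduce.red) FreeGroup.reduce.self.symm
  set w := FreeGroup.reduce p with hw
  have hwr : FreeGroup.IsReduced w :=
    FreeGroup.isReduced_iff_reduce_eq.2 FreeGroup.reduce.idem
  set u := FreeGroup.reduceCyclically.conjugator w with hu
  set q := FreeGroup.reduceCyclically w with hq
  have h2 : u ++ (q ++ FreeGroup.invRev u) = w := by
    rw [← List.append_assoc]
    exact FreeGroup.reduceCyclically.conj_conjugator_reduceCyclically w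
  rw [← h2] at h1
  obtain ⟨x, hux, hx⟩ := FinGraph.isPath_append_iff.1 h1.1
  obtain ⟨y, hqy, hy⟩ := FinGraph.isPath_append_iff.1 hx
  have hy' := hy.invRev
  rw [FreeGroup.invRev_invRev] at hy'
  obtain rfl := hux.end_unique hy'
  refine ⟨x, q, (h1.rotate hux).of_mk_eq hqy ?_,
    FreeGroup.reduceCyclically.isCyclicallyReduced hwr⟩
  rw [← FreeGroup.mul_mk, ← FreeGroup.mul_mk, ← FreeGroup.inv_mk]
  group

/-- A cyclically reduced closed path that represents `γ`. -/
noncomputable def cyclicRep (γ : FreeGroup (Fin n)) : List (G.E × Bool) :=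
  (G.exists_isCyclicallyReduced γ).choose_spec.choose

theorem exists_represents_cyclicRep (γ : FreeGroup (Fin n)) :
    ∃ v, G.Represents v (G.cyclicRep γ) γ :=
  ⟨_, (G.exists_isCyclicallyReduced γ).choose_spec.choose_spec.1⟩

theorem isCyclicallyReduced_cyclicRep (γ : FreeGroup (Fin n)) :
    FreeGroup.IsCyclicallyReduced (G.cyclicRep γ) :=
  (G.exists_isCyclicallyReduced γ).choose_spec.choose_spec.2

/-- The length of a conjugacy class with respect to edge weights. It is additive in the weights. -/
noncomputable def wlen (z : G.E → ℝ) (γ : FreeGroup (Fin n)) : ℝ := wordWeight z (G.cyclicRep γ)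

variable {G}

theorem wlen_le {z : G.E → ℝ} (hz : ∀ e, 0 ≤ z e) {v : G.V} {p : List (G.E × Bool)}
    {γ : FreeGroup (Fin n)} (h : G.Represents v p γ) : G.wlen z γ ≤ wordWeight z p := by
  obtain ⟨w, hw⟩ := G.exists_represents_cyclicRep γ
  exact wordWeight_le_of_isCyclicallyReduced hz (G.isCyclicallyReduced_cyclicRep γ)
    (hw.isConj.trans h.isConj.symm)

theorem wlen_eq {z : G.E → ℝ} (hz : ∀ e, 0 ≤ z e) {v : G.V} {p : List (G.E × Bool)}
    {γ : FreeGroup (Fin n)} (h : G.Represents v p γ) (hp : FreeGroup.IsCyclicallyReduced p) :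
    G.wlen z γ = wordWeight z p := by
  obtain ⟨w, hw⟩ := G.exists_represents_cyclicRep γ
  exact (wlen_le hz h).antisymm
    (wordWeight_le_of_isCyclicallyReduced hz hp (h.isConj.trans hw.isConj.symm))

theorem cyclicRep_ne_nil {γ : FreeGroup (Fin n)} (hγ : γ ≠ 1) : G.cyclicRep γ ≠ [] := by
  intro h
  obtain ⟨v, hv⟩ := G.exists_represents_cyclicRep γ
  have h1 := hv.isConj
  rw [h, ← FreeGroup.one_eq_mk, isConj_one_right] at h1
  exact hγ (G.marking_injective (h1.trans (map_one _).symm))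

theorem wlen_pos {z : G.E → ℝ} (hz : ∀ e, 0 < z e) {γ : FreeGroup (Fin n)} (hγ : γ ≠ 1) :
    0 < G.wlen z γ := wordWeight_pos hz (cyclicRep_ne_nil hγ)

theorem wlen_congr_isConj {z : G.E → ℝ} (hz : ∀ e, 0 ≤ z e) {γ γ' : FreeGroup (Fin n)}
    (h : IsConj γ γ') : G.wlen z γ = G.wlen z γ' := by
  obtain ⟨v, hv⟩ := G.exists_represents_cyclicRep γ
  obtain ⟨v', hv'⟩ := G.exists_represents_cyclicRep γ'
  exact (wlen_le hz (hv'.of_isConj h.symm)).antisymm (wlen_le hz (hv.of_isConj h))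

theorem wlen_inv {z : G.E → ℝ} (hz : ∀ e, 0 ≤ z e) (γ : FreeGroup (Fin n)) :
    G.wlen z γ⁻¹ = G.wlen z γ := by
  obtain ⟨v, hv⟩ := G.exists_represents_cyclicRep γ
  obtain ⟨v', hv'⟩ := G.exists_represents_cyclicRep γ⁻¹
  have h2 := hv'.inv
  rw [inv_inv] at h2
  refine ((wlen_le hz hv.inv).trans_eq (wordWeight_invRev _ _)).antisymm
    ((wlen_le hz h2).trans_eq (wordWeight_invRev _ _))

theorem wlen_add (z z' : G.E → ℝ) (γ : FreeGroup (Fin n)) :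
    G.wlen (fun e => z e + z' e) γ = G.wlen z γ + G.wlen z' γ := wordWeight_add _ _ _

theorem wlen_smul (r : ℝ) (z : G.E → ℝ) (γ : FreeGroup (Fin n)) :
    G.wlen (fun e => r * z e) γ = r * G.wlen z γ := wordWeight_smul _ _ _

theorem wlen_mono {z z' : G.E → ℝ} (h : ∀ e, z e ≤ z' e) (γ : FreeGroup (Fin n)) :
    G.wlen z γ ≤ G.wlen z' γ := wordWeight_mono fun d _ => h d.1

theorem IsRose.wlen_le {R : MarkedGraph n} (hR : R.IsRose) {z : R.E → ℝ} (hz : ∀ e, 0 ≤ z e)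
    {w : List (R.E × Bool)} {γ : FreeGroup (Fin n)}
    (h : IsConj (FreeGroup.mk w) (R.marking γ)) : R.wlen z γ ≤ wordWeight z w :=
  MarkedGraph.wlen_le hz (hR.represents_iff (v := R.base).2 h)

theorem IsRose.wlen_petal {R : MarkedGraph n} (hR : R.IsRose) {z : R.E → ℝ} (hz : ∀ e, 0 ≤ z e)
    {β : R.E × Bool} {γ : FreeGroup (Fin n)}
    (h : IsConj (FreeGroup.mk [β]) (R.marking γ)) : R.wlen z γ = z β.1 := by
  rw [wlen_eq hz (hR.represents_iff (v := R.base).2 h) FreeGroup.IsCyclicallyReduced.singleton]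
  simp

theorem IsRose.ne_one {R : MarkedGraph n} {b : R.E} {γ : FreeGroup (Fin n)}
    (h : expSum b (R.marking γ) ≠ 0) : γ ≠ 1 := by
  rintro rfl
  exact h (by rw [map_one, expSum_one])

theorem ne_one_of_petal {R : MarkedGraph n} {β : R.E × Bool} {γ : FreeGroup (Fin n)}
    (h : IsConj (FreeGroup.mk [β]) (R.marking γ)) : γ ≠ 1 := by
  apply IsRose.ne_one (R := R) (b := β.1)
  rw [← expSum_eq_of_isConj _ h, expSum_mk_singleton]
  intro h0
  have := letterSign_abs β.2
  rw [h0] at this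
  simp at this

theorem ne_one_of_petal_pair {R : MarkedGraph n} {β β' : R.E × Bool} (hne : β.1 ≠ β'.1)
    {γ : FreeGroup (Fin n)} (h : IsConj (FreeGroup.mk [β, β']) (R.marking γ)) : γ ≠ 1 := by
  apply IsRose.ne_one (R := R) (b := β.1)
  rw [← expSum_eq_of_isConj _ h, mk_cons, expSum_mul, expSum_mk_singleton,
    expSum_mk_singleton_of_ne hne.symm, add_zero]
  intro h0
  have := letterSign_abs β.2
  rw [h0] at this
  simp at this

end MarkedGraph

/-! ### Stretching factors between a metric graph and a rose -/

namespace MarkedMetricGraph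

open MarkedGraph

variable {n : ℕ}

theorem len_nonneg (X : MarkedMetricGraph n) (e : X.E) : 0 ≤ X.len e := (X.len_pos e).le

theorem L_eq_wlen (X : MarkedMetricGraph n) (γ : FreeGroup (Fin n)) :
    X.L γ = X.toMarkedGraph.wlen X.len γ := by
  obtain ⟨v, hv⟩ := X.exists_represents_cyclicRep γ
  refine IsLeast.csInf_eq ⟨⟨v, _, hv, rfl⟩, ?_⟩
  rintro l ⟨w, p, hp, rfl⟩
  exact wlen_le X.len_nonneg hp

theorem L_pos (X : MarkedMetricGraph n) {γ : FreeGroup (Fin n)} (hγ : γ ≠ 1) : 0 < X.L γ := by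
  rw [L_eq_wlen]; exact wlen_pos X.len_pos hγ

theorem L_le (X : MarkedMetricGraph n) {v : X.V} {p : List (X.E × Bool)}
    {γ : FreeGroup (Fin n)} (h : X.Represents v p γ) : X.L γ ≤ wordWeight X.len p := by
  rw [L_eq_wlen]; exact wlen_le X.len_nonneg h

/-- The smallest factor by which the weighted length on a marked graph `R` is bounded by the length
on `X`. -/
noncomputable def ratioSup (X : MarkedMetricGraph n) (R : MarkedGraph n) (z : R.E → ℝ) : ℝ :=
  ⨆ γ : {γ : FreeGroup (Fin n) // γ ≠ 1}, R.wlen z γ / X.L γ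

variable {X : MarkedMetricGraph n} {R : MarkedGraph n}

section ratioSup

variable {c : Collapse X.toFinGraph R.toFinGraph}

/-- Collapsing a closed path gives a word for its class. This word need not be cyclically reduced,
whence only an inequality. -/
theorem wlen_le_pullback (hR : R.IsRose) (hc : Compat (G := X.toMarkedGraph) c) {z : R.E → ℝ}
    (hz : ∀ b, 0 ≤ z b) {v : X.V} {p : List (X.E × Bool)} {γ : FreeGroup (Fin n)}
    (h : X.Represents v p γ) : R.wlen z γ ≤ wordWeight (c.pullback z) p := by
  rw [← c.wordWeight_path]
  exact hR.wlen_le hz ((hc.represents_iff hR h.1).1 h)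

/-- Weights are compared edge by edge. The bound is needed because the real supremum of an unbounded
family is the default value `0`. -/
theorem exists_wlen_le_mul_L (hR : R.IsRose) (hc : Compat (G := X.toMarkedGraph) c) {z : R.E → ℝ}
    (hz : ∀ b, 0 ≤ z b) : ∃ C, 0 ≤ C ∧ ∀ γ, R.wlen z γ ≤ C * X.L γ := by
  have := X.finE
  obtain ⟨C, hC0, hC⟩ := exists_le_mul_of_finite (c.pullback z) X.len X.len_pos
  refine ⟨C, hC0, fun γ => ?_⟩
  obtain ⟨v, hv⟩ := X.exists_represents_cyclicRep γ
  rw [L_eq_wlen]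
  refine (wlen_le_pullback hR hc hz hv).trans ?_
  rw [wlen, ← wordWeight_smul]
  exact wordWeight_mono fun d _ => hC d.1

theorem bddAbove_ratioSup (hR : R.IsRose) (hc : Compat (G := X.toMarkedGraph) c) {z : R.E → ℝ}
    (hz : ∀ b, 0 ≤ z b) : BddAbove (Set.range
      fun γ : {γ : FreeGroup (Fin n) // γ ≠ 1} => R.wlen z γ / X.L γ) := by
  obtain ⟨C, -, hC⟩ := exists_wlen_le_mul_L (X := X) hR hc hz
  refine ⟨C, ?_⟩
  rintro _ ⟨γ, rfl⟩
  change R.wlen z γ / X.L γ ≤ C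
  rw [div_le_iff₀ (X.L_pos γ.2)]
  exact hC γ

theorem le_ratioSup (hR : R.IsRose) (hc : Compat (G := X.toMarkedGraph) c) {z : R.E → ℝ}
    (hz : ∀ b, 0 ≤ z b) (γ : FreeGroup (Fin n)) (hγ : γ ≠ 1) :
    R.wlen z γ ≤ X.ratioSup R z * X.L γ := by
  rw [← div_le_iff₀ (X.L_pos hγ)]
  exact le_ciSup (bddAbove_ratioSup (X := X) hR hc hz) ⟨γ, hγ⟩

theorem nontrivial_of_two_le (hn : 2 ≤ n) : Nonempty {γ : FreeGroup (Fin n) // γ ≠ 1} :=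
  ⟨⟨FreeGroup.of ⟨0, by omega⟩, FreeGroup.of_ne_one _⟩⟩

theorem ratioSup_le (hn : 2 ≤ n) {z : R.E → ℝ} {M : ℝ}
    (h : ∀ γ, γ ≠ 1 → R.wlen z γ ≤ M * X.L γ) : X.ratioSup R z ≤ M := by
  have := nontrivial_of_two_le hn
  refine ciSup_le fun γ => ?_
  rw [div_le_iff₀ (X.L_pos γ.2)]
  exact h γ γ.2

theorem ratioSup_mono (hn : 2 ≤ n) (hR : R.IsRose) (hc : Compat (G := X.toMarkedGraph) c)
    {z z' : R.E → ℝ} (hz : ∀ b, 0 ≤ z b) (h : ∀ b, z b ≤ z' b) :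
    X.ratioSup R z ≤ X.ratioSup R z' :=
  ratioSup_le hn fun γ hγ =>
    (wlen_mono h γ).trans (le_ratioSup hR hc (fun b => (hz b).trans (h b)) γ hγ)

theorem ratioSup_add_le (hn : 2 ≤ n) (hR : R.IsRose) (hc : Compat (G := X.toMarkedGraph) c)
    {z z' : R.E → ℝ} (hz : ∀ b, 0 ≤ z b) (hz' : ∀ b, 0 ≤ z' b) :
    X.ratioSup R (fun b => z b + z' b) ≤ X.ratioSup R z + X.ratioSup R z' :=
  ratioSup_le hn fun γ hγ => by
    rw [wlen_add, add_mul]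
    exact add_le_add (le_ratioSup hR hc hz γ hγ) (le_ratioSup hR hc hz' γ hγ)

theorem ratioSup_const_le (hn : 2 ≤ n) (hR : R.IsRose) (hc : Compat (G := X.toMarkedGraph) c)
    {s : ℝ} (hs : 0 ≤ s) : X.ratioSup R (fun _ => s) ≤ s * X.ratioSup R (fun _ => 1) :=
  ratioSup_le hn fun γ hγ => by
    have h1 : R.wlen (fun _ => s) γ = s * R.wlen (fun _ => 1) γ := by
      rw [← wlen_smul]; simp
    rw [h1, mul_assoc]
    exact mul_le_mul_of_nonneg_left (le_ratioSup hR hc (fun _ => zero_le_one) γ hγ) hs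

theorem exists_petal_class (hR : R.IsRose) (β : R.E × Bool) :
    ∃ γ, IsConj (FreeGroup.mk [β]) (R.marking γ) := by
  obtain ⟨γ, hγ⟩ := hR.marking_surjective (FreeGroup.mk [β])
  exact ⟨γ, hγ ▸ IsConj.refl _⟩

theorem ratioSup_pos (hR : R.IsRose) (hc : Compat (G := X.toMarkedGraph) c) {z : R.E → ℝ}
    (hz : ∀ b, 0 ≤ z b) {b : R.E} (hb : 0 < z b) : 0 < X.ratioSup R z := by
  obtain ⟨γ, hγ⟩ := exists_petal_class hR (b, true)
  have h1 := ne_one_of_petal hγ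
  have h2 := le_ratioSup (X := X) hR hc hz γ h1
  rw [hR.wlen_petal hz hγ] at h2
  exact pos_of_mul_pos_left (hb.trans_le h2) (X.L_pos h1).le

end ratioSup

/-- The weights `K` on the petals of `R` bound the length on `X` from above. -/
def IsCost (X : MarkedMetricGraph n) (R : MarkedGraph n) (K : R.E → ℝ) : Prop :=
  (∀ b, 0 ≤ K b) ∧ ∀ γ, X.L γ ≤ R.wlen K γ

/-- The metric rose with petals of lengths `y`. -/
abbrev rose (R : MarkedGraph n) (y : R.E → ℝ) (hy : ∀ b, 0 < y b) : MarkedMetricGraph n :=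
  { toMarkedGraph := R, len := y, len_pos := hy }

/-- The cost `K` bounds all quotients by `M`, and the class of `w` attains `M`. The word `w` need
not be cyclically reduced, since its weight only serves as an upper bound for a length. -/
theorem stretch_rose_eq (hn : 2 ≤ n) (hR : R.IsRose) {y K : R.E → ℝ} (hy : ∀ b, 0 < y b)
    {M : ℝ} (hM : 0 ≤ M) (hK : X.IsCost R K) (hKy : ∀ b, K b ≤ M * y b)
    {w : List (R.E × Bool)} {γ : FreeGroup (Fin n)} (hγ : γ ≠ 1)
    (hw : IsConj (FreeGroup.mk w) (R.marking γ)) (hwL : M * wordWeight y w ≤ X.L γ) :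
    X.stretch (rose R y hy) = M := by
  have := nontrivial_of_two_le hn
  have hy0 : ∀ b, 0 ≤ y b := fun b => (hy b).le
  have hle : ∀ δ : {γ : FreeGroup (Fin n) // γ ≠ 1}, X.L δ / (rose R y hy).L δ ≤ M := by
    intro δ
    rw [div_le_iff₀ (L_pos _ δ.2), L_eq_wlen (rose R y hy), ← wlen_smul]
    exact (hK.2 δ).trans (wlen_mono hKy _)
  refine (ciSup_le hle).antisymm ?_
  refine le_trans ?_ (le_ciSup (f := fun δ : {γ : FreeGroup (Fin n) // γ ≠ 1} =>
    X.L δ / (rose R y hy).L δ) ⟨M, by rintro _ ⟨δ, rfl⟩; exact hle δ⟩ ⟨γ, hγ⟩)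
  rw [le_div_iff₀ (L_pos _ hγ), L_eq_wlen (rose R y hy)]
  exact (mul_le_mul_of_nonneg_left (hR.wlen_le hy0 hw) hM).trans hwL

theorem rose_stretch (y : R.E → ℝ) (hy : ∀ b, 0 < y b) :
    (rose R y hy).stretch X = X.ratioSup R y := by
  unfold stretch ratioSup
  simp only [L_eq_wlen (rose R y hy)]

theorem dist_rose_eq (hn : 2 ≤ n) (hR : R.IsRose) {y K : R.E → ℝ} (hy : ∀ b, 0 < y b)
    {M : ℝ} (hM : 0 ≤ M) (hK : X.IsCost R K) (hKy : ∀ b, K b ≤ M * y b)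
    {w : List (R.E × Bool)} {γ : FreeGroup (Fin n)} (hγ : γ ≠ 1)
    (hw : IsConj (FreeGroup.mk w) (R.marking γ)) (hwL : M * wordWeight y w ≤ X.L γ) :
    X.dist (rose R y hy) = Real.log (M * X.ratioSup R y) := by
  unfold dist
  rw [stretch_rose_eq hn hR hy hM hK hKy hγ hw hwL, rose_stretch]

end MarkedMetricGraph

/-! ### Equal distances compared at the boundary of the simplex of a rose -/

namespace MarkedMetricGraph

open MarkedGraph FinGraph

variable {n : ℕ} {X X₁ X₂ : MarkedMetricGraph n} {R : MarkedGraph n}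
  {c : Collapse X.toFinGraph R.toFinGraph} {c₁ : Collapse X₁.toFinGraph R.toFinGraph}
  {c₂ : Collapse X₂.toFinGraph R.toFinGraph}

/-- `X₁` and `X₂` have the same distance to all metrics on `R`. -/
def SameDist (X₁ X₂ : MarkedMetricGraph n) (R : MarkedGraph n) : Prop :=
  ∀ y hy, X₁.dist (rose R y hy) = X₂.dist (rose R y hy)

theorem nonempty_petals (hn : 2 ≤ n) (hR : R.IsRose) : Nonempty R.E := by
  have := R.finE
  rw [← Finite.card_pos_iff, hR.natCard_eq]; omega

/-- The same `y` and `w` serve for both graphs, so both distances are explicit logarithms of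
positive numbers, and the logarithm can be removed. -/
theorem mul_ratioSup_eq (hn : 2 ≤ n) (hR : R.IsRose) (hc₁ : Compat (G := X₁.toMarkedGraph) c₁)
    (hc₂ : Compat (G := X₂.toMarkedGraph) c₂) (hd : SameDist X₁ X₂ R) {y K₁ K₂ : R.E → ℝ}
    (hy : ∀ b, 0 < y b) {M₁ M₂ : ℝ} (hM₁ : 0 < M₁) (hM₂ : 0 < M₂) (hK₁ : X₁.IsCost R K₁)
    (hK₂ : X₂.IsCost R K₂) (hKy₁ : ∀ b, K₁ b ≤ M₁ * y b) (hKy₂ : ∀ b, K₂ b ≤ M₂ * y b)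
    {w : List (R.E × Bool)} {γ : FreeGroup (Fin n)} (hγ : γ ≠ 1)
    (hw : IsConj (FreeGroup.mk w) (R.marking γ)) (hL₁ : M₁ * wordWeight y w ≤ X₁.L γ)
    (hL₂ : M₂ * wordWeight y w ≤ X₂.L γ) :
    M₁ * X₁.ratioSup R y = M₂ * X₂.ratioSup R y := by
  have h := hd y hy
  obtain ⟨b⟩ := nonempty_petals hn hR
  have hy0 : ∀ b, 0 ≤ y b := fun b => (hy b).le
  rw [dist_rose_eq hn hR hy hM₁.le hK₁ hKy₁ hγ hw hL₁,
    dist_rose_eq hn hR hy hM₂.le hK₂ hKy₂ hγ hw hL₂] at h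
  exact Real.log_injOn_pos (mul_pos hM₁ (ratioSup_pos hR hc₁ hy0 (hy b)))
    (mul_pos hM₂ (ratioSup_pos hR hc₂ hy0 (hy b))) h

open Classical in
/-- Comparison at the boundary of the simplex of `R`, where the lengths of the petals in `S` tend
to zero in the proportion given by `z₀`. -/
theorem mul_ratioSup_eq_of_small (hn : 2 ≤ n) (hR : R.IsRose)
    (hc₁ : Compat (G := X₁.toMarkedGraph) c₁)
    (hc₂ : Compat (G := X₂.toMarkedGraph) c₂) (hd : SameDist X₁ X₂ R) {S : Set R.E}
    {z z₀ K₁ K₂ : R.E → ℝ} (hz₀ : ∀ b, 0 < z₀ b)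
    {M₁ M₂ : ℝ} (hM₁ : 0 < M₁) (hM₂ : 0 < M₂) (hK₁ : X₁.IsCost R K₁)
    (hK₂ : X₂.IsCost R K₂) (hKS₁ : ∀ b ∈ S, K₁ b ≤ M₁ * z₀ b)
    (hKS₂ : ∀ b ∈ S, K₂ b ≤ M₂ * z₀ b) {w : List (R.E × Bool)} (hwS : ∀ d ∈ w, d.1 ∈ S)
    {γ : FreeGroup (Fin n)} (hγ : γ ≠ 1)
    (hw : IsConj (FreeGroup.mk w) (R.marking γ)) (hL₁ : M₁ * wordWeight z₀ w ≤ X₁.L γ)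
    (hL₂ : M₂ * wordWeight z₀ w ≤ X₂.L γ) (hz : ∀ b, 0 ≤ z b) (hzS : ∀ b ∈ S, z b = 0) :
    M₁ * X₁.ratioSup R z = M₂ * X₂.ratioSup R z := by
  have := R.finE
  obtain ⟨C, hC0, hC⟩ := exists_le_mul_of_finite (fun b => K₁ b + K₂ b + z₀ b) (fun _ => (1 : ℝ))
    fun _ => one_pos
  have key : ∀ s : ℝ, 0 < s → ∃ y : R.E → ℝ, (∀ b, 0 ≤ y b) ∧ (∀ b, z b ≤ y b) ∧
      (∀ b, y b ≤ z b + s) ∧ M₁ * X₁.ratioSup R y = M₂ * X₂.ratioSup R y := by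
    intro s hs
    -- The scale `t` of the shrinking petals is such that `t * x` is at most `s`, `M₁ * s` and `M₂ *
    -- s` whenever `x ≤ C`. So the shrinking petals become shorter than `s`, and the other petals,
    -- of length at least `s`, do not raise the stretch.
    set m := min 1 (min M₁ M₂) with hm
    have hm0 : 0 < m := lt_min one_pos (lt_min hM₁ hM₂)
    set t := m * s / (C + 1) with ht
    have ht0 : 0 < t := by positivity
    have htC : ∀ x, x ≤ C → t * x ≤ m * s := by
      intro x hx
      have h1 : t * (C + 1) = m * s := by rw [ht]; field_simp
      nlinarith
    have hK₁C : ∀ b, K₁ b ≤ C := fun b => by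
      have h1 := hC b; have h2 := hK₂.1 b; have h3 := (hz₀ b).le; linarith
    have hK₂C : ∀ b, K₂ b ≤ C := fun b => by
      have h1 := hC b; have h2 := hK₁.1 b; have h3 := (hz₀ b).le; linarith
    have hz₀C : ∀ b, z₀ b ≤ C := fun b => by
      have h1 := hC b; have h2 := hK₁.1 b; have h3 := hK₂.1 b; linarith
    have hm1 : m * s ≤ 1 * s := mul_le_mul_of_nonneg_right (min_le_left _ _) hs.le
    have hmM₁ : m * s ≤ M₁ * s := mul_le_mul_of_nonneg_right
      ((min_le_right _ _).trans (min_le_left _ _)) hs.le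
    have hmM₂ : m * s ≤ M₂ * s := mul_le_mul_of_nonneg_right
      ((min_le_right _ _).trans (min_le_right _ _)) hs.le
    -- Outside `S` the amount `s` is added because `z` may vanish there, while petals have positive
    -- length.
    set y : R.E → ℝ := fun b => if b ∈ S then t * z₀ b else z b + s with hydef
    have hyS : ∀ b ∈ S, y b = t * z₀ b := fun b hb => by simp [hydef, hb]
    have hyS' : ∀ b, b ∉ S → y b = z b + s := fun b hb => by simp [hydef, hb]
    have hy : ∀ b, 0 < y b := by
      intro b
      by_cases hb : b ∈ S
      · rw [hyS b hb]; exact mul_pos ht0 (hz₀ b)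
      · rw [hyS' b hb]; exact add_pos_of_nonneg_of_pos (hz b) hs
    have hww : wordWeight y w = t * wordWeight z₀ w := by
      rw [← wordWeight_smul]
      exact (wordWeight_mono fun d hd => (hyS _ (hwS d hd)).le).antisymm
        (wordWeight_mono fun d hd => (hyS _ (hwS d hd)).ge)
    have hcost : ∀ {K : R.E → ℝ} {M : ℝ}, 0 < M → (∀ b, K b ≤ C) → (∀ b ∈ S, K b ≤ M * z₀ b) →
        m * s ≤ M * s → ∀ b, K b ≤ M / t * y b := by
      intro K M hM hKC hKS hms b
      rw [div_mul_eq_mul_div, le_div_iff₀ ht0]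
      by_cases hb : b ∈ S
      · rw [hyS b hb]
        have := mul_le_mul_of_nonneg_right (hKS b hb) ht0.le
        linarith
      · rw [hyS' b hb]
        have h1 := htC _ (hKC b)
        have h2 := mul_nonneg hM.le (hz b)
        linarith
    refine ⟨y, fun b => (hy b).le, fun b => ?_, fun b => ?_, ?_⟩
    · by_cases hb : b ∈ S
      · rw [hzS b hb]; exact (hy b).le
      · rw [hyS' b hb]; linarith
    · by_cases hb : b ∈ S
      · rw [hyS b hb, hzS b hb]
        have := htC _ (hz₀C b)
        linarith
      · rw [hyS' b hb]
    · have hlen : ∀ {M L : ℝ}, M * wordWeight z₀ w ≤ L → M / t * wordWeight y w ≤ L := by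
        intro M L h
        rw [hww]
        convert h using 1
        field_simp
      -- The stretches are `M₁ / t` and `M₂ / t`; the divergent factor `1 / t` is common to both
      -- sides.
      have h := mul_ratioSup_eq hn hR hc₁ hc₂ hd hy (div_pos hM₁ ht0) (div_pos hM₂ ht0) hK₁ hK₂
        (hcost hM₁ hK₁C hKS₁ hmM₁) (hcost hM₂ hK₂C hKS₂ hmM₂) hγ hw (hlen hL₁) (hlen hL₂)
      rw [div_mul_eq_mul_div, div_mul_eq_mul_div, div_left_inj' ht0.ne'] at h
      exact h
  -- As `ratioSup` is monotone and subadditive in the weights, an increase of the weights by at most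
  -- `s` raises it by at most a fixed multiple of `s`, which disappears in the limit.
  have hub : ∀ {X : MarkedMetricGraph n} {c : Collapse X.toFinGraph R.toFinGraph}
      (_ : Compat (G := X.toMarkedGraph) c) {s : ℝ} {y : R.E → ℝ}, 0 < s → (∀ b, 0 ≤ y b) →
      (∀ b, y b ≤ z b + s) →
      X.ratioSup R y ≤ X.ratioSup R z + s * X.ratioSup R (fun _ => 1) := by
    intro X c hc s y hs hy hys
    have h1 := ratioSup_mono hn hR hc (z' := fun b => z b + s) hy hys
    have h2 := ratioSup_add_le hn hR hc hz (z' := fun _ => s) fun _ => hs.le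
    have h3 := ratioSup_const_le hn hR hc hs.le
    linarith
  have hle : ∀ s : ℝ, 0 < s → M₁ * X₁.ratioSup R z ≤ M₂ * X₂.ratioSup R z +
      s * (M₂ * X₂.ratioSup R (fun _ => 1)) := by
    intro s hs
    obtain ⟨y, hy, hzy, hys, h⟩ := key s hs
    have h1 := mul_le_mul_of_nonneg_left (ratioSup_mono hn hR hc₁ hz hzy) hM₁.le
    have h2 := mul_le_mul_of_nonneg_left (hub hc₂ hs hy hys) hM₂.le
    linarith
  have hge : ∀ s : ℝ, 0 < s → M₂ * X₂.ratioSup R z ≤ M₁ * X₁.ratioSup R z +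
      s * (M₁ * X₁.ratioSup R (fun _ => 1)) := by
    intro s hs
    obtain ⟨y, hy, hzy, hys, h⟩ := key s hs
    have h1 := mul_le_mul_of_nonneg_left (ratioSup_mono hn hR hc₂ hz hzy) hM₂.le
    have h2 := mul_le_mul_of_nonneg_left (hub hc₁ hs hy hys) hM₁.le
    linarith
  have hlim : ∀ {a b D : ℝ}, (∀ s : ℝ, 0 < s → a ≤ b + s * D) → a ≤ b := by
    intro a b D h
    by_contra! hlt
    have hD : 0 < D := by have := h 1 one_pos; linarith
    have := h ((a - b) / (2 * D)) (by have := sub_pos.2 hlt; positivity)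
    have h3 : (a - b) / (2 * D) * D = (a - b) / 2 := by field_simp
    linarith
  exact (hlim hle).antisymm (hlim hge)

theorem exists_closed_lift (hR : R.IsRose) (c : Collapse X.toFinGraph R.toFinGraph) (v₀ : X.V)
    (b : R.E) : ∃ p, X.IsPath v₀ p v₀ ∧ ∃ s, c.hom (FreeGroup.mk p) = FreeGroup.mk [(b, s)] := by
  obtain ⟨d, hd⟩ := c.exists_dart (b, true)
  obtain ⟨q, hq, hqT⟩ := IsRose.spans (G := X.toMarkedGraph) hR c v₀ (X.init d)
  obtain ⟨q', hq', hqT'⟩ := IsRose.spans (G := X.toMarkedGraph) hR c (X.term d) v₀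
  refine ⟨q ++ d :: q', hq.append (v := X.init d) ⟨rfl, hq'⟩, true, ?_⟩
  rw [c.hom_mk, c.path_append, c.path_cons, hd, c.path_of_forall_mem_kernel hqT,
    c.path_of_forall_mem_kernel hqT']
  rfl

/-- Closed lifts of the petals at a common base point bound the length on `X`. -/
theorem isCost_of_lifts (hR : R.IsRose) (hc : Compat (G := X.toMarkedGraph) c) (v₀ : X.V)
    {K : R.E → ℝ} (h : ∀ b, ∃ p, X.IsPath v₀ p v₀ ∧
      (∃ s, c.hom (FreeGroup.mk p) = FreeGroup.mk [(b, s)]) ∧ wordWeight X.len p = K b) :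
    X.IsCost R K := by
  refine ⟨fun b => ?_, fun γ => ?_⟩
  · obtain ⟨p, -, -, hp⟩ := h b
    rw [← hp]; exact wordWeight_nonneg X.len_nonneg p
  · have hdart : ∀ d : R.E × Bool, ∃ p, X.IsPath v₀ p v₀ ∧
        c.hom (FreeGroup.mk p) = FreeGroup.mk [d] ∧ wordWeight X.len p = K d.1 := by
      rintro ⟨b, t⟩
      obtain ⟨p, hp, ⟨s, hs⟩, hK⟩ := h b
      by_cases hst : s = t
      · exact ⟨p, hp, hst ▸ hs, hK⟩
      · refine ⟨FreeGroup.invRev p, hp.invRev, ?_, by rw [wordWeight_invRev, hK]⟩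
        rw [← FreeGroup.inv_mk, map_inv, hs, FreeGroup.inv_mk]
        have : (!s) = t := by revert hst; cases s <;> cases t <;> simp
        simp [FreeGroup.invRev, this]
    have hword : ∀ w : List (R.E × Bool), ∃ p, X.IsPath v₀ p v₀ ∧
        c.hom (FreeGroup.mk p) = FreeGroup.mk w ∧ wordWeight X.len p = wordWeight K w := by
      intro w
      induction w with
      | nil => exact ⟨[], rfl, map_one _, rfl⟩
      | cons d w ih =>
        obtain ⟨p, hp, hpw, hpK⟩ := ih
        obtain ⟨q, hq, hqw, hqK⟩ := hdart d
        refine ⟨q ++ p, hq.append hp, ?_, by rw [wordWeight_append, wordWeight_cons, hpK, hqK]⟩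
        rw [← FreeGroup.mul_mk, map_mul, hqw, hpw, ← mk_cons]
    obtain ⟨p, hp, hpw, hpK⟩ := hword (R.cyclicRep γ)
    obtain ⟨v, hv⟩ := R.exists_represents_cyclicRep γ
    rw [wlen, ← hpK]
    refine X.L_le ((hc.represents_iff hR hp).2 ?_)
    rw [← c.hom_mk, hpw]
    exact hv.isConj

/-- A cost function with prescribed properties at some petals. -/
theorem exists_isCost (hR : R.IsRose) (hc : Compat (G := X.toMarkedGraph) c) (v₀ : X.V)
    (P : R.E → ℝ → Prop) (h : ∀ b, (∀ x, P b x) ∨ ∃ p, X.IsPath v₀ p v₀ ∧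
      (∃ s, c.hom (FreeGroup.mk p) = FreeGroup.mk [(b, s)]) ∧ P b (wordWeight X.len p)) :
    ∃ K, X.IsCost R K ∧ ∀ b, P b (K b) := by
  have h' : ∀ b, ∃ p, X.IsPath v₀ p v₀ ∧
      (∃ s, c.hom (FreeGroup.mk p) = FreeGroup.mk [(b, s)]) ∧ P b (wordWeight X.len p) := by
    intro b
    rcases h b with h | h
    · obtain ⟨p, hp, hs⟩ := exists_closed_lift hR c v₀ b
      exact ⟨p, hp, hs, h _⟩
    · exact h
  choose p hp hs hP using h'
  exact ⟨fun b => wordWeight X.len (p b),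
    isCost_of_lifts hR hc v₀ fun b => ⟨p b, hp b, hs b, rfl⟩, hP⟩

theorem isCyclicallyReduced_of_nodup {α : Type*} {p : List (α × Bool)}
    (hp : (p.map Prod.fst).Nodup) : FreeGroup.IsCyclicallyReduced p := by
  refine ⟨isReduced_of_nodup hp, fun a ha b hb hab => ?_⟩
  have ha' := List.mem_of_mem_getLast? ha
  have hb' := List.mem_of_mem_head? hb
  rw [List.nodup_map_iff_inj_on (List.Nodup.of_map _ hp)] at hp
  rw [hp a ha' b hb' hab]

/-- The length of a petal is realised by a simple loop, which can be used as a lift. -/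
theorem exists_petal_lift (hR : R.IsRose) (hc : Compat (G := X.toMarkedGraph) c)
    (β : R.E × Bool) : ∃ v p, X.IsSimpleClosed v p ∧ c.path p = [β] ∧
      ∀ γ, IsConj (FreeGroup.mk [β]) (R.marking γ) → X.L γ = wordWeight X.len p := by
  obtain ⟨d, q, hd, hq, hs⟩ := hc.exists_petal_loop hR β
  have hpath : c.path (d :: q) = [β] := by
    rw [c.path_cons, hd, c.path_of_forall_mem_kernel hq]; rfl
  refine ⟨_, d :: q, hs, hpath, fun γ hγ => ?_⟩
  rw [L_eq_wlen]
  refine wlen_eq X.len_nonneg ((hc.represents_iff hR hs.2.1).2 (by rwa [hpath]))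
    (isCyclicallyReduced_of_nodup hs.2.2.2)

theorem L_petal_eq (hR : R.IsRose) {b : R.E} {s s' : Bool} {γ γ' : FreeGroup (Fin n)}
    (h : IsConj (FreeGroup.mk [(b, s)]) (R.marking γ))
    (h' : IsConj (FreeGroup.mk [(b, s')]) (R.marking γ')) : X.L γ = X.L γ' := by
  rw [L_eq_wlen, L_eq_wlen]
  by_cases hs : s = s'
  · subst hs
    exact wlen_congr_isConj X.len_nonneg (hR.isConj_of_marking (h.symm.trans h'))
  · rw [← wlen_inv X.len_nonneg γ]
    refine wlen_congr_isConj X.len_nonneg (hR.isConj_of_marking (IsConj.trans ?_ h'))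
    rw [map_inv]
    have hs' : (!s) = s' := by revert hs; cases s <;> cases s' <;> simp
    have h2 : (FreeGroup.mk [(b, s')] : FreeGroup R.E) = (FreeGroup.mk [(b, s)])⁻¹ := by
      rw [FreeGroup.inv_mk]; simp [FreeGroup.invRev, hs']
    rw [h2]
    obtain ⟨g, hg⟩ := isConj_iff.1 h.symm
    exact isConj_iff.2 ⟨g, by rw [← hg]; group⟩

/-- The comparison at the face where the length of one petal tends to zero. -/
theorem L_mul_ratioSup_eq (hn : 2 ≤ n) (hR : R.IsRose) (hc₁ : Compat (G := X₁.toMarkedGraph) c₁)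
    (hc₂ : Compat (G := X₂.toMarkedGraph) c₂) (hd : SameDist X₁ X₂ R) {β : R.E × Bool}
    {γ : FreeGroup (Fin n)} (hγ : IsConj (FreeGroup.mk [β]) (R.marking γ)) {z : R.E → ℝ}
    (hz : ∀ b, 0 ≤ z b) (hzβ : z β.1 = 0) :
    X₁.L γ * X₁.ratioSup R z = X₂.L γ * X₂.ratioSup R z := by
  have hne := ne_one_of_petal hγ
  -- With the base point on the simple loop that realises the petal, the cost of this petal is
  -- exactly its length on `X`.
  have hcost : ∀ {X : MarkedMetricGraph n} {c : Collapse X.toFinGraph R.toFinGraph}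
      (_ : Compat (G := X.toMarkedGraph) c), ∃ K, X.IsCost R K ∧ ∀ b, b = β.1 → K b = X.L γ := by
    intro X c hc
    obtain ⟨v, p, hs, hp, hL⟩ := exists_petal_lift hR hc β
    refine exists_isCost hR hc v (fun b x => b = β.1 → x = X.L γ) fun b => ?_
    by_cases hb : b = β.1
    · right
      refine ⟨p, hs.2.1, ⟨β.2, ?_⟩, fun _ => (hL γ hγ).symm⟩
      rw [c.hom_mk, hp, hb]
    · exact Or.inl fun x h => absurd h hb
  obtain ⟨K₁, hK₁, hKβ₁⟩ := hcost hc₁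
  obtain ⟨K₂, hK₂, hKβ₂⟩ := hcost hc₂
  refine mul_ratioSup_eq_of_small hn hR hc₁ hc₂ hd (S := {β.1}) (z₀ := fun _ => 1)
    (fun _ => one_pos) (X₁.L_pos hne) (X₂.L_pos hne) hK₁ hK₂ ?_ ?_ (w := [β]) (by simp) hne hγ
    (by simp) (by simp) hz (by simpa using hzβ)
  · rintro b rfl; rw [hKβ₁ _ rfl, mul_one]
  · rintro b rfl; rw [hKβ₂ _ rfl, mul_one]

theorem exists_third_petal (hn : 3 ≤ n) (hR : R.IsRose) (x y : R.E) : ∃ b, b ≠ x ∧ b ≠ y := by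
  have := R.finE
  by_contra! h
  have h1 : Nat.card R.E ≤ ({x, y} : Set R.E).ncard := by
    rw [← Set.ncard_univ]
    refine Set.ncard_le_ncard (fun b _ => ?_) (Set.toFinite _)
    by_cases hb : b = x
    · exact Or.inl hb
    · exact Or.inr (h b hb)
  rw [hR.natCard_eq] at h1
  have := Set.ncard_insert_le x {y}
  rw [Set.ncard_singleton] at this
  omega

/-- In rank at least three, the distances to a rose determine the ratios of the petal lengths. -/
theorem L_mul_L_eq_of_three_le (hn : 3 ≤ n) (hR : R.IsRose)
    (hc₁ : Compat (G := X₁.toMarkedGraph) c₁)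
    (hc₂ : Compat (G := X₂.toMarkedGraph) c₂) (hd : SameDist X₁ X₂ R) {β β' : R.E × Bool}
    {γ γ' : FreeGroup (Fin n)} (hγ : IsConj (FreeGroup.mk [β]) (R.marking γ))
    (hγ' : IsConj (FreeGroup.mk [β']) (R.marking γ')) :
    X₁.L γ * X₂.L γ' = X₂.L γ * X₁.L γ' := by
  classical
  have hn2 : 2 ≤ n := by omega
  obtain ⟨b, hb, hb'⟩ := exists_third_petal hn hR β.1 β'.1
  -- For weights supported on a third petal, the same two values of `ratioSup` occur in both
  -- comparisons and cancel.
  set z : R.E → ℝ := fun x => if x = b then 1 else 0 with hz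
  have hz0 : ∀ x, 0 ≤ z x := fun x => by simp only [hz]; split_ifs <;> norm_num
  have h1 := L_mul_ratioSup_eq hn2 hR hc₁ hc₂ hd hγ hz0 (by simp [hz, hb.symm])
  have h2 := L_mul_ratioSup_eq hn2 hR hc₁ hc₂ hd hγ' hz0 (by simp [hz, hb'.symm])
  have hp₁ : 0 < X₁.ratioSup R z := ratioSup_pos hR hc₁ hz0 (b := b) (by simp [hz])
  have hp₂ : 0 < X₂.ratioSup R z := ratioSup_pos hR hc₂ hz0 (b := b) (by simp [hz])
  have h3 : (X₁.L γ * X₂.L γ') * (X₁.ratioSup R z * X₂.ratioSup R z)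
      = (X₂.L γ * X₁.L γ') * (X₁.ratioSup R z * X₂.ratioSup R z) := by
    linear_combination (X₂.L γ' * X₂.ratioSup R z) * h1 - (X₂.L γ * X₂.ratioSup R z) * h2
  exact mul_right_cancel₀ (mul_pos hp₁ hp₂).ne' h3

end MarkedMetricGraph

/-! ### Rank two: counting edges, loops, and the ratios of petal lengths -/

theorem two_mul_count_le {α : Type*} [DecidableEq α] (f : α) :
    ∀ l : List α, l.IsChain (fun a b => ¬ (a = f ∧ b = f)) → 2 * l.count f ≤ l.length + 1
  | [], _ => by simp
  | [a], _ => by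
    have := List.count_le_length (a := f) (l := [a])
    simp only [List.length_singleton] at *
    omega
  | a :: b :: l, h => by
    rw [List.isChain_cons_cons] at h
    by_cases ha : a = f
    · have hb : b ≠ f := fun hb => h.1 ⟨ha, hb⟩
      have ih := two_mul_count_le f l h.2.of_cons
      rw [List.count_cons, List.count_cons]
      simp only [ha, hb, beq_iff_eq, if_true, if_false, List.length_cons]
      omega
    · have ih := two_mul_count_le f (b :: l) h.2
      rw [List.count_cons]
      simp only [ha, beq_iff_eq, if_false, List.length_cons] at *
      omega

/-- For the quotients `α = a / a'`, `β = b / b'`, `ρ = s / s'`, the first equation places `α`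
between `β` and `ρ`, the second places `β` between `α` and `ρ`; hence `α = β`. -/
theorem mul_eq_mul_of_min_eq {a b s a' b' s' : ℝ} (hb : 0 < b) (hs : 0 < s) (ha : 0 < a)
    (ha' : 0 < a') (hb' : 0 < b') (hs' : 0 < s') (h₁ : a * min b' s' = a' * min b s)
    (h₂ : b * min a' s' = b' * min a s) : a * b' = a' * b := by
  have key : ∀ {α β ρ x y w : ℝ}, 0 < x → 0 < y → 0 < w → 0 < β → 0 < ρ →
      α * x * min y w = x * min (β * y) (ρ * w) → min β ρ ≤ α ∧ α ≤ max β ρ := by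
    intro α β ρ x y w hx hy hw hβ hρ h
    have hm : 0 < min y w := lt_min hy hw
    have h' : α * min y w = min (β * y) (ρ * w) := mul_left_cancel₀ hx.ne' (by linarith)
    have hmn : 0 < min β ρ := lt_min hβ hρ
    have hmx : 0 < max β ρ := hβ.trans_le (le_max_left _ _)
    constructor
    · refine le_of_mul_le_mul_right ?_ hm
      rw [h']
      exact le_min (mul_le_mul (min_le_left _ _) (min_le_left _ _) hm.le hβ.le)
        (mul_le_mul (min_le_right _ _) (min_le_right _ _) hm.le hρ.le)
    · refine le_of_mul_le_mul_right ?_ hm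
      rw [h']
      rcases min_choice y w with h0 | h0 <;> rw [h0]
      · exact (min_le_left _ _).trans (mul_le_mul_of_nonneg_right (le_max_left _ _) hy.le)
      · exact (min_le_right _ _).trans (mul_le_mul_of_nonneg_right (le_max_right _ _) hw.le)
  obtain ⟨α, rfl⟩ : ∃ α, a = α * a' := ⟨a / a', by field_simp⟩
  obtain ⟨β, rfl⟩ : ∃ β, b = β * b' := ⟨b / b', by field_simp⟩
  obtain ⟨ρ, rfl⟩ : ∃ ρ, s = ρ * s' := ⟨s / s', by field_simp⟩
  have hα : 0 < α := pos_of_mul_pos_left ha ha'.le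
  have hβ : 0 < β := pos_of_mul_pos_left hb hb'.le
  have hρ : 0 < ρ := pos_of_mul_pos_left hs hs'.le
  obtain ⟨l₁, u₁⟩ := key ha' hb' hs' hβ hρ h₁
  obtain ⟨l₂, u₂⟩ := key hb' ha' hs' hα hρ h₂
  have : α = β := by
    rcases min_le_iff.1 l₁ with h1 | h1 <;> rcases le_max_iff.1 u₁ with h2 | h2 <;>
      rcases min_le_iff.1 l₂ with h3 | h3 <;> rcases le_max_iff.1 u₂ with h4 | h4 <;> linarith
  rw [this]; ring

namespace FinGraph

variable {G : FinGraph}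

/-- A forest has fewer edges than vertices. -/
theorem Acyclic.ncard_lt {T : Set G.E} (hT : G.Acyclic T) (hs : G.Spans T) (v₀ : G.V) :
    T.ncard + 1 ≤ Nat.card G.V := by
  have := G.finV
  have := G.finE
  choose P hP hPT hPr using fun v => hs.exists_isReduced v v₀
  -- A vertex is sent to the first edge of its reduced tree path to the root. Every edge of `T` is
  -- the value at one of its two ends, and the root takes the value `none`.
  set φ : G.V → Option G.E := fun v => (P v).head?.map Prod.fst with hφ
  have hsub : some '' T ⊆ φ '' {v₀}ᶜ := by
    rintro _ ⟨e, he, rfl⟩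
    have key : ∀ d : G.E × Bool, d.1 ∈ T → φ (G.init d) ≠ some d.1 →
        φ (G.term d) = some d.1 := by
      intro d hd h
      have hpath : G.IsPath (G.term d) ((d.1, !d.2) :: P (G.init d)) v₀ :=
        ⟨init_flip d, by rw [term_flip]; exact hP _⟩
      have hred : FreeGroup.IsReduced ((d.1, !d.2) :: P (G.init d)) := by
        rw [← List.singleton_append, isReduced_append_iff]
        refine ⟨FreeGroup.IsReduced.singleton, hPr _, ?_⟩
        intro x hx y hy hxy
        simp only [List.getLast?_singleton, Option.mem_def, Option.some.injEq] at hx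
        subst hx
        exfalso
        apply h
        simp only [hφ, Option.mem_def] at hy ⊢
        rw [hy]
        simpa using hxy.symm
      have heq : P (G.term d) = (d.1, !d.2) :: P (G.init d) := by
        refine eq_of_isReduced (hPr _) hred ?_
        have h1 := hT _ _ (hpath.append (hP (G.term d)).invRev) (by
          intro x hx
          rcases List.mem_append.1 hx with hx | hx
          · rcases List.mem_cons.1 hx with rfl | hx
            · exact hd
            · exact hPT _ x hx
          · exact hPT (G.term d) (x.1, !x.2) (mem_invRev_iff.1 hx))
        rw [← FreeGroup.mul_mk, ← FreeGroup.inv_mk, mul_inv_eq_one] at h1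
        exact h1.symm
      simp [hφ, heq]
    have hv₀ : φ v₀ = none := by
      have h1 := eq_of_isReduced (hPr v₀) FreeGroup.IsReduced.nil
        (hT v₀ (P v₀) (hP v₀) (hPT v₀))
      simp [hφ, h1]
    by_cases h : φ (G.init (e, true)) = some e
    · exact ⟨_, fun h0 => by
        rw [Set.mem_singleton_iff] at h0; rw [h0, hv₀] at h; simp at h, h⟩
    · have h1 := key (e, true) he h
      exact ⟨_, fun h0 => by
        rw [Set.mem_singleton_iff] at h0; rw [h0, hv₀] at h1; simp at h1, h1⟩
  have h1 := (Set.ncard_le_ncard hsub (Set.toFinite _)).trans (Set.ncard_image_le (Set.toFinite _))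
  rw [Set.ncard_image_of_injective _ (Option.some_injective _)] at h1
  have h2 := Set.ncard_add_ncard_compl ({v₀} : Set G.V)
  rw [Set.ncard_singleton] at h2
  omega

/-- In a graph without loops consecutive edges of a reduced path are distinct. -/
theorem isChain_edges_ne (hloop : ∀ d : G.E × Bool, G.init d ≠ G.term d) {u v : G.V}
    {p : List (G.E × Bool)} (hp : G.IsPath u p v) (hr : FreeGroup.IsReduced p) :
    (G.edges p).IsChain (· ≠ ·) := by
  induction p generalizing u with
  | nil => simp [edges]
  | cons d p ih =>
    cases p with
    | nil => simp [edges]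
    | cons d' p =>
      rw [FreeGroup.isReduced_cons_cons] at hr
      have h1 := ih hp.2 hr.2
      simp only [edges, List.map_cons, List.isChain_cons_cons] at h1 ⊢
      refine ⟨fun h => ?_, h1⟩
      have : d = d' := Prod.ext h (hr.1 h)
      subst this
      exact hloop d hp.2.1

end FinGraph

namespace MarkedGraph

open FinGraph

variable {n : ℕ} {G R : MarkedGraph n} {c : Collapse G.toFinGraph R.toFinGraph}

theorem Compat.ncard_compl_kernel_le (hR : R.IsRose) (c : Collapse G.toFinGraph R.toFinGraph) :
    (c.kernel)ᶜ.ncard ≤ n := by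
  have := R.finE
  have := G.finE
  have hcard : (Set.univ : Set R.E).ncard = n := by rw [Set.ncard_univ, hR.natCard_eq]
  refine le_of_le_of_eq ?_ hcard
  choose f hf using fun b : R.E => c.exists_dart (b, true)
  refine (Set.ncard_le_ncard (t := (fun b => (f b).1) '' Set.univ) ?_ (Set.toFinite _)).trans
    (Set.ncard_image_le (Set.toFinite _))
  intro e he
  obtain ⟨β, hβ⟩ := c.exists_dart_eq (d := (e, true)) he
  exact ⟨β.1, trivial, (c.edge_eq_iff (hf β.1) hβ).2 rfl⟩

theorem three_mul_card_le (G : MarkedGraph n) : 3 * Nat.card G.V ≤ 2 * Nat.card G.E := by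
  have := G.finV
  have := G.finE
  have := Fintype.ofFinite G.V
  have h1 : Nat.card (G.E × Bool) = ∑ v, Nat.card {d : G.E × Bool // G.init d = v} := by
    rw [← Nat.card_congr (Equiv.sigmaFiberEquiv (G.init : G.E × Bool → G.V)), Nat.card_sigma]
  have h2 : ∑ _v : G.V, 3 ≤ ∑ v, Nat.card {d : G.E × Bool // G.init d = v} :=
    Finset.sum_le_sum fun v _ => G.valence v
  rw [Finset.sum_const, Finset.card_univ, ← Nat.card_eq_fintype_card, ← h1, Nat.card_prod] at h2
  simp only [smul_eq_mul, Nat.card_eq_fintype_card, Fintype.card_bool] at h2 ⊢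
  omega

variable {G R : MarkedGraph 2} {c : Collapse G.toFinGraph R.toFinGraph}

/-- In rank two, a graph has at most two vertices. -/
theorem Compat.card_vertices_le (hR : R.IsRose) (hc : Compat c) : Nat.card G.V ≤ 2 := by
  have := G.finE
  -- With `V` vertices there are at most `(V - 1) + 2` edges, while the valence condition gives `3 *
  -- V ≤ 2 * E`; so `V ≤ 2`.
  have h1 := hc.acyclic.ncard_lt (hR.spans c) G.base
  have h2 := Compat.ncard_compl_kernel_le hR c
  have h3 := G.three_mul_card_le
  have h4 := Set.ncard_add_ncard_compl c.kernel
  omega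

theorem Compat.kernel_subsingleton (hR : R.IsRose) (hc : Compat c) : c.kernel.Subsingleton := by
  have := G.finE
  have h1 := hc.acyclic.ncard_lt (hR.spans c) G.base
  have h2 := hc.card_vertices_le hR
  rw [← Set.ncard_le_one_iff_subsingleton]
  omega

theorem not_loop_of_mem_acyclic {T : Set G.E} (hT : G.Acyclic T)
    {d : G.E × Bool} (hd : d.1 ∈ T) : G.init d ≠ G.term d := by
  intro h
  exact not_mem_of_isPath_acyclic hT (d := d) (q := []) h.symm (by simp) (by simp [edges]) hd

theorem eq_of_ne_of_card_le_two {V : Type*} [Finite V] (h : Nat.card V ≤ 2) {x y z : V}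
    (hx : x ≠ z) (hy : y ≠ z) : x = y := by
  by_contra hxy
  have h1 : ({x, y, z} : Set V).ncard = 3 := by
    rw [Set.ncard_eq_three]; exact ⟨x, y, z, hxy, hx, hy, rfl⟩
  have h2 := Set.ncard_le_card ({x, y, z} : Set V)
  omega

/-- In rank two, if one edge outside a spanning tree is a loop, then so is the other one. -/
theorem Compat.loop_of_loop (hR : R.IsRose) (hc : Compat c) {d d' : G.E × Bool}
    (hcover : ∀ e, e ∈ c.kernel ∨ e = d.1 ∨ e = d'.1)
    (h : G.init d' = G.term d') : G.init d = G.term d := by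
  have := G.finE
  have := G.finV
  by_contra hne
  have hcard := hc.card_vertices_le hR
  -- At an end of `d` that is not on the loop `d'`, only `d` and at most one tree edge can start,
  -- against valence three.
  have key : ∀ d : G.E × Bool, (∀ e, e ∈ c.kernel ∨ e = d.1 ∨ e = d'.1) →
      G.init d ≠ G.term d → G.init d ≠ G.init d' → False := by
    intro d hcover hne hx
    have hval := G.valence (G.init d)
    have hsub : {x : G.E × Bool | G.init x = G.init d} ⊆
        insert d {x : G.E × Bool | x.1 ∈ c.kernel ∧ G.init x = G.init d} := by
      intro x hxd
      have hxd : G.init x = G.init d := hxd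
      rcases hcover x.1 with hk | hk | hk
      · exact Or.inr ⟨hk, hxd⟩
      · rcases eq_or_eq_flip hk with rfl | rfl
        · exact Or.inl rfl
        · rw [init_flip] at hxd
          exact absurd hxd.symm hne
      · exfalso
        rcases eq_or_eq_flip hk with rfl | rfl
        · exact hx hxd.symm
        · rw [init_flip, ← h] at hxd
          exact hx hxd.symm
    have hss : {x : G.E × Bool | x.1 ∈ c.kernel ∧ G.init x = G.init d}.Subsingleton := by
      rintro x ⟨hxT, hx⟩ y ⟨hyT, hy⟩
      have hxy := hc.kernel_subsingleton hR hxT hyT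
      rcases eq_or_eq_flip hxy with h' | h'
      · exact h'
      · exfalso
        rw [h', init_flip] at hx
        exact not_loop_of_mem_acyclic hc.acyclic hyT (hy.trans hx.symm)
    have h1 := Set.ncard_le_ncard hsub (Set.toFinite _)
    have h2 := Set.ncard_insert_le d {x : G.E × Bool | x.1 ∈ c.kernel ∧ G.init x = G.init d}
    have h3 := Set.ncard_le_one_iff_subsingleton.2 hss
    have h4 : Nat.card {x : G.E × Bool // G.init x = G.init d}
        = {x : G.E × Bool | G.init x = G.init d}.ncard := rfl
    omega
  by_cases hx : G.init d = G.init d'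
  · refine key (d.1, !d.2) hcover ?_ ?_
    · rw [init_flip, term_flip]; exact Ne.symm hne
    · rw [init_flip, ← hx]; exact Ne.symm hne
  · exact key d hcover hne hx

end MarkedGraph

namespace MarkedMetricGraph

open MarkedGraph FinGraph

section Indicator

open Classical in
/-- The weight one on a single petal. -/
noncomputable def petalWeight {E : Type} (j b : E) : ℝ := if b = j then 1 else 0

theorem petalWeight_nonneg {E : Type} (j b : E) : 0 ≤ petalWeight j b := by
  unfold petalWeight; split_ifs <;> norm_num

@[simp] theorem petalWeight_self {E : Type} (j : E) : petalWeight j j = 1 := by simp [petalWeight]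

theorem petalWeight_of_ne {E : Type} {j b : E} (h : b ≠ j) : petalWeight j b = 0 := by
  simp [petalWeight, h]

theorem pullback_petalWeight {G H : FinGraph} (c : Collapse G H) {d : G.E × Bool}
    {β : H.E × Bool} (h : c.dart d = [β]) (e : G.E) :
    c.pullback (petalWeight β.1) e = petalWeight d.1 e := by
  by_cases he : e ∈ c.kernel
  · rw [c.pullback_of_mem_kernel he, petalWeight_of_ne]
    rintro rfl
    exact c.not_mem_kernel_of_dart_eq h he
  · obtain ⟨β', hβ'⟩ := c.exists_dart_eq (d := (e, true)) he
    have h1 := c.pullback_of_dart_eq (z := petalWeight β.1) hβ'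
    have h2 := c.edge_eq_iff hβ' h
    simp only at h1 h2
    rw [h1]
    by_cases hb : β'.1 = β.1
    · rw [hb, h2.2 hb]; simp
    · rw [petalWeight_of_ne hb, petalWeight_of_ne fun h => hb (h2.1 h)]

theorem wordWeight_petalWeight {E : Type} [DecidableEq E] (f : E) (p : List (E × Bool)) :
    wordWeight (petalWeight f) p = ((p.map Prod.fst).count f : ℕ) := by
  induction p with
  | nil => simp
  | cons d p ih =>
    rw [wordWeight_cons, ih, List.map_cons, List.count_cons]
    by_cases h : d.1 = f
    · rw [h]; simp; ring
    · rw [petalWeight_of_ne h]; simp [h]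

end Indicator

/-- The class `δ` attains the bound that `h` gives for all classes. -/
theorem ratioSup_mul_eq_one {n : ℕ} (hn : 2 ≤ n) {X : MarkedMetricGraph n} {R : MarkedGraph n}
    {c : Collapse X.toFinGraph R.toFinGraph} (hR : R.IsRose)
    (hc : Compat (G := X.toMarkedGraph) c) {z : R.E → ℝ} (hz : ∀ b, 0 ≤ z b) {m : ℝ} (hm : 0 < m)
    (h : ∀ γ, γ ≠ 1 → R.wlen z γ * m ≤ X.L γ) {δ : FreeGroup (Fin n)} (hδ : δ ≠ 1)
    (hδ₁ : 1 ≤ R.wlen z δ) (hδm : X.L δ ≤ m) : X.ratioSup R z * m = 1 := by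
  have h1 : X.ratioSup R z ≤ 1 / m := ratioSup_le hn fun γ hγ => by
    rw [div_mul_eq_mul_div, one_mul, le_div_iff₀ hm]; exact h γ hγ
  rw [le_div_iff₀ hm] at h1
  have h2 := le_ratioSup (X := X) hR hc hz δ hδ
  have h3 : 0 ≤ X.ratioSup R z := by
    by_contra! hneg
    have := mul_neg_of_neg_of_pos hneg (X.L_pos hδ)
    linarith
  have h4 := mul_le_mul_of_nonneg_left hδm h3
  linarith

variable {X : MarkedMetricGraph 2} {R : MarkedGraph 2} {c : Collapse X.toFinGraph R.toFinGraph}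

theorem eq_or_eq_of_ne (hR : R.IsRose) {i j : R.E} (hij : i ≠ j) (b : R.E) : b = i ∨ b = j := by
  have := R.finE
  by_contra! h
  exact hij (eq_of_ne_of_card_le_two hR.natCard_eq.le (Ne.symm h.1) (Ne.symm h.2))

theorem kernel_cover (hR : R.IsRose) {d d' : X.E × Bool} {β β' : R.E × Bool}
    (hd : c.dart d = [β]) (hd' : c.dart d' = [β']) (hne : β.1 ≠ β'.1) (e : X.E) :
    e ∈ c.kernel ∨ e = d.1 ∨ e = d'.1 := by
  by_cases he : e ∈ c.kernel
  · exact Or.inl he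
  · obtain ⟨β'', hβ⟩ := c.exists_dart_eq (d := (e, true)) he
    rcases eq_or_eq_of_ne hR hne β''.1 with h | h
    · exact Or.inr (Or.inl ((c.edge_eq_iff hβ hd).2 h))
    · exact Or.inr (Or.inr ((c.edge_eq_iff hβ hd').2 h))

theorem L_le_len_of_loop (hR : R.IsRose) (hc : Compat (G := X.toMarkedGraph) c) {d : X.E × Bool}
    {β : R.E × Bool} (hd : c.dart d = [β]) (hloop : X.init d = X.term d)
    {γ : FreeGroup (Fin 2)} (hγ : IsConj (FreeGroup.mk [β]) (R.marking γ)) :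
    X.L γ ≤ X.len d.1 := by
  have hp : X.IsPath (X.init d) [d] (X.init d) := ⟨rfl, hloop.symm⟩
  refine (X.L_le ((hc.represents_iff hR hp).2 ?_)).trans_eq (by simp)
  rwa [c.path_cons, hd]

/-- Each passage of the loop `d` costs its full length, which is at least that of `γ`; so no class
has a better ratio than `γ` itself. -/
theorem ratioSup_of_loop (hR : R.IsRose) (hc : Compat (G := X.toMarkedGraph) c) {d : X.E × Bool}
    {β : R.E × Bool} (hd : c.dart d = [β]) (hloop : X.init d = X.term d)
    {γ : FreeGroup (Fin 2)} (hγ : IsConj (FreeGroup.mk [β]) (R.marking γ)) :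
    X.ratioSup R (petalWeight β.1) * X.L γ = 1 := by
  have hne := ne_one_of_petal hγ
  refine ratioSup_mul_eq_one le_rfl hR hc (petalWeight_nonneg _) (X.L_pos hne)
    (fun δ hδ => ?_) hne ?_ le_rfl
  · obtain ⟨v, hv⟩ := X.exists_represents_cyclicRep δ
    have h1 := wlen_le_pullback hR hc (petalWeight_nonneg β.1) hv
    have h2 : X.L γ * wordWeight (c.pullback (petalWeight β.1)) (X.cyclicRep δ) ≤ X.L δ := by
      rw [L_eq_wlen X δ, wlen, ← wordWeight_smul]
      refine wordWeight_mono fun x _ => ?_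
      rw [pullback_petalWeight c hd]
      by_cases hx : x.1 = d.1
      · rw [hx, petalWeight_self, mul_one]
        exact L_le_len_of_loop hR hc hd hloop hγ
      · rw [petalWeight_of_ne hx, mul_zero]; exact X.len_nonneg _
    have h3 := mul_le_mul_of_nonneg_left h1 (X.L_pos hne).le
    linarith
  · rw [hR.wlen_petal (petalWeight_nonneg _) hγ, petalWeight_self]

/-- The petal consists of `d` and a path in the tree, and in rank two the tree has at most one edge.
-/
theorem L_petal_le (hR : R.IsRose) (hc : Compat (G := X.toMarkedGraph) c) {d : X.E × Bool}
    {β : R.E × Bool} (hd : c.dart d = [β]) {γ : FreeGroup (Fin 2)}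
    (hγ : IsConj (FreeGroup.mk [β]) (R.marking γ)) :
    X.len d.1 ≤ X.L γ ∧ ∀ e ∈ c.kernel, X.L γ ≤ X.len d.1 + X.len e := by
  obtain ⟨q, hq, hqT, hqr⟩ := (IsRose.spans (G := X.toMarkedGraph) hR c).exists_isReduced
    (X.term d) (X.init d)
  have hnd := hc.isReduced_edges_nodup hq hqT hqr
  have hdq : d.1 ∉ X.edges q := fun hmem => by
    obtain ⟨x, hx, hxd⟩ := List.mem_map.1 hmem
    exact c.not_mem_kernel_of_dart_eq hd (hxd ▸ hqT x hx)
  have hp : X.IsPath (X.init d) (d :: q) (X.init d) := ⟨rfl, hq⟩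
  have hL : X.L γ = X.len d.1 + wordWeight X.len q := by
    rw [L_eq_wlen, ← wordWeight_cons]
    refine wlen_eq X.len_nonneg ((hc.represents_iff hR hp).2 ?_) (isCyclicallyReduced_of_nodup ?_)
    · rwa [c.path_cons, hd, c.path_of_forall_mem_kernel hqT]
    · exact List.nodup_cons.2 ⟨hdq, hnd⟩
  refine ⟨?_, fun e he => ?_⟩
  · rw [hL]; linarith [wordWeight_nonneg X.len_nonneg q]
  · rw [hL]
    gcongr
    have hqe : ∀ x ∈ q, x.1 = e := fun x hx => hc.kernel_subsingleton hR (hqT x hx) he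
    match q, hnd, hqe with
    | [], _, _ => exact X.len_nonneg e
    | [x], _, hqe => rw [wordWeight_cons, hqe x (by simp)]; simp
    | x :: y :: q, hnd, hqe =>
      exfalso
      simp only [edges, List.map_cons, List.nodup_cons, List.mem_cons, hqe x (by simp),
        hqe y (by simp)] at hnd
      simp at hnd

theorem wordWeight_ge_of_count {E : Type} [DecidableEq E] {z : E → ℝ} {f : E} {ν : ℝ}
    (hν : ∀ e, e ≠ f → ν ≤ z e) (p : List (E × Bool)) :
    ((p.map Prod.fst).count f : ℝ) * z f + (p.length - (p.map Prod.fst).count f : ℝ) * ν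
      ≤ wordWeight z p := by
  induction p with
  | nil => simp
  | cons d p ih =>
    rw [wordWeight_cons, List.map_cons, List.count_cons, List.length_cons]
    by_cases h : d.1 = f
    · simp only [h, beq_self_eq_true, if_true]; push_cast; linarith
    · have := hν _ h
      simp only [h, beq_iff_eq, if_false]; push_cast; linarith

/-- The graph is a theta. In a cyclically reduced closed path at most half of the edges are `d`, and
every other edge has length at least `m - len d`, where `m` is the minimum; so each passage of `d`
costs at least `m`. The two cycles through `d` realise the two terms of the minimum. -/
theorem ratioSup_of_not_loop (hR : R.IsRose) (hc : Compat (G := X.toMarkedGraph) c)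
    (hloop : ∀ x : X.E × Bool, X.init x ≠ X.term x) {d d' : X.E × Bool}
    {β β' : R.E × Bool} (hd : c.dart d = [β]) (hd' : c.dart d' = [β']) (hne : β.1 ≠ β'.1)
    {γ : FreeGroup (Fin 2)} (hγ : IsConj (FreeGroup.mk [β]) (R.marking γ)) :
    X.ratioSup R (petalWeight β.1) * min (X.L γ) (X.len d.1 + X.len d'.1) = 1 := by
  classical
  have := X.finV
  have hγ1 := ne_one_of_petal hγ
  set m := min (X.L γ) (X.len d.1 + X.len d'.1) with hm
  have hm0 : 0 < m := lt_min (X.L_pos hγ1) (add_pos (X.len_pos _) (X.len_pos _))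
  obtain ⟨hLd, hLe⟩ := L_petal_le hR hc hd hγ
  have hmd : X.len d.1 ≤ m := le_min hLd (by linarith [X.len_pos d'.1])
  have hν : ∀ e, e ≠ d.1 → m - X.len d.1 ≤ X.len e := by
    intro e he
    rcases kernel_cover (X := X) hR hd hd' hne e with h | h | h
    · have := hLe e h
      have := min_le_left (X.L γ) (X.len d.1 + X.len d'.1)
      linarith
    · exact absurd h he
    · have := min_le_right (X.L γ) (X.len d.1 + X.len d'.1)
      rw [h]; linarith
  have hupper : ∀ δ, δ ≠ 1 → R.wlen (petalWeight β.1) δ * m ≤ X.L δ := by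
    intro δ hδ
    obtain ⟨v, hv⟩ := X.exists_represents_cyclicRep δ
    set p := X.cyclicRep δ with hp
    have h1 := wlen_le_pullback hR hc (petalWeight_nonneg β.1) hv
    have h2 : wordWeight (c.pullback (petalWeight β.1)) p
        = (((p.map Prod.fst).count d.1 : ℕ) : ℝ) := by
      rw [← wordWeight_petalWeight]
      congr 1
      ext e
      exact pullback_petalWeight c hd e
    -- By cyclic reducedness `p ++ p` never repeats `d` in succession, so `4 * count ≤ 2 * length +
    -- 1`; parity removes the `1`.
    have h3 : 2 * (p.map Prod.fst).count d.1 ≤ p.length := by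
      have hred := ((X.isCyclicallyReduced_cyclicRep δ).flatten_replicate 2).isReduced
      have hpp : (List.replicate 2 p).flatten = p ++ p := by simp [List.replicate]
      rw [hpp] at hred
      have h4 := isChain_edges_ne hloop (hv.1.append hv.1) hred
      have h5 := two_mul_count_le d.1 _ (h4.imp fun a b hab => fun h => hab (h.1.trans h.2.symm))
      rw [edges_append, List.count_append, List.length_append] at h5
      simp only [edges, List.length_map] at h5
      omega
    have h4 := wordWeight_ge_of_count hν p
    have h5 : X.L δ = wordWeight X.len p := L_eq_wlen X δ
    rw [h2] at h1
    have h6 : (2 * ((p.map Prod.fst).count d.1 : ℕ) : ℝ) ≤ p.length := by exact_mod_cast h3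
    have h7 := mul_le_mul_of_nonneg_right h1 hm0.le
    have h8 : 0 ≤ (p.length - 2 * ((p.map Prod.fst).count d.1 : ℕ) : ℝ) * (m - X.len d.1) :=
      mul_nonneg (by linarith) (by linarith)
    rw [h5]
    nlinarith
  rcases min_choice (X.L γ) (X.len d.1 + X.len d'.1) with h | h
  · refine ratioSup_mul_eq_one le_rfl hR hc (petalWeight_nonneg _) hm0 hupper hγ1 ?_ h.ge
    rw [hR.wlen_petal (petalWeight_nonneg _) hγ, petalWeight_self]
  -- This minimum is attained by the cycle of `d` and `d'`, suitably oriented; it closes up because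
  -- there are only two vertices.
  · have hcard := hc.card_vertices_le hR
    obtain ⟨x, hx, hxl⟩ : ∃ x : X.E × Bool, x.1 = d'.1 ∧ X.init x = X.term d := by
      by_cases h0 : X.init d' = X.term d
      · exact ⟨d', rfl, h0⟩
      · refine ⟨(d'.1, !d'.2), rfl, ?_⟩
        rw [init_flip]
        by_contra h1
        exact hloop d' (eq_of_ne_of_card_le_two hcard h0 h1)
    have hxt : X.term x = X.init d := by
      refine eq_of_ne_of_card_le_two hcard (z := X.term d) (fun h0 => hloop x ?_) (hloop d)
      rw [h0, hxl]
    have hp : X.IsPath (X.init d) [d, x] (X.init d) := ⟨rfl, hxl, hxt⟩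
    obtain ⟨δ, hδ⟩ := exists_represents_of_isPath (G := X.toMarkedGraph) hp
    obtain ⟨βx, hβx⟩ := c.exists_dart_eq (d := x) (by
      rw [hx]; exact c.not_mem_kernel_of_dart_eq hd')
    have hβx' : βx.1 = β'.1 := (c.edge_eq_iff hβx hd').1 hx
    have hδ' := (hc.represents_iff hR hp).1 hδ
    have hpath : c.path [d, x] = [β, βx] := by
      rw [c.path_cons, c.path_cons, hd, hβx]; rfl
    rw [hpath] at hδ'
    have hne' : β.1 ≠ βx.1 := hβx' ▸ hne
    refine ratioSup_mul_eq_one le_rfl hR hc (petalWeight_nonneg _) hm0 hupper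
      (ne_one_of_petal_pair hne' hδ') ?_ ?_
    · rw [wlen_eq (petalWeight_nonneg _) (hR.represents_iff (v := R.base).2 hδ')
        (isCyclicallyReduced_of_nodup (by simpa using hne'))]
      simp [petalWeight_nonneg]
    · refine (X.L_le hδ).trans ?_
      rw [hm, h]; simp [hx]

/-- In rank two, either all edges outside a spanning tree are loops, or the graph has no loops. -/
theorem loops_or_not_loops (hR : R.IsRose) (hc : Compat (G := X.toMarkedGraph) c)
    {d d' : X.E × Bool} {β β' : R.E × Bool} (hd : c.dart d = [β]) (hd' : c.dart d' = [β'])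
    (hne : β.1 ≠ β'.1) : (X.init d = X.term d ∧ X.init d' = X.term d') ∨
      ∀ x : X.E × Bool, X.init x ≠ X.term x := by
  have hcover := kernel_cover (X := X) hR hd hd' hne
  by_cases h : X.init d = X.term d
  · exact Or.inl ⟨h, hc.loop_of_loop hR
      (fun e => (hcover e).imp_right Or.symm) h⟩
  · by_cases h' : X.init d' = X.term d'
    · exact Or.inl ⟨hc.loop_of_loop hR hcover h', h'⟩
    · right
      have hflip : ∀ y x : X.E × Bool, X.init y ≠ X.term y → x.1 = y.1 →
          X.init x ≠ X.term x := by
        intro y x hy hx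
        rcases eq_or_eq_flip hx with rfl | rfl
        · exact hy
        · rw [init_flip, term_flip]; exact hy.symm
      intro x
      rcases hcover x.1 with hx | hx | hx
      · exact not_loop_of_mem_acyclic (G := X.toMarkedGraph) hc.acyclic hx
      · exact hflip d x h hx
      · exact hflip d' x h' hx

/-- In rank two, the ratios for single petals depend on the petal lengths and one more number. -/
theorem exists_ratioSup_mul_min (hR : R.IsRose) (hc : Compat (G := X.toMarkedGraph) c)
    {β β' : R.E × Bool} (hne : β.1 ≠ β'.1) {γ γ' : FreeGroup (Fin 2)}
    (hγ : IsConj (FreeGroup.mk [β]) (R.marking γ))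
    (hγ' : IsConj (FreeGroup.mk [β']) (R.marking γ')) :
    ∃ s, 0 < s ∧ X.ratioSup R (petalWeight β.1) * min (X.L γ) s = 1 ∧
      X.ratioSup R (petalWeight β'.1) * min (X.L γ') s = 1 := by
  obtain ⟨d, hd⟩ := c.exists_dart β
  obtain ⟨d', hd'⟩ := c.exists_dart β'
  rcases loops_or_not_loops hR hc hd hd' hne with ⟨h, h'⟩ | h
  · have h1 := X.L_pos (ne_one_of_petal hγ)
    have h2 := X.L_pos (ne_one_of_petal hγ')
    -- Any `s` not smaller than either length makes the minima equal to the petal lengths.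
    refine ⟨X.L γ + X.L γ', by positivity, ?_, ?_⟩
    · rw [min_eq_left (by linarith)]; exact ratioSup_of_loop hR hc hd h hγ
    · rw [min_eq_left (by linarith)]; exact ratioSup_of_loop hR hc hd' h' hγ'
  · refine ⟨X.len d.1 + X.len d'.1, add_pos (X.len_pos _) (X.len_pos _),
      ratioSup_of_not_loop hR hc h hd hd' hne hγ, ?_⟩
    rw [add_comm]
    exact ratioSup_of_not_loop hR hc h hd' hd hne.symm hγ'

/-- For lack of a third petal, each petal is shrunk in turn with `z` supported on the other one. The
known values of `ratioSup` turn this into the two equations of `mul_eq_mul_of_min_eq`. -/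
theorem L_mul_L_eq_of_two {X₁ X₂ : MarkedMetricGraph 2} {c₁ : Collapse X₁.toFinGraph R.toFinGraph}
    {c₂ : Collapse X₂.toFinGraph R.toFinGraph} (hR : R.IsRose)
    (hc₁ : Compat (G := X₁.toMarkedGraph) c₁)
    (hc₂ : Compat (G := X₂.toMarkedGraph) c₂) (hd : SameDist X₁ X₂ R) {β β' : R.E × Bool}
    {γ γ' : FreeGroup (Fin 2)} (hγ : IsConj (FreeGroup.mk [β]) (R.marking γ))
    (hγ' : IsConj (FreeGroup.mk [β']) (R.marking γ')) :
    X₁.L γ * X₂.L γ' = X₂.L γ * X₁.L γ' := by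
  by_cases hne : β.1 = β'.1
  · have h1 : β' = (β.1, β'.2) := Prod.ext hne.symm rfl
    rw [h1] at hγ'
    rw [L_petal_eq (X := X₁) hR hγ hγ', L_petal_eq (X := X₂) hR hγ hγ', mul_comm]
  · have h1 := L_mul_ratioSup_eq le_rfl hR hc₁ hc₂ hd hγ (petalWeight_nonneg β'.1)
      (petalWeight_of_ne hne)
    have h2 := L_mul_ratioSup_eq le_rfl hR hc₁ hc₂ hd hγ' (petalWeight_nonneg β.1)
      (petalWeight_of_ne (Ne.symm hne))
    obtain ⟨s₁, hs₁, e₁, e₁'⟩ := exists_ratioSup_mul_min hR hc₁ hne hγ hγ'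
    obtain ⟨s₂, hs₂, e₂, e₂'⟩ := exists_ratioSup_mul_min hR hc₂ hne hγ hγ'
    have p₁ := X₁.L_pos (ne_one_of_petal hγ)
    have p₁' := X₁.L_pos (ne_one_of_petal hγ')
    have p₂ := X₂.L_pos (ne_one_of_petal hγ)
    have p₂' := X₂.L_pos (ne_one_of_petal hγ')
    refine mul_eq_mul_of_min_eq (s := s₁) (s' := s₂) p₁' hs₁ p₁ p₂ p₂' hs₂ ?_ ?_
    · linear_combination (min (X₁.L γ') s₁ * min (X₂.L γ') s₂) * h1
        - (X₁.L γ * min (X₂.L γ') s₂) * e₁' + (X₂.L γ * min (X₁.L γ') s₁) * e₂'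
    · linear_combination (min (X₁.L γ) s₁ * min (X₂.L γ) s₂) * h2
        - (X₁.L γ' * min (X₂.L γ) s₂) * e₁ + (X₂.L γ' * min (X₁.L γ) s₁) * e₂

end MarkedMetricGraph

/-! ### Lengths of figure-eights and barbells -/

theorem isCyclicallyReduced_of_separated {α : Type*} {a k b : List (α × Bool)} (ha : a ≠ [])
    (hb : b ≠ []) (h : (a.map Prod.fst ++ k.map Prod.fst ++ b.map Prod.fst).Nodup) :
    FreeGroup.IsCyclicallyReduced (a ++ k ++ b ++ FreeGroup.invRev k) := by
  have hab : ∀ x ∈ a, ∀ y ∈ b, x.1 ≠ y.1 := fun x hx y hy he => by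
    have h1 : x.1 ∈ a.map Prod.fst := List.mem_map_of_mem hx
    have h2 : y.1 ∈ b.map Prod.fst := List.mem_map_of_mem hy
    grind
  have hak : ∀ x ∈ a, ∀ y ∈ FreeGroup.invRev k, x.1 ≠ y.1 := fun x hx y hy he => by
    have h1 : x.1 ∈ a.map Prod.fst := List.mem_map_of_mem hx
    have h2 : y.1 ∈ k.map Prod.fst := List.mem_map.2 ⟨_, FinGraph.mem_invRev_iff.1 hy, rfl⟩
    grind
  have hbk : ∀ x ∈ b, ∀ y ∈ FreeGroup.invRev k, x.1 ≠ y.1 := fun x hx y hy he => by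
    have h1 : x.1 ∈ b.map Prod.fst := List.mem_map_of_mem hx
    have h2 : y.1 ∈ k.map Prod.fst := List.mem_map.2 ⟨_, FinGraph.mem_invRev_iff.1 hy, rfl⟩
    grind
  have hred : FreeGroup.IsReduced (a ++ k ++ b) :=
    isReduced_of_nodup (by rwa [List.map_append, List.map_append])
  have hk : FreeGroup.IsReduced k := hred.infix ⟨a, b, rfl⟩
  refine ⟨isReduced_append_iff.2 ⟨hred, isReduced_invRev hk, fun x hx y hy he => ?_⟩,
    fun x hx y hy he => ?_⟩
  · rw [List.getLast?_append_of_ne_nil _ hb] at hx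
    exact absurd he (hbk x (List.mem_of_mem_getLast? hx) y (List.mem_of_mem_head? hy))
  · have hy' : y ∈ a := by
      rw [List.append_assoc, List.append_assoc, List.head?_append_of_ne_nil _ ha] at hy
      exact List.mem_of_mem_head? hy
    have hx' : x ∈ b ++ FreeGroup.invRev k := by
      rw [List.append_assoc, List.getLast?_append_of_ne_nil _ (by simp [hb])] at hx
      exact List.mem_of_mem_getLast? hx
    rcases List.mem_append.1 hx' with hx' | hx'
    · exact absurd he.symm (hab y hy' x hx')
    · exact absurd he.symm (hak y hy' x hx')

namespace MarkedMetricGraph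

open MarkedGraph FinGraph

section cost

variable {n : ℕ} {X : MarkedMetricGraph n} {R : MarkedGraph n}
  {c : Collapse X.toFinGraph R.toFinGraph}

/-- Weighted length is linear in the weights. Convex combinations stand for base points in the
interior of an arc, where no vertex is available. -/
theorem IsCost.convex {K K' : R.E → ℝ} (hK : X.IsCost R K) (hK' : X.IsCost R K') {s t : ℝ}
    (hs : 0 ≤ s) (ht : 0 ≤ t) (hst : s + t = 1) : X.IsCost R fun b => s * K b + t * K' b := by
  refine ⟨fun b => add_nonneg (mul_nonneg hs (hK.1 b)) (mul_nonneg ht (hK'.1 b)), fun γ => ?_⟩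
  rw [wlen_add, wlen_smul, wlen_smul]
  have h1 := mul_le_mul_of_nonneg_left (hK.2 γ) hs
  have h2 := mul_le_mul_of_nonneg_left (hK'.2 γ) ht
  have h3 : X.L γ = s * X.L γ + t * X.L γ := by rw [← add_mul, hst, one_mul]
  linarith

theorem L_of_isSimpleClosed (hR : R.IsRose) (hc : Compat (G := X.toMarkedGraph) c) {v : X.V}
    {p : List (X.E × Bool)} (hp : X.IsSimpleClosed v p) {γ : FreeGroup (Fin n)}
    (h : IsConj (FreeGroup.mk (c.path p)) (R.marking γ)) : X.L γ = wordWeight X.len p := by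
  rw [L_eq_wlen]
  exact wlen_eq X.len_nonneg ((hc.represents_iff hR hp.2.1).2 h)
    (isCyclicallyReduced_of_nodup hp.2.2.2)

theorem L_of_isSeparated (hR : R.IsRose) (hc : Compat (G := X.toMarkedGraph) c)
    {β β' : R.E × Bool} {γ : FreeGroup (Fin n)}
    (h : IsConj (FreeGroup.mk [β, β']) (R.marking γ)) {v w : X.V} {a k b : List (X.E × Bool)}
    (hs : X.IsSeparated v w a k b) (ha : c.path a = [β]) (hk : c.path k = [])
    (hb : c.path b = [β']) :
    X.L γ = wordWeight X.len a + wordWeight X.len b + 2 * wordWeight X.len k := by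
  rw [L_eq_wlen, wlen_eq X.len_nonneg
    (MarkedGraph.IsSeparated.represents (G := X.toMarkedGraph) hR hc h hs ha hk hb)
    (isCyclicallyReduced_of_separated hs.left.1 hs.right.1 hs.edges_nodup)]
  simp only [wordWeight_append, wordWeight_invRev]
  ring

/-- The cost function of a figure-eight or barbell curve, as the curve is seen from the point that
balances the costs of its two loops. -/
theorem exists_isCost_of_isSeparated (hR : R.IsRose) (hc : Compat (G := X.toMarkedGraph) c)
    {β β' : R.E × Bool} (hne : β.1 ≠ β'.1) {γ γ₁ γ₂ : FreeGroup (Fin n)}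
    (h : IsConj (FreeGroup.mk [β, β']) (R.marking γ))
    (h₁ : IsConj (FreeGroup.mk [β]) (R.marking γ₁))
    (h₂ : IsConj (FreeGroup.mk [β']) (R.marking γ₂)) {v w : X.V} {a k b : List (X.E × Bool)}
    (hs : X.IsSeparated v w a k b) (ha : c.path a = [β]) (hk : c.path k = [])
    (hb : c.path b = [β']) :
    ∃ K, X.IsCost R K ∧ K β.1 = X.L γ / (X.L γ₁ + X.L γ₂) * X.L γ₁ ∧
      K β'.1 = X.L γ / (X.L γ₁ + X.L γ₂) * X.L γ₂ := by
  have hL := L_of_isSeparated hR hc h hs ha hk hb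
  have hL₁ := L_of_isSimpleClosed hR hc hs.left (by rwa [ha])
  have hL₂ := L_of_isSimpleClosed hR hc hs.right (by rwa [hb])
  rw [← hL₁, ← hL₂] at hL
  have hp₁ := X.L_pos (ne_one_of_petal h₁)
  have hp₂ := X.L_pos (ne_one_of_petal h₂)
  have hk' := path_invRev_of_path_eq_nil (G := X.toMarkedGraph) hk
  have hcost : ∀ {u : X.V} {p q : List (X.E × Bool)}, X.IsPath u p u → X.IsPath u q u →
      c.path p = [β] → c.path q = [β'] → ∃ K, X.IsCost R K ∧
        K β.1 = wordWeight X.len p ∧ K β'.1 = wordWeight X.len q := by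
    intro u p q hp hq hpβ hqβ
    obtain ⟨K, hK, hKP⟩ := exists_isCost hR hc u (fun x y =>
      (x = β.1 → y = wordWeight X.len p) ∧ (x = β'.1 → y = wordWeight X.len q)) fun x => by
        by_cases hx : x = β.1
        · refine Or.inr ⟨p, hp, ⟨β.2, ?_⟩, fun _ => rfl, fun h => absurd (hx.symm.trans h) hne⟩
          rw [c.hom_mk, hpβ, hx]
        · by_cases hx' : x = β'.1
          · refine Or.inr ⟨q, hq, ⟨β'.2, ?_⟩, fun h => absurd h hx, fun _ => rfl⟩
            rw [c.hom_mk, hqβ, hx']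
          · exact Or.inl fun y => ⟨fun h => absurd h hx, fun h => absurd h hx'⟩
    exact ⟨K, hK, (hKP _).1 rfl, (hKP _).2 rfl⟩
  -- Seen from `v`, the loop at `w` costs twice the arc in addition; seen from `w`, the loop at `v`
  -- does.
  obtain ⟨K, hK, hKβ, hKβ'⟩ := hcost (q := k ++ b ++ FreeGroup.invRev k) hs.left.2.1
    ((hs.arc.append hs.right.2.1).append hs.arc.invRev) ha (by simp [hk, hb, hk'])
  obtain ⟨K', hK', hKβ₂, hKβ₂'⟩ := hcost (p := FreeGroup.invRev k ++ a ++ k)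
    ((hs.arc.invRev.append hs.left.2.1).append hs.arc) hs.right.2.1 (by simp [hk, ha, hk']) hb
  simp only [wordWeight_append, wordWeight_invRev, ← hL₁, ← hL₂] at hKβ hKβ' hKβ₂ hKβ₂'
  have hp : 0 < X.L γ₁ + X.L γ₂ := add_pos hp₁ hp₂
  -- These coefficients make the two costs proportional to the lengths of the loops; they correspond
  -- to the point that divides the arc from `v` to `w` in the ratio `L γ₁ : L γ₂`.
  refine ⟨_, hK.convex hK' (s := X.L γ₂ / (X.L γ₁ + X.L γ₂)) (t := X.L γ₁ / (X.L γ₁ + X.L γ₂))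
    (by positivity) (by positivity) (by field_simp; ring), ?_, ?_⟩
  · rw [hKβ, hKβ₂, hL]; field_simp; ring
  · rw [hKβ', hKβ₂', hL]; field_simp; ring

end cost

section pair

/-- In rank at least three, the distances to a rose and the petal lengths determine the lengths of
figure-eight and barbell curves. -/
theorem L_eq_of_isSeparated_of_three_le {n : ℕ} {X₁ X₂ : MarkedMetricGraph n} {R : MarkedGraph n}
    {c₁ : Collapse X₁.toFinGraph R.toFinGraph} {c₂ : Collapse X₂.toFinGraph R.toFinGraph}
    (hn : 3 ≤ n) (hR : R.IsRose) (hc₁ : Compat (G := X₁.toMarkedGraph) c₁)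
    (hc₂ : Compat (G := X₂.toMarkedGraph) c₂) (hd : SameDist X₁ X₂ R)
    {β β' : R.E × Bool} (hne : β.1 ≠ β'.1) {γ γ₁ γ₂ : FreeGroup (Fin n)}
    (h : IsConj (FreeGroup.mk [β, β']) (R.marking γ))
    (h₁ : IsConj (FreeGroup.mk [β]) (R.marking γ₁))
    (h₂ : IsConj (FreeGroup.mk [β']) (R.marking γ₂))
    (e₁ : X₁.L γ₁ = X₂.L γ₁) (e₂ : X₁.L γ₂ = X₂.L γ₂)
    {v₁ w₁ : X₁.V} {a₁ k₁ b₁ : List (X₁.E × Bool)} (hs₁ : X₁.IsSeparated v₁ w₁ a₁ k₁ b₁)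
    (ha₁ : c₁.path a₁ = [β]) (hk₁ : c₁.path k₁ = []) (hb₁ : c₁.path b₁ = [β'])
    {v₂ w₂ : X₂.V} {a₂ k₂ b₂ : List (X₂.E × Bool)} (hs₂ : X₂.IsSeparated v₂ w₂ a₂ k₂ b₂)
    (ha₂ : c₂.path a₂ = [β]) (hk₂ : c₂.path k₂ = []) (hb₂ : c₂.path b₂ = [β']) :
    X₁.L γ = X₂.L γ := by
  classical
  have hn2 : 2 ≤ n := by omega
  obtain ⟨x, hx, hx'⟩ := exists_third_petal hn hR β.1 β'.1
  obtain ⟨K₁, hK₁, hβ₁, hβ₁'⟩ := exists_isCost_of_isSeparated hR hc₁ hne h h₁ h₂ hs₁ ha₁ hk₁ hb₁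
  obtain ⟨K₂, hK₂, hβ₂, hβ₂'⟩ := exists_isCost_of_isSeparated hR hc₂ hne h h₁ h₂ hs₂ ha₂ hk₂ hb₂
  rw [← e₁, ← e₂] at hβ₂ hβ₂'
  have hγ := ne_one_of_petal_pair hne h
  have p₁ := X₁.L_pos (ne_one_of_petal h₁)
  have p₂ := X₁.L_pos (ne_one_of_petal h₂)
  have p := add_pos p₁ p₂
  -- Away from the two shrinking petals the value only has to be positive.
  set z₀ : R.E → ℝ := fun b => if b = β.1 then X₁.L γ₁ else X₁.L γ₂ with hz₀
  have hzβ : z₀ β.1 = X₁.L γ₁ := by simp [hz₀]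
  have hzβ' : z₀ β'.1 = X₁.L γ₂ := by simp [hz₀, hne.symm]
  have hw : wordWeight z₀ [β, β'] = X₁.L γ₁ + X₁.L γ₂ := by simp [hzβ, hzβ']
  have key := mul_ratioSup_eq_of_small hn2 hR hc₁ hc₂ hd (S := {β.1, β'.1}) (z₀ := z₀)
    (z := petalWeight x) (fun b => by simp only [hz₀]; split_ifs <;> assumption)
    (div_pos (X₁.L_pos hγ) p) (div_pos (X₂.L_pos hγ) p) hK₁ hK₂
    (by rintro b (rfl | rfl); exacts [(hβ₁.trans (by rw [hzβ])).le, (hβ₁'.trans (by rw [hzβ'])).le])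
    (by rintro b (rfl | rfl); exacts [(hβ₂.trans (by rw [hzβ])).le, (hβ₂'.trans (by rw [hzβ'])).le])
    (w := [β, β']) (by simp) hγ h (by rw [hw, div_mul_cancel₀ _ p.ne'])
    (by rw [hw, div_mul_cancel₀ _ p.ne']) (petalWeight_nonneg x)
    (by rintro b (rfl | rfl); exacts [petalWeight_of_ne hx.symm, petalWeight_of_ne hx'.symm])
  -- Shrinking `β` alone with the same `z` shows, the petal lengths being equal, that `X₁` and `X₂`
  -- have the same `ratioSup`, which then cancels from `key`.
  have h3 := L_mul_ratioSup_eq hn2 hR hc₁ hc₂ hd h₁ (petalWeight_nonneg x)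
    (petalWeight_of_ne hx.symm)
  rw [← e₁] at h3
  rw [mul_left_cancel₀ p₁.ne' h3] at key
  have hpos := ratioSup_pos hR hc₂ (petalWeight_nonneg x) (b := x) (by simp)
  exact (div_left_inj' p.ne').1 (mul_right_cancel₀ hpos.ne' key)

variable {X : MarkedMetricGraph 2} {R : MarkedGraph 2} {c : Collapse X.toFinGraph R.toFinGraph}

/-- In a graph without loops every simple closed curve has at least two vertices, so two separated
ones would need three in all, but there are at most two. -/
theorem loops_of_isSeparated (hR : R.IsRose) (hc : Compat (G := X.toMarkedGraph) c)
    {d d' : X.E × Bool} {β β' : R.E × Bool} (hd : c.dart d = [β]) (hd' : c.dart d' = [β'])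
    (hne : β.1 ≠ β'.1) {v w : X.V} {a k b : List (X.E × Bool)}
    (hs : X.IsSeparated v w a k b) : X.init d = X.term d ∧ X.init d' = X.term d' := by
  refine (loops_or_not_loops hR hc hd hd' hne).resolve_right fun hloop => ?_
  have hlen : ∀ {u : X.V} {p : List (X.E × Bool)}, X.IsSimpleClosed u p →
      1 ≤ (X.verts p).tail.length := by
    rintro u p ⟨hp, hpath, -⟩
    match p, hp, hpath with
    | [x], _, hpath => exact absurd (hpath.1.trans (show X.term x = u from hpath.2).symm) (hloop x)
    | x :: y :: p, _, _ => simp [verts]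
  have := X.finV
  have := Fintype.ofFinite X.V
  have h1 := hs.verts_nodup.length_le_card
  have h2 := hc.card_vertices_le hR
  rw [Nat.card_eq_fintype_card] at h2
  have h3 := hlen hs.left
  have h4 := hlen hs.right
  simp only [List.length_append, support, List.length_singleton] at h1
  omega

/-- The weights pulled back to `X` do not exceed the edge lengths, so no class is longer on the
rose, and the petal `γ₁` keeps its length. -/
theorem ratioSup_eq_one_of_loops (hR : R.IsRose) (hc : Compat (G := X.toMarkedGraph) c)
    {d d' : X.E × Bool} {β β' : R.E × Bool} (hd : c.dart d = [β]) (hd' : c.dart d' = [β'])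
    (hne : β.1 ≠ β'.1) (hloop : X.init d = X.term d) (hloop' : X.init d' = X.term d')
    {γ₁ γ₂ : FreeGroup (Fin 2)} (h₁ : IsConj (FreeGroup.mk [β]) (R.marking γ₁))
    (h₂ : IsConj (FreeGroup.mk [β']) (R.marking γ₂)) {y : R.E → ℝ} (hy : ∀ b, 0 < y b)
    (hyβ : y β.1 = X.L γ₁) (hyβ' : y β'.1 = X.L γ₂) : X.ratioSup R y = 1 := by
  have hy0 : ∀ b, 0 ≤ y b := fun b => (hy b).le
  have hne₁ := ne_one_of_petal h₁
  refine le_antisymm (ratioSup_le le_rfl fun δ _ => ?_) ?_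
  · obtain ⟨v, hv⟩ := X.exists_represents_cyclicRep δ
    rw [one_mul, L_eq_wlen X δ]
    refine (wlen_le_pullback hR hc hy0 hv).trans (wordWeight_mono fun x _ => ?_)
    rcases kernel_cover (X := X) hR hd hd' hne x.1 with hx | hx | hx
    · rw [c.pullback_of_mem_kernel hx]; exact X.len_nonneg _
    · rw [hx, c.pullback_of_dart_eq hd, hyβ]; exact L_le_len_of_loop hR hc hd hloop h₁
    · rw [hx, c.pullback_of_dart_eq hd', hyβ']; exact L_le_len_of_loop hR hc hd' hloop' h₂
  · have h := le_ratioSup (X := X) hR hc hy0 γ₁ hne₁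
    rw [hR.wlen_petal hy0 h₁, hyβ] at h
    exact le_of_mul_le_mul_right (by rwa [one_mul]) (X.L_pos hne₁)

/-- In rank two, the distances to a rose and the petal lengths determine the lengths of
figure-eight and barbell curves. -/
theorem L_eq_of_isSeparated_of_two {X₁ X₂ : MarkedMetricGraph 2}
    {c₁ : Collapse X₁.toFinGraph R.toFinGraph} {c₂ : Collapse X₂.toFinGraph R.toFinGraph}
    (hR : R.IsRose) (hc₁ : Compat (G := X₁.toMarkedGraph) c₁)
    (hc₂ : Compat (G := X₂.toMarkedGraph) c₂) (hd : SameDist X₁ X₂ R)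
    {β β' : R.E × Bool} (hne : β.1 ≠ β'.1) {γ γ₁ γ₂ : FreeGroup (Fin 2)}
    (h : IsConj (FreeGroup.mk [β, β']) (R.marking γ))
    (h₁ : IsConj (FreeGroup.mk [β]) (R.marking γ₁))
    (h₂ : IsConj (FreeGroup.mk [β']) (R.marking γ₂))
    (e₁ : X₁.L γ₁ = X₂.L γ₁) (e₂ : X₁.L γ₂ = X₂.L γ₂)
    {v₁ w₁ : X₁.V} {a₁ k₁ b₁ : List (X₁.E × Bool)} (hs₁ : X₁.IsSeparated v₁ w₁ a₁ k₁ b₁)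
    (ha₁ : c₁.path a₁ = [β]) (hk₁ : c₁.path k₁ = []) (hb₁ : c₁.path b₁ = [β'])
    {v₂ w₂ : X₂.V} {a₂ k₂ b₂ : List (X₂.E × Bool)} (hs₂ : X₂.IsSeparated v₂ w₂ a₂ k₂ b₂)
    (ha₂ : c₂.path a₂ = [β]) (hk₂ : c₂.path k₂ = []) (hb₂ : c₂.path b₂ = [β']) :
    X₁.L γ = X₂.L γ := by
  classical
  obtain ⟨K₁, hK₁, hβ₁, hβ₁'⟩ := exists_isCost_of_isSeparated hR hc₁ hne h h₁ h₂ hs₁ ha₁ hk₁ hb₁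
  obtain ⟨K₂, hK₂, hβ₂, hβ₂'⟩ := exists_isCost_of_isSeparated hR hc₂ hne h h₁ h₂ hs₂ ha₂ hk₂ hb₂
  rw [← e₁, ← e₂] at hβ₂ hβ₂'
  have hγ := ne_one_of_petal_pair hne h
  have p₁ := X₁.L_pos (ne_one_of_petal h₁)
  have p₂ := X₁.L_pos (ne_one_of_petal h₂)
  have p := add_pos p₁ p₂
  -- The two petals are all petals of the rose, so no limit is taken: `y` is itself a metric on `R`,
  -- and `ratioSup` takes the value `1` there for both graphs.
  set y : R.E → ℝ := fun b => if b = β.1 then X₁.L γ₁ else X₁.L γ₂ with hydef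
  have hyβ : y β.1 = X₁.L γ₁ := by simp [hydef]
  have hyβ' : y β'.1 = X₁.L γ₂ := by simp [hydef, hne.symm]
  have hy : ∀ b, 0 < y b := fun b => by simp only [hydef]; split_ifs <;> assumption
  have hw : wordWeight y [β, β'] = X₁.L γ₁ + X₁.L γ₂ := by simp [hyβ, hyβ']
  have key := mul_ratioSup_eq le_rfl hR hc₁ hc₂ hd hy
    (div_pos (X₁.L_pos hγ) p) (div_pos (X₂.L_pos hγ) p) hK₁ hK₂
    (fun b => by
      rcases eq_or_eq_of_ne hR hne b with rfl | rfl
      exacts [(hβ₁.trans (by rw [hyβ])).le, (hβ₁'.trans (by rw [hyβ'])).le])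
    (fun b => by
      rcases eq_or_eq_of_ne hR hne b with rfl | rfl
      exacts [(hβ₂.trans (by rw [hyβ])).le, (hβ₂'.trans (by rw [hyβ'])).le])
    (w := [β, β']) hγ h (by rw [hw, div_mul_cancel₀ _ p.ne']) (by rw [hw, div_mul_cancel₀ _ p.ne'])
  obtain ⟨d₁, hd₁⟩ := c₁.exists_dart β
  obtain ⟨d₁', hd₁'⟩ := c₁.exists_dart β'
  obtain ⟨d₂, hd₂⟩ := c₂.exists_dart β
  obtain ⟨d₂', hd₂'⟩ := c₂.exists_dart β'
  obtain ⟨l₁, l₁'⟩ := loops_of_isSeparated hR hc₁ hd₁ hd₁' hne hs₁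
  obtain ⟨l₂, l₂'⟩ := loops_of_isSeparated hR hc₂ hd₂ hd₂' hne hs₂
  rw [ratioSup_eq_one_of_loops hR hc₁ hd₁ hd₁' hne l₁ l₁' h₁ h₂ hy hyβ hyβ',
    ratioSup_eq_one_of_loops hR hc₂ hd₂ hd₂' hne l₂ l₂' h₁ h₂ hy (hyβ.trans e₁) (hyβ'.trans e₂),
    mul_one, mul_one] at key
  exact (div_left_inj' p.ne').1 key

end pair

end MarkedMetricGraph

/-! ### Conclusion -/

namespace MarkedMetricGraph

open MarkedGraph FinGraph

variable {n : ℕ}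

/-- A point of the simplex of `G` is represented, with the same lengths, by a metric on `G`. -/
theorem exists_metric_of_mem_simplex {X : MarkedMetricGraph n} {G : MarkedGraph n}
    (h : CV.mk X ∈ G.simplex) : ∃ (l : G.E → ℝ) (hl : ∀ e, 0 < l e),
      CV.mk X = CV.mk { toMarkedGraph := G, len := l, len_pos := hl } ∧
      ∀ γ, X.L γ = L { toMarkedGraph := G, len := l, len_pos := hl } γ := by
  obtain ⟨l, hl, h⟩ := h
  have h' : Equivalent { toMarkedGraph := G, len := l, len_pos := hl } X := Quotient.exact h.symm
  obtain ⟨r, hr, hL⟩ := exists_L_eq_mul h'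
  refine ⟨fun e => r * l e, fun e => mul_pos hr (hl e), h.trans (Quotient.sound ?_), fun γ => ?_⟩
  · exact ⟨GraphIso.refl _, G.isoCompatible_refl, r, hr, fun d => rfl⟩
  · rw [hL, L_eq_wlen, L_eq_wlen]
    exact (wlen_smul r l γ).symm

variable {X₁ X₂ : MarkedMetricGraph n} {G : MarkedGraph n}

/-- The quotient of the two lengths is constant on the petals of each rose face, hence on all simple
loops, and equals `1` at `γ₀`. -/
theorem L_eq_of_isSimpleLoop (hn : 2 ≤ n) (h₁ : G.roseFaces = X₁.roseFaces)
    (h₂ : G.roseFaces = X₂.roseFaces)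
    (hd : ∀ R : MarkedGraph n, R.IsRose → R.IsFaceOf G → SameDist X₁ X₂ R)
    {γ₀ γ : FreeGroup (Fin n)} (hγ₀ : G.IsSimpleLoop γ₀) (e₁ : X₁.L γ₀ = 1) (e₂ : X₂.L γ₀ = 1)
    (hγ : G.IsSimpleLoop γ) : X₁.L γ = X₂.L γ := by
  have h := eq_of_isSimpleLoop hn (fun γ => X₁.L γ / X₂.L γ) ?_ hγ hγ₀
  · have h0 : X₁.L γ / X₂.L γ = 1 := h.trans (by rw [e₁, e₂, div_one])
    by_cases hne : X₂.L γ = 0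
    · rw [hne, div_zero] at h0; exact absurd h0 zero_ne_one
    · exact (div_eq_one_iff_eq hne).1 h0
  · intro R hR hRG β β' δ δ' hδ hδ'
    obtain ⟨c₁, hc₁⟩ := (hRG.of_roseFaces_eq h₁ hR).exists_compat
    obtain ⟨c₂, hc₂⟩ := (hRG.of_roseFaces_eq h₂ hR).exists_compat
    have hmul : X₁.L δ * X₂.L δ' = X₂.L δ * X₁.L δ' := by
      obtain rfl | hn3 := hn.eq_or_lt
      · exact L_mul_L_eq_of_two hR hc₁ hc₂ (hd R hR hRG) hδ hδ'
      · exact L_mul_L_eq_of_three_le hn3 hR hc₁ hc₂ (hd R hR hRG) hδ hδ'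
    change X₁.L δ / X₂.L δ = X₁.L δ' / X₂.L δ'
    rw [div_eq_div_iff (X₂.L_pos (ne_one_of_petal hδ)).ne' (X₂.L_pos (ne_one_of_petal hδ')).ne',
      hmul, mul_comm]

theorem L_eq_of_isAlmostSimple (hn : 2 ≤ n) (h₁ : G.roseFaces = X₁.roseFaces)
    (h₂ : G.roseFaces = X₂.roseFaces)
    (hd : ∀ R : MarkedGraph n, R.IsRose → R.IsFaceOf G → SameDist X₁ X₂ R)
    {γ₀ γ : FreeGroup (Fin n)} (hγ₀ : G.IsSimpleLoop γ₀) (e₁ : X₁.L γ₀ = 1) (e₂ : X₂.L γ₀ = 1)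
    (hγ : G.IsAlmostSimple γ) : X₁.L γ = X₂.L γ := by
  have hsimple := fun {δ : FreeGroup (Fin n)} =>
    L_eq_of_isSimpleLoop (γ := δ) hn h₁ h₂ hd hγ₀ e₁ e₂
  by_cases hγs : G.IsSimpleLoop γ
  · exact hsimple hγs
  obtain ⟨v, w, a, k, b, hs, hp⟩ := hγ.cases.resolve_left hγs
  obtain ⟨T, hT, β, β', hne, hβ⟩ := exists_petal_pair_of_isSeparated hn hs hp
  have hR := G.isRose_roseOf hn hT
  have hRG := G.isFaceOf_roseOf hn hT
  obtain ⟨c₁, hc₁⟩ := (hRG.of_roseFaces_eq h₁ hR).exists_compat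
  obtain ⟨c₂, hc₂⟩ := (hRG.of_roseFaces_eq h₂ hR).exists_compat
  -- A simple loop of `X₁` or `X₂` would be one of `G`, so in both graphs the product of the two
  -- petals is a figure-eight or barbell.
  obtain ⟨v₁, w₁, a₁, k₁, b₁, hs₁, ha₁, hk₁, hb₁⟩ := (hc₁.isSimpleLoop_or_isSeparated hn hR hne hβ
    (hγ.expSum_of_roseFaces_eq h₁)).resolve_left fun h => hγs (h.of_roseFaces_eq hn h₁.symm)
  obtain ⟨v₂, w₂, a₂, k₂, b₂, hs₂, ha₂, hk₂, hb₂⟩ := (hc₂.isSimpleLoop_or_isSeparated hn hR hne hβ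
    (hγ.expSum_of_roseFaces_eq h₂)).resolve_left fun h => hγs (h.of_roseFaces_eq hn h₂.symm)
  obtain ⟨γ₁, hγ₁⟩ := exists_petal_class hR β
  obtain ⟨γ₂, hγ₂⟩ := exists_petal_class hR β'
  have hc := G.compat_roseCollapse hn hT
  have f₁ := hsimple (hc.isSimpleLoop hR hγ₁)
  have f₂ := hsimple (hc.isSimpleLoop hR hγ₂)
  obtain rfl | hn3 := hn.eq_or_lt
  · exact L_eq_of_isSeparated_of_two hR hc₁ hc₂ (hd _ hR hRG) hne hβ hγ₁ hγ₂ f₁ f₂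
      hs₁ ha₁ hk₁ hb₁ hs₂ ha₂ hk₂ hb₂
  · exact L_eq_of_isSeparated_of_three_le hn3 hR hc₁ hc₂ (hd _ hR hRG) hne hβ hγ₁ hγ₂ f₁ f₂
      hs₁ ha₁ hk₁ hb₁ hs₂ ha₂ hk₂ hb₂

end MarkedMetricGraph

theorem theorem6 (n : ℕ) (hn : 2 ≤ n) (G₁ G₂ : MarkedGraph n)
    (hfaces : G₁.roseFaces = G₂.roseFaces)
    (γ₀ : FreeGroup (Fin n)) (hγ₀ : G₁.IsSimpleLoop γ₀) :
    G₂.IsSimpleLoop γ₀ ∧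
    (∀ γ : FreeGroup (Fin n), G₁.IsAlmostSimple γ → G₂.IsAlmostSimple γ) ∧
    ∀ X₁ X₂ : MarkedMetricGraph n,
      CV.mk X₁ ∈ G₁.simplex ∪ G₂.simplex →
      CV.mk X₂ ∈ G₁.simplex ∪ G₂.simplex →
      X₁.L γ₀ = 1 → X₂.L γ₀ = 1 →
      (∀ S ∈ G₁.roseFaces, ∀ Y ∈ S, CV.dist (CV.mk X₁) Y = CV.dist (CV.mk X₂) Y) →
      ∀ γ : FreeGroup (Fin n), G₁.IsAlmostSimple γ → X₁.L γ = X₂.L γ := by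
  refine ⟨hγ₀.of_roseFaces_eq hn hfaces, fun γ hγ => hγ.of_roseFaces_eq hn hfaces, ?_⟩
  intro X₁ X₂ hX₁ hX₂ e₁ e₂ hd γ hγ
  have key : ∀ X : MarkedMetricGraph n, CV.mk X ∈ G₁.simplex ∪ G₂.simplex →
      ∃ X' : MarkedMetricGraph n, G₁.roseFaces = X'.roseFaces ∧ CV.mk X = CV.mk X' ∧
        ∀ γ, X.L γ = X'.L γ := by
    rintro X (hX | hX)
    · obtain ⟨l, hl, h, hL⟩ := MarkedMetricGraph.exists_metric_of_mem_simplex hX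
      exact ⟨_, rfl, h, hL⟩
    · obtain ⟨l, hl, h, hL⟩ := MarkedMetricGraph.exists_metric_of_mem_simplex hX
      exact ⟨_, hfaces, h, hL⟩
  obtain ⟨Y₁, h₁, hY₁, hL₁⟩ := key X₁ hX₁
  obtain ⟨Y₂, h₂, hY₂, hL₂⟩ := key X₂ hX₂
  rw [hL₁] at e₁ ⊢
  rw [hL₂] at e₂ ⊢
  rw [hY₁, hY₂] at hd
  refine MarkedMetricGraph.L_eq_of_isAlmostSimple hn h₁ h₂ (fun R hR hRG y hy => ?_) hγ₀ e₁ e₂ hγ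
  exact hd R.simplex ⟨R, hR, hRG, rfl⟩ (CV.mk (MarkedMetricGraph.rose R y hy)) ⟨y, hy, rfl⟩
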